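/- Let $\mathbf k$ be an algebraically closed field of characteristic zero, $n>1$, $\mathfrak g=\mathfrak{sl}_n(\mathbf k)$ with its diagonal Cartan subalgebra $\mathfrak h$, roots $\varepsilon_i-\varepsilon_j$ and simple roots $\alpha_i=\varepsilon_i-\varepsilon_{i+1}$. Let $\mathscr J^+,\mathscr J^-$ be two partitions of $[1,n]$ into intervals, and let $\pi^\pm$ be the set of $\alpha_i$ such that $i,i+1$ lie in one interval of $\mathscr J^\pm$; assume that $\pi^+\cup\pi^-$ contains all simple roots. Let $\mathfrak q\subset\mathfrak g$ be the biparabolic subalgebra containing $\mathfrak h$ whose positive (resp. negative) roots are the positive (resp. negative) roots in $\mathbb Z\pi^-$ (resp. $\mathbb Z\pi^+$), and let $\mathfrak q_\Lambda$ be its canonical truncation, i.e. the common kernel in $\mathfrak q$ of the weights of all semi-invariants of the symmetric algebra $S(\mathfrak q)$. Set $\mathfrak h_\Lambda=\mathfrak h\cap\mathfrak q_\Lambda$. For a Lie algebra $\mathfrak a$, a form $f\in\mathfrak a^*$ is regular if its stabilizer for the coadjoint action has the least possible dimension, and an adapted pair is a pair $(h,\eta)\in\mathfrak a\times\mathfrak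 a^*$ with $\eta$ regular and $(\operatorname{ad}h)\eta=-\eta$. Identify $\mathfrak g^*$ with $\mathfrak g$ through the Killing form; $y\in\mathfrak g^*$ is nilpotent if it is ad-nilpotent as an element of $\mathfrak g$. Consider the following sets $S$ of roots. (1) Markings. Let $\iota^\pm$ be the involution of $\pi^\pm$ reversing each connected component. An arc above (resp. below) is an orbit $\{\alpha,\iota^+(\alpha)\}$, $\alpha\in\pi^+$ (resp. $\{\alpha,\iota^-(\alpha)\}$, $\alpha\in\pi^-$). On each connected component of the graph on the simple roots formed by all these arcs, mark exactly one arc; if the component contains arcs consisting of a single simple root (fixed by $\iota^+$ or $\iota^-$), the marked arc has to be one of those. (2) Modified involutions. Let $\kappa^\pm$ be the involution of $[1,n]$ reversing each interval of $\mathscr J^\pm$. A mark on the arc above (below) joining $\alpha_i$ and $\alpha_j$, $i\le j$, marks the point $i$ above (below); then $\kappa^+(i)=j+1$ (resp. $\kappa^-(i)=j+1$). For each maximal run $[p,q]$ of consecutive points marked above, let $A=[p,q]$ if $\kappa^+(q)=q+1$ and $A=[p,q+1]$ otherwise, and let $M=A\cup\kappa^+(A)$. Let $\sigma^+$ be any involution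 of $[1,n]$ that equals $\kappa^+$ outside all the sets $M$, stabilizes each $M$, and is anti-Toeplitz on each $M$: every pair $\{x,\sigma^+(x)\}$ with $x\in M$, $x\neq\sigma^+(x)$ has one member in $A$ and the other in $\kappa^+(A)$; and $M$ is a single orbit of $\langle\kappa^+,\sigma^+\rangle$, which is an edge (that is, also a single orbit of $\langle\kappa^+\sigma^+\rangle$) if $\kappa^+(q)\le q+2$, and a loop (that is, not an edge) otherwise. Let $\sigma^-$ be obtained in the same way from $\kappa^-$ and the points marked below. (3) $S=\{\varepsilon_i-\varepsilon_{\sigma^+(i)}: i<\sigma^+(i)\}\cup\{\varepsilon_i-\varepsilon_{\sigma^-(i)}: i>\sigma^-(i)\}$. For any such $S$ and any choice of root vectors $x_\alpha$ of weight $\alpha\in S$, let $\eta\in\mathfrak q_\Lambda^*$ be the restriction to $\mathfrak q_\Lambda$ of $\sum_{\alpha\in S}x_\alpha$, and let $\Xi$ be the set of all adapted pairs $(h,\eta)$ of $\mathfrak q_\Lambda$ with $h\in\mathfrak h_\Lambda$ and $\eta$ of this form. (The adapted pairs constructed in [A. Joseph, Slices for biparabolic coadjoint actions in type A, J. Algebra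 319 (2008)] belong to $\Xi$: there the anti-Toeplitz involutions are those given by anti-Coxeter and anti-Jordan blocks.) Theorem. Every $\eta$ of this form, in particular the second element of every $(h,\eta)\in\Xi$, is the restriction to $\mathfrak q_\Lambda$ of a regular nilpotent element $y\in\mathfrak g^*$. -/

import Mathlib

open LieAlgebra.SpecialLinear

namespace Biparabolic

/-! ### Coadjoint action, adapted pairs, canonical truncation (arbitrary Lie algebra) -/

section General

attribute [local instance 100] LieRing.ofAssociativeRing

variable (k : Type*) [Field k] {L : Type*} [LieRing L] [LieAlgebra k L]

/-- The stabilizer of a linear form `f` under the coadjoint action. -/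
def coadjointStabilizer (f : Module.Dual k L) : Submodule k L where
  carrier := {a | ⁅a, f⁆ = 0}
  add_mem' {a b} ha hb := by
    change ⁅a + b, f⁆ = 0
    rw [add_lie, show ⁅a, f⁆ = 0 from ha, show ⁅b, f⁆ = 0 from hb, add_zero]
  zero_mem' := zero_lie f
  smul_mem' c a ha := by
    change ⁅c • a, f⁆ = 0
    rw [smul_lie, show ⁅a, f⁆ = 0 from ha, smul_zero]

/-- A linear form is regular if its stabilizer has the minimal possible dimension. -/
def IsRegularForm (f : Module.Dual k L) : Prop :=
  ∀ g : Module.Dual k L,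
    Module.finrank k (coadjointStabilizer k f) ≤ Module.finrank k (coadjointStabilizer k g)

/-- `(h, η)` is an adapted pair: `η` is regular and `(ad h) η = -η`. -/
def IsAdaptedPair (h : L) (η : Module.Dual k L) : Prop :=
  IsRegularForm k η ∧ ⁅h, η⁆ = -η

/-- A linear form is nilpotent if it corresponds to an ad-nilpotent element under the Killing
form. -/
def IsNilpotentForm (y : Module.Dual k L) : Prop :=
  ∃ x : L, killingForm k L x = y ∧ IsNilpotent (LieAlgebra.ad k L x)

/-- `f` is a semi-invariant of weight `χ` in the symmetric algebra of `L`: it is non-zero, and for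
each `x` the (unique) derivation of the symmetric algebra that extends `ad x` multiplies `f`
by `χ x`. -/
def IsSemiInvariant (χ : LieAlgebra.LieCharacter k L) (f : SymmetricAlgebra k L) : Prop :=
  f ≠ 0 ∧ ∀ x : L, ∃ D : Derivation k (SymmetricAlgebra k L) (SymmetricAlgebra k L),
    (∀ z : L, D (SymmetricAlgebra.ι k L z) = SymmetricAlgebra.ι k L ⁅x, z⁆) ∧ D f = χ x • f

variable (L) in
/-- The canonical truncation: the common kernel of the weights of all semi-invariants in the
symmetric algebra. -/
noncomputable def canonicalTruncation : LieIdeal k L :=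
  ⨅ χ : {χ : LieAlgebra.LieCharacter k L // ∃ f, IsSemiInvariant k χ f}, χ.1.ker

end General

/-! ### Partitions of `{0, …, n-1}` into intervals

A partition into consecutive intervals is a `Composition n`; two points lie in the same interval
when `c.index` takes the same value on them. -/

section Partition

variable {n : ℕ}

/-- The involution that reverses each interval of the partition. -/
def kappa (c : Composition n) : Equiv.Perm (Fin n) :=
  c.blocksFinEquiv.permCongr (Equiv.Perm.sigmaCongrRight fun _ => Fin.revPerm)

theorem index_monotone (c : Composition n) : Monotone c.index := by
  intro i j hij
  by_contra! h
  have h1 := c.lt_sizeUpTo_index_succ j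
  have h2 := c.sizeUpTo_index_le i
  have h3 : c.sizeUpTo (c.index j).succ ≤ c.sizeUpTo (c.index i) :=
    c.monotone_sizeUpTo (Nat.succ_le_of_lt h)
  have : (i : ℕ) ≤ j := hij
  omega

/-- `ε_i - ε_j` is zero, or a positive root, or a root of the Levi factor given by `c`. -/
def UpperPattern (c : Composition n) (i j : Fin n) : Prop := i ≤ j ∨ c.index i = c.index j

/-- `ε_i - ε_j` is zero, or a negative root, or a root of the Levi factor given by `c`. -/
def LowerPattern (c : Composition n) (i j : Fin n) : Prop := j ≤ i ∨ c.index i = c.index j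

theorem upperPattern_iff (c : Composition n) (i j : Fin n) :
    UpperPattern c i j ↔ c.index i ≤ c.index j := by
  constructor
  · rintro (h | h)
    · exact index_monotone c h
    · exact h.le
  · intro h
    by_cases hij : i ≤ j
    · exact Or.inl hij
    · exact Or.inr (le_antisymm h (index_monotone c (not_le.mp hij).le))

theorem lowerPattern_iff (c : Composition n) (i j : Fin n) :
    LowerPattern c i j ↔ c.index j ≤ c.index i := by
  rw [← upperPattern_iff, UpperPattern, LowerPattern, eq_comm]

end Partition

/-! ### Biparabolic subalgebras of `sl n` -/

section Subalgebra

variable (k : Type*) [Field k] {n : ℕ}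

/-- The trace zero matrices supported on a transitive relation. -/
def patternSubalgebra (r : Fin n → Fin n → Prop) (hr : ∀ i j l, r i j → r j l → r i l) :
    LieSubalgebra k (sl (Fin n) k) where
  carrier := {A | ∀ i j, ¬ r i j → A.val i j = 0}
  add_mem' {A B} hA hB i j hij := by
    change A.val i j + B.val i j = 0
    rw [hA i j hij, hB i j hij, add_zero]
  zero_mem' _ _ _ := rfl
  smul_mem' c A hA i j hij := by
    change c • A.val i j = 0
    rw [hA i j hij, smul_zero]
  lie_mem' {A B} hA hB i j hij := by
    have key : ∀ X Y : sl (Fin n) k, (∀ i j, ¬ r i j → X.val i j = 0) →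
        (∀ i j, ¬ r i j → Y.val i j = 0) → (X.val * Y.val) i j = 0 := by
      intro X Y hX hY
      rw [Matrix.mul_apply]
      refine Finset.sum_eq_zero fun l _ => ?_
      by_cases h1 : r i l
      · rw [hY l j fun h2 => hij (hr i l j h1 h2), mul_zero]
      · rw [hX i l h1, zero_mul]
    rw [sl_bracket, Matrix.sub_apply, key A B hA hB, key B A hB hA, sub_zero]

/-- The standard parabolic subalgebra that contains the upper triangular matrices and whose Levi
factor is given by `c`. -/
def parabolicUpper (c : Composition n) : LieSubalgebra k (sl (Fin n) k) :=
  patternSubalgebra k (UpperPattern c) fun i j l h1 h2 => by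
    rw [upperPattern_iff] at *; exact h1.trans h2

/-- The standard parabolic subalgebra that contains the lower triangular matrices and whose Levi
factor is given by `c`. -/
def parabolicLower (c : Composition n) : LieSubalgebra k (sl (Fin n) k) :=
  patternSubalgebra k (LowerPattern c) fun i j l h1 h2 => by
    rw [lowerPattern_iff] at *; exact h2.trans h1

end Subalgebra

/-- Above or below the horizontal line. -/
inductive Side
  | above
  | below

/-- A pair of interval partitions `J⁺` (`pos`) and `J⁻` (`neg`) such that every simple root
`α_i = ε_i - ε_{i+1}` belongs to `π⁺` or to `π⁻`, that is, any two neighbouring points share an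
interval of `J⁺` or of `J⁻`. -/
structure DoublePartition (n : ℕ) where
  pos : Composition n
  neg : Composition n
  cover : ∀ i j : Fin n, (j : ℕ) = i + 1 → pos.index i = pos.index j ∨ neg.index i = neg.index j

section Construction

variable {n : ℕ}

/-- `J⁺` is drawn above the line and `J⁻` below it. -/
def DoublePartition.part (D : DoublePartition n) : Side → Composition n
  | .above => D.pos
  | .below => D.neg

/-- The biparabolic subalgebra `𝔮` attached to the double partition: its positive roots are those
of `J⁻`, its negative roots are those of `J⁺`. -/
def biparabolic (k : Type*) [Field k] (D : DoublePartition n) : LieSubalgebra k (sl (Fin n) k) :=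
  parabolicLower k D.neg ⊓ parabolicUpper k D.pos

/-- The canonical truncation `𝔮_Λ` of the biparabolic subalgebra. -/
noncomputable abbrev truncatedBiparabolic (k : Type*) [Field k] (D : DoublePartition n) :
    LieIdeal k (biparabolic k D) :=
  canonicalTruncation k (biparabolic k D)

/-- The restriction map `𝔤* → 𝔮_Λ*`. -/
noncomputable def restrictForm (k : Type*) [Field k] (D : DoublePartition n)
    (y : Module.Dual k (sl (Fin n) k)) : Module.Dual k (truncatedBiparabolic k D) :=
  (y ∘ₗ (biparabolic k D).toSubmodule.subtype) ∘ₗ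
    (truncatedBiparabolic k D).toSubmodule.subtype

/-! ### Half-integer arcs and markings

The simple root `α_i` is the half-integer point between `i` and `i + 1`; it is named by `i`. -/

/-- The Dynkin diagram involution of the intervals of `c` interchanges `α_i` and `α_j`: the points
`i`, `j`, `j + 1` lie in one interval, and reversing that interval takes `i` to `j + 1`. -/
def DynkinSwap (c : Composition n) (i j : Fin n) : Prop :=
  c.index i = c.index j ∧ (kappa c i : ℕ) = j + 1

/-- A (non-fictitious) half-integer arc: it joins `α_left` and `α_right`, above or below the line,
and represents the root `α_left + ⋯ + α_right`. -/
structure HalfArc (D : DoublePartition n) where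
  side : Side
  left : Fin n
  right : Fin n
  le : left ≤ right
  swap : DynkinSwap (D.part side) left right

/-- An arc that joins a fixed point of the involution to itself. -/
def HalfArc.IsEnd {D : DoublePartition n} (a : HalfArc D) : Prop := a.left = a.right

/-- Two simple roots lie on the same half-integer meander. The fictitious arcs only join the two
loose ends of one chain of genuine arcs, or close one loose end on itself, so they do not change
this relation. -/
def SameMeander (D : DoublePartition n) : Fin n → Fin n → Prop :=
  Relation.EqvGen fun i j => ∃ s, DynkinSwap (D.part s) i j

/-- The marking rule: exactly one non-fictitious arc is marked on each half-integer meander, and if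
the meander is an edge, the marked arc is an end. A half-integer meander is an edge exactly when it
has a non-fictitious end: a chain of genuine arcs without fixed point is a cycle, or its two loose
ends are joined by fictitious arcs to a loop. -/
def IsMarking (D : DoublePartition n) (𝓜 : Set (HalfArc D)) : Prop :=
  ∀ i : Fin n, (i : ℕ) + 1 < n →
    ∃ a ∈ 𝓜, SameMeander D i a.left ∧
      (∀ b ∈ 𝓜, SameMeander D i b.left → b = a) ∧
      ((∃ b : HalfArc D, SameMeander D i b.left ∧ b.IsEnd) → a.IsEnd)

/-- The left end-points of the marked integer arcs on one side: a mark on the half-integer arc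
from `α_i` to `α_j`, `i ≤ j`, becomes a mark on the integer arc joining `i` and `j + 1`. -/
def markedPoints {D : DoublePartition n} (𝓜 : Set (HalfArc D)) (s : Side) : Set (Fin n) :=
  {i | ∃ a ∈ 𝓜, a.side = s ∧ a.left = i}

/-! ### Meanders, loops, edges -/

/-- A meander of two involutions is an orbit of the group that they generate. -/
def IsMeander (σ τ : Equiv.Perm (Fin n)) (O : Set (Fin n)) : Prop :=
  ∃ x, O = MulAction.orbit (Subgroup.closure {σ, τ}) x

/-- A meander is an edge if it is also an orbit of the product. -/
def IsEdge (σ τ : Equiv.Perm (Fin n)) (O : Set (Fin n)) : Prop :=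
  IsMeander σ τ O ∧ ∃ x, O = MulAction.orbit (Subgroup.zpowers (σ * τ)) x

/-- A meander that is not an edge is a loop. -/
def IsLoop (σ τ : Equiv.Perm (Fin n)) (O : Set (Fin n)) : Prop :=
  IsMeander σ τ O ∧ ¬ IsEdge σ τ O

/-! ### Modified involutions -/

/-- `[p, q]` is a connected component of the set `m` of marked points. -/
def IsMarkedRun (m : Set (Fin n)) (p q : Fin n) : Prop :=
  p ≤ q ∧ (∀ t, p ≤ t → t ≤ q → t ∈ m) ∧
    (∀ t : Fin n, (t : ℕ) + 1 = p → t ∉ m) ∧ (∀ t : Fin n, (t : ℕ) = q + 1 → t ∉ m)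

/-- The left half of the extended component of the run `[p, q]`: it is `[p, q + 1]`, or `[p, q]`
if `q` and `q + 1` are the two middle points of an interval of even cardinality. -/
def leftHalf (c : Composition n) (p q : Fin n) : Set (Fin n) :=
  {x | p ≤ x ∧ (x ≤ q ∨ ((x : ℕ) = q + 1 ∧ x ≠ kappa c q))}

/-- The right half of the extended component: the mirror image of the left half. -/
def rightHalf (c : Composition n) (p q : Fin n) : Set (Fin n) := kappa c '' leftHalf c p q

/-- The extended component of the run `[p, q]`. -/
def extendedComponent (c : Composition n) (p q : Fin n) : Set (Fin n) :=
  leftHalf c p q ∪ rightHalf c p q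

/-- The run `[p, q]` reaches the centre of its interval: there is at most one point strictly between
`q` and its mirror image. -/
def IsCentralRun (c : Composition n) (q : Fin n) : Prop := (kappa c q : ℕ) ≤ q + 2

/-- `σ` is obtained from the involution `kappa c` by replacing it, on each extended component of the
set `m` of marked points, by an anti-Toeplitz involution. -/
structure IsModifiedInvolution (c : Composition n) (m : Set (Fin n)) (σ : Equiv.Perm (Fin n)) :
    Prop where
  involutive : ∀ x, σ (σ x) = x
  unmarked : ∀ x, (∀ p q, IsMarkedRun m p q → x ∉ extendedComponent c p q) → σ x = kappa c x
  stable : ∀ p q, IsMarkedRun m p q → ∀ x ∈ extendedComponent c p q, σ x ∈ extendedComponent c p q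
  loop : ∀ p q, IsMarkedRun m p q → ¬ IsCentralRun c q →
    IsLoop (kappa c) σ (extendedComponent c p q)
  edge : ∀ p q, IsMarkedRun m p q → IsCentralRun c q →
    IsEdge (kappa c) σ (extendedComponent c p q)
  antidiagonal : ∀ p q, IsMarkedRun m p q → ∀ x ∈ extendedComponent c p q, σ x ≠ x →
    (x ∈ leftHalf c p q ∧ σ x ∈ rightHalf c p q) ∨ (x ∈ rightHalf c p q ∧ σ x ∈ leftHalf c p q)

/-- All the choices made in the construction: a marking and a pair of modified involutions
`σ⁺ = σ above`, `σ⁻ = σ below`. -/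
structure ModifiedPair (D : DoublePartition n) where
  marks : Set (HalfArc D)
  isMarking : IsMarking D marks
  σ : Side → Equiv.Perm (Fin n)
  isModified : ∀ s, IsModifiedInvolution (D.part s) (markedPoints marks s) (σ s)

/-- The root `ε_i - ε_j` of `sl n` is the pair `(i, j)`. -/
abbrev Root (n : ℕ) := {α : Fin n × Fin n // α.1 ≠ α.2}

/-- The set `S = S⁺ ∪ S⁻`: the positive roots given by the arcs of `σ⁺` and the negative roots given
by the arcs of `σ⁻`. -/
def ModifiedPair.roots {D : DoublePartition n} (P : ModifiedPair D) : Finset (Root n) :=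
  {α : Root n | (α.1.1 < α.1.2 ∧ P.σ .above α.1.1 = α.1.2) ∨
    (α.1.2 < α.1.1 ∧ P.σ .below α.1.1 = α.1.2)}

/-- The form `η = ∑_{α ∈ S} x_α` on `𝔮_Λ`, where `x_α` is the root vector `u α • E_{ij}` of weight
`α = ε_i - ε_j` and `𝔤` is identified with `𝔤*` through the Killing form. -/
noncomputable def ModifiedPair.eta {k : Type*} [Field k] {D : DoublePartition n}
    (P : ModifiedPair D) (u : Root n → kˣ) : Module.Dual k (truncatedBiparabolic k D) :=
  restrictForm k D (killingForm k (sl (Fin n) k)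
    (∑ α ∈ P.roots, single α.1.1 α.1.2 α.2 (u α : k)))

/-- The set `Ξ` of the adapted pairs `(h, η)` of `𝔮_Λ` given by the construction; `h` lies in the
Cartan subalgebra `𝔥_Λ` of diagonal matrices in `𝔮_Λ`. -/
def constructedAdaptedPairs (k : Type*) [Field k] (D : DoublePartition n) :
    Set (truncatedBiparabolic k D × Module.Dual k (truncatedBiparabolic k D)) :=
  {a | IsAdaptedPair k a.1 a.2 ∧ (a.1.val.val.val : Matrix (Fin n) (Fin n) k).IsDiag ∧
    ∃ (P : ModifiedPair D) (u : Root n → kˣ), a.2 = P.eta u}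

end Construction

end Biparabolic

/-!
A matrix that becomes strictly upper triangular with non-zero superdiagonal after reordering the
basis represents a regular nilpotent form. It therefore suffices to order the basis so that every
root in `S` becomes positive and every two consecutive basis vectors either give a root in `S` or a
matrix unit orthogonal to `𝔮`: adding these matrix units to `∑ x_α` does not change `η`. Such an
order is a linear extension of the acyclic digraph with arrows `a → b` for `ε_a - ε_b` in `S`, with
a condition on consecutive vertices. Let `δ x` be the difference of the images of `x` under the
reflections of the two intervals that contain `x`. It changes from `≤ 0` to `≥ 0` along every arrow
between different cells (the nonempty intersections of an interval of `J⁺` with one of `J⁻`), and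
`E_{ab}` is orthogonal to `𝔮` as soon as `δ b ≤ δ a` and `a`, `b` lie in different cells. So the
linear extension can be built greedily, following paths as long as possible.
-/

namespace Biparabolic

/-! ### Regular nilpotent elements of `sl n` -/

section Centralizer

open Polynomial Module

variable {k : Type*} [Field k]

/-- Take the product of the quotients `k[X] ⧸ (p ^ e)` in the structure theorem over `k[X]`. -/
theorem exists_commRing_linearEquiv_mul.{u} {k : Type u} [Field k] {V : Type*} [AddCommGroup V]
    [Module k V] [FiniteDimensional k V] (T : End k V) :
    ∃ (A : Type u) (_ : CommRing A) (_ : Algebra k A) (E : V ≃ₗ[k] A) (t : A),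
      ∀ v, E (T v) = t * E v := by
  obtain ⟨ι, _, p, -, e, ⟨E⟩⟩ :=
    equiv_directSum_of_isTorsion (AEval.isTorsion_of_finiteDimensional k V T)
  classical
  let E' := E.trans (DirectSum.linearEquivFunOnFintype k[X] ι _)
  refine ⟨(i : ι) → k[X] ⧸ Ideal.span {p i ^ e i}, inferInstance, inferInstance,
    (AEval'.of T).trans (E'.restrictScalars k), algebraMap k[X] _ X, fun v => ?_⟩
  rw [← Algebra.smul_def, LinearEquiv.trans_apply, LinearEquiv.trans_apply, ← AEval'.X_smul_of]
  exact map_smul E' X _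

theorem finrank_centralizer_map {A B : Type*} [Ring A] [Algebra k A] [Ring B] [Algebra k B]
    (e : A ≃ₐ[k] B) (a : A) :
    finrank k (Subalgebra.centralizer k {e a}) = finrank k (Subalgebra.centralizer k {a}) := by
  have h : Subalgebra.centralizer k {e a} = (Subalgebra.centralizer k {a}).map e.toAlgHom := by
    ext b
    obtain ⟨c, rfl⟩ := e.surjective b
    simp [Subalgebra.mem_centralizer_iff, ← map_mul]
  rw [h]
  exact (e.subalgebraMap _).toLinearEquiv.finrank_eq.symm

theorem finrank_le_finrank_centralizer {V : Type*} [AddCommGroup V] [Module k V]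
    [FiniteDimensional k V] (T : End k V) :
    finrank k V ≤ finrank k (Subalgebra.centralizer k {T}) := by
  obtain ⟨A, _, _, E, t, hE⟩ := exists_commRing_linearEquiv_mul T
  let φ : V →ₗ[k] End k V := E.symm.conj.toLinearMap ∘ₗ LinearMap.mul k A ∘ₗ E.toLinearMap
  have φ_apply : ∀ v w, φ v w = E.symm (E v * E w) := fun _ _ => rfl
  have φ_mem : ∀ v, φ v ∈ (Subalgebra.centralizer k {T}).toSubmodule := by
    refine fun v => Subalgebra.mem_centralizer_iff k |>.2 fun S hS => LinearMap.ext fun w => ?_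
    obtain rfl : S = T := hS
    apply E.injective
    simp only [End.mul_apply, φ_apply, hE, E.apply_symm_apply, mul_left_comm]
  have φ_injective : Function.Injective φ :=
    E.symm.conj.injective.comp ((Algebra.lmul_injective (R := k)).comp E.injective)
  exact LinearMap.finrank_le_finrank_of_injective (f := φ.codRestrict _ φ_mem)
    fun v w h => φ_injective (congrArg Subtype.val h)

variable {ι : Type*} [Fintype ι] [DecidableEq ι]

theorem card_le_finrank_centralizer (X : Matrix ι ι k) :
    Fintype.card ι ≤ finrank k (Subalgebra.centralizer k {X}) := by
  rw [← finrank_centralizer_map Matrix.toLinAlgEquiv', ← finrank_fintype_fun_eq_card (R := k)]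
  exact finrank_le_finrank_centralizer _

theorem isNilpotent_of_strictly_upper [LinearOrder ι] {N : Matrix ι ι k}
    (hN : ∀ i j, j ≤ i → N i j = 0) : IsNilpotent N := by
  refine ⟨Fintype.card ι, ?_⟩
  have h := N.aeval_self_charpoly
  rw [Matrix.charpoly_of_isUpperTriangular N fun i j hij => hN i j hij.le] at h
  simpa [hN] using h

/-- A matrix that commutes with `N` is determined by its product with a cyclic row vector `v`. -/
theorem finrank_centralizer_le_of_det_ne_zero {n : ℕ} {N : Matrix (Fin n) (Fin n) k}
    (v : Fin n → k)
    (hv : (Matrix.of fun i : Fin n => Matrix.vecMul v (N ^ (i : ℕ))).det ≠ 0) :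
    finrank k (Subalgebra.centralizer k {N}) ≤ n := by
  set K : Matrix (Fin n) (Fin n) k := Matrix.of fun i : Fin n => Matrix.vecMul v (N ^ (i : ℕ))
  let ρ : Matrix (Fin n) (Fin n) k →ₗ[k] Fin n → k :=
    { toFun := Matrix.vecMul v
      map_add' := fun Y Z => Matrix.vecMul_add Y Z v
      map_smul' := fun c Z => Matrix.vecMul_smul v c Z }
  have hρ : Function.Injective (ρ ∘ₗ (Subalgebra.centralizer k {N}).toSubmodule.subtype) := by
    rw [injective_iff_map_eq_zero]
    rintro ⟨Z, hZ⟩ (hvZ : Matrix.vecMul v Z = 0)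
    have hcomm : Commute N Z := Subalgebra.mem_centralizer_iff k |>.1 hZ N rfl
    have hKZ : K * Z = 0 := funext fun i => by
      change Matrix.vecMul (Matrix.vecMul v (N ^ (i : ℕ))) Z = 0
      rw [Matrix.vecMul_vecMul, (hcomm.pow_left i).eq, ← Matrix.vecMul_vecMul, hvZ,
        Matrix.zero_vecMul]
    have hZ0 : Z = 0 := by
      rw [← Matrix.nonsing_inv_mul_cancel_left K Z (isUnit_iff_ne_zero.2 hv), hKZ, Matrix.mul_zero]
    exact Subtype.ext hZ0
  simpa using LinearMap.finrank_le_finrank_of_injective hρ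

section Superdiagonal

variable {n : ℕ} {N : Matrix (Fin n) (Fin n) k} (hN : ∀ i j, j ≤ i → N i j = 0)
include hN

theorem pow_apply_eq_zero_of_lt (m : ℕ) {i j : Fin n} (hij : (j : ℕ) < i + m) :
    (N ^ m) i j = 0 := by
  induction m generalizing j with
  | zero => exact Matrix.one_apply_ne fun h => by omega
  | succ m ih =>
    rw [pow_succ, Matrix.mul_apply]
    refine Finset.sum_eq_zero fun l _ => ?_
    by_cases hl : (l : ℕ) < i + m
    · rw [ih hl, zero_mul]
    · rw [hN l j (by omega), mul_zero]

theorem pow_apply_ne_zero (hs : ∀ i j : Fin n, (j : ℕ) = i + 1 → N i j ≠ 0) (m : ℕ) {i j : Fin n}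
    (hij : (j : ℕ) = i + m) : (N ^ m) i j ≠ 0 := by
  induction m generalizing j with
  | zero =>
    obtain rfl : i = j := by omega
    simp
  | succ m ih =>
    have hm : i + m < n := by omega
    rw [pow_succ, Matrix.mul_apply, Finset.sum_eq_single ⟨i + m, hm⟩]
    · exact mul_ne_zero (ih rfl) (hs _ _ hij)
    · intro l _ hl
      rcases lt_or_ge (l : ℕ) (i + m) with hl' | hl'
      · rw [pow_apply_eq_zero_of_lt hN m hl', zero_mul]
      · have : (l : ℕ) ≠ i + m := fun h => hl (Fin.ext h)
        rw [hN l j (by omega), mul_zero]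
    · simp

theorem finrank_centralizer_le_of_superdiagonal
    (hs : ∀ i j : Fin n, (j : ℕ) = i + 1 → N i j ≠ 0) :
    finrank k (Subalgebra.centralizer k {N}) ≤ n := by
  obtain rfl | hn := n.eq_zero_or_pos
  · exact (finrank_zero_of_subsingleton (R := k)).le
  let o : Fin n := ⟨0, hn⟩
  refine finrank_centralizer_le_of_det_ne_zero (Pi.single o 1) ?_
  simp only [Matrix.single_one_vecMul]
  rw [Matrix.det_of_isUpperTriangular]
  · exact Finset.prod_ne_zero_iff.2 fun i _ => pow_apply_ne_zero hN hs i (by simp [o])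
  · exact fun i j h => pow_apply_eq_zero_of_lt hN i (by simpa [o] using h)

end Superdiagonal

end Centralizer

section Killing

attribute [local instance 100] LieRing.ofAssociativeRing

open Module

variable {k : Type*} [Field k] {ι : Type*} [Fintype ι]

theorem trace_mulLeft_mulRight (A B : Matrix ι ι k) :
    LinearMap.trace k _ (LinearMap.mulLeft k A ∘ₗ LinearMap.mulRight k B) =
      A.trace * B.trace := by
  classical
  rw [LinearMap.trace_eq_matrix_trace k (Matrix.stdBasis k ι ι), Matrix.trace,
    Fintype.sum_prod_type, Matrix.trace, Matrix.trace, Finset.sum_mul_sum]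
  refine Finset.sum_congr rfl fun i _ => Finset.sum_congr rfl fun j _ => ?_
  rw [Matrix.diag_apply, LinearMap.toMatrix_apply, Matrix.stdBasis_eq_single]
  change (A * ((Matrix.single i j 1 : Matrix ι ι k) * B)) i j = _
  simp [Matrix.mul_apply, Matrix.single_apply, ite_and]

theorem exists_eq_trace_mul (g : Dual k (Matrix ι ι k)) :
    ∃ X : Matrix ι ι k, ∀ M, g M = (X * M).trace := by
  let φ : Matrix ι ι k →ₗ[k] Dual k (Matrix ι ι k) :=
    LinearMap.compr₂ (LinearMap.mul k _) (Matrix.traceLinearMap ι k k)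
  have φ_injective : Function.Injective φ := fun X Y h =>
    Matrix.ext_iff_trace_mul_right.2 fun M => LinearMap.congr_fun h M
  obtain ⟨X, hX⟩ :=
    (LinearMap.injective_iff_surjective_of_finrank_eq_finrank Subspace.dual_finrank_eq.symm).1
      φ_injective g
  exact ⟨X, fun M => (LinearMap.congr_fun hX M).symm⟩

variable [DecidableEq ι]

theorem killingForm_sl (A B : sl ι k) :
    killingForm k (sl ι k) A B = 2 * Fintype.card ι * (A.val * B.val).trace := by
  have trace_A : A.val.trace = 0 := A.2
  have trace_B : B.val.trace = 0 := B.2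
  let f : Matrix ι ι k →ₗ[k] Matrix ι ι k := LieAlgebra.ad k _ A.val ∘ₗ LieAlgebra.ad k _ B.val
  have f_mem_sl : ∀ X, f X ∈ (sl ι k).toSubmodule := fun X =>
    LinearMap.mem_ker.2 (LieAlgebra.matrix_trace_commutator_zero _ _ A.val ⁅B.val, X⁆)
  have killingForm_eq : killingForm k (sl ι k) A B = LinearMap.trace k _ f := by
    rw [killingForm_apply_apply, ← LinearMap.trace_restrict_eq_of_forall_mem _ f f_mem_sl]
    rfl
  have f_eq : f = LinearMap.mulLeft k (A.val * B.val) ∘ₗ LinearMap.mulRight k 1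
      - LinearMap.mulLeft k A.val ∘ₗ LinearMap.mulRight k B.val
      - LinearMap.mulLeft k B.val ∘ₗ LinearMap.mulRight k A.val
      + LinearMap.mulLeft k 1 ∘ₗ LinearMap.mulRight k (B.val * A.val) := by
    ext1 X
    simp only [f, LinearMap.comp_apply, LieAlgebra.ad_apply, LieRing.of_associative_ring_bracket,
      LinearMap.add_apply, LinearMap.sub_apply, LinearMap.mulLeft_apply, LinearMap.mulRight_apply]
    noncomm_ring
  rw [killingForm_eq, f_eq, map_add, map_sub, map_sub, trace_mulLeft_mulRight,
    trace_mulLeft_mulRight, trace_mulLeft_mulRight, trace_mulLeft_mulRight, trace_A, trace_B,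
    Matrix.trace_one, Matrix.trace_mul_comm B.val A.val]
  ring

theorem exists_eq_trace_mul_sl (g : Dual k (sl ι k)) :
    ∃ X : Matrix ι ι k, ∀ b : sl ι k, g b = (X * b.val).trace := by
  obtain ⟨G, rfl⟩ := LinearMap.exists_extend (p := (sl ι k).toSubmodule) g
  obtain ⟨X, hX⟩ := exists_eq_trace_mul G
  exact ⟨X, fun b => hX b.val⟩

section TraceForm

variable (hι : (Fintype.card ι : k) ≠ 0)
include hι

theorem eq_zero_of_forall_trace_mul_sl {W : Matrix ι ι k} (hW : W.trace = 0)
    (h : ∀ b : sl ι k, (W * b.val).trace = 0) : W = 0 := by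
  refine Matrix.ext_iff_trace_mul_right.2 fun M => ?_
  let c : k := M.trace / Fintype.card ι
  have trace_sub_smul_one : (M - c • 1).trace = 0 := by
    simp [c, Matrix.trace_sub, Matrix.trace_smul, Matrix.trace_one, hι]
  have := h ⟨M - c • 1, trace_sub_smul_one⟩
  simpa [mul_sub, Matrix.trace_sub, Matrix.trace_smul, hW] using this

variable {g : Dual k (sl ι k)} {X : Matrix ι ι k} (hX : ∀ b : sl ι k, g b = (X * b.val).trace)
include hX

theorem mem_coadjointStabilizer_iff_commute {a : sl ι k} :
    a ∈ coadjointStabilizer k g ↔ Commute X a.val := by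
  have lie_apply : ∀ b : sl ι k, ⁅a, g⁆ b = -((X * a.val - a.val * X) * b.val).trace := fun b => by
    rw [Module.Dual.lie_apply, hX, sl_bracket, mul_sub, sub_mul, Matrix.trace_sub, Matrix.trace_sub,
      mul_assoc, mul_assoc, Matrix.trace_mul_comm a.val (X * b.val), mul_assoc]
  constructor
  · intro (ha : ⁅a, g⁆ = 0)
    refine sub_eq_zero.1 (eq_zero_of_forall_trace_mul_sl hι
      (LieAlgebra.matrix_trace_commutator_zero _ _ _ _) fun b => ?_)
    rw [← neg_eq_zero, ← lie_apply, ha, LinearMap.zero_apply]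
  · intro ha
    refine LinearMap.ext fun b => ?_
    rw [lie_apply, sub_eq_zero.2 ha.eq, zero_mul, Matrix.trace_zero, neg_zero, LinearMap.zero_apply]

theorem finrank_coadjointStabilizer_add_one :
    finrank k (coadjointStabilizer k g) + 1 = finrank k (Subalgebra.centralizer k {X}) := by
  let C := (Subalgebra.centralizer k {X}).toSubmodule
  let t : C →ₗ[k] k := Matrix.traceLinearMap ι k k ∘ₗ C.subtype
  have ht : Function.Surjective t := by
    refine LinearMap.surjective fun h => hι ?_
    simpa [t] using LinearMap.congr_fun h ⟨1, one_mem (Subalgebra.centralizer k {X})⟩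
  have map_eq : (coadjointStabilizer k g).map (sl ι k).toSubmodule.subtype =
      (LinearMap.ker t).map C.subtype := by
    rw [LinearMap.ker_comp, Submodule.map_comap_subtype]
    ext Z
    constructor
    · rintro ⟨a, ha, rfl⟩
      refine ⟨Subalgebra.mem_centralizer_iff k |>.2 ?_, a.2⟩
      rintro _ rfl
      exact (mem_coadjointStabilizer_iff_commute hι hX).1 ha
    · rintro ⟨hZ, trace_Z⟩
      exact ⟨⟨Z, trace_Z⟩, (mem_coadjointStabilizer_iff_commute hι hX).2
        (Subalgebra.mem_centralizer_iff k |>.1 hZ X rfl), rfl⟩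
  have finrank_eq : finrank k (coadjointStabilizer k g) = finrank k (LinearMap.ker t) := by
    rw [← Submodule.finrank_map_subtype_eq C, ← map_eq]
    exact (Submodule.finrank_map_subtype_eq (sl ι k).toSubmodule _).symm
  have rank_nullity := t.finrank_range_add_finrank_ker
  rw [LinearMap.range_eq_top.2 ht, finrank_top, finrank_self] at rank_nullity
  rw [finrank_eq, add_comm]
  exact rank_nullity

end TraceForm

theorem isRegularForm_isNilpotentForm_killingForm {n : ℕ} (hn : (2 * n : k) ≠ 0)
    (Y : sl (Fin n) k) (e : Fin n ≃ Fin n) (hY : ∀ i j, j ≤ i → Y.val (e i) (e j) = 0)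
    (hs : ∀ i j : Fin n, (j : ℕ) = i + 1 → Y.val (e i) (e j) ≠ 0) :
    IsRegularForm k (killingForm k (sl (Fin n) k) Y) ∧
      IsNilpotentForm k (killingForm k (sl (Fin n) k) Y) := by
  have hι : (Fintype.card (Fin n) : k) ≠ 0 := by
    rw [Fintype.card_fin]; exact right_ne_zero_of_mul hn
  let φ := Matrix.reindexAlgEquiv k k e.symm
  constructor
  · intro g
    obtain ⟨X, hX⟩ := exists_eq_trace_mul_sl g
    have killingForm_eq : ∀ b : sl (Fin n) k, killingForm k (sl (Fin n) k) Y b =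
        ((2 * n : k) • Y.val * b.val).trace := fun b => by
      rw [killingForm_sl, smul_mul_assoc, Matrix.trace_smul, Fintype.card_fin, smul_eq_mul]
    rw [← Nat.add_le_add_iff_right (n := 1), finrank_coadjointStabilizer_add_one hι hX,
      finrank_coadjointStabilizer_add_one hι killingForm_eq, ← finrank_centralizer_map φ]
    calc finrank k (Subalgebra.centralizer k {φ ((2 * n : k) • Y.val)}) ≤ n :=
          finrank_centralizer_le_of_superdiagonal
            (fun i j hij => mul_eq_zero_of_right _ (hY i j hij))
            fun i j hij => mul_ne_zero hn (hs i j hij)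
      _ = Fintype.card (Fin n) := (Fintype.card_fin n).symm
      _ ≤ _ := card_le_finrank_centralizer X
  · have hφ : IsNilpotent (φ Y.val) := isNilpotent_of_strictly_upper hY
    exact ⟨Y, rfl, LieSubalgebra.isNilpotent_ad_of_isNilpotent_ad _
      (LieAlgebra.ad_nilpotent_of_nilpotent ((IsNilpotent.map_iff φ.injective).1 hφ))⟩

end Killing

/-! ### Hamiltonian linear extensions of an acyclic digraph -/

section LinkedSequence

open Relation

variable {V γ : Type*}

/-- The vertex `v` is not in the list, but all its predecessors are. -/
def IsAvailable (S : V → V → Prop) (l : List V) (v : V) : Prop :=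
  v ∉ l ∧ ∀ u, S u v → u ∈ l

/-- A list without repetitions in which every vertex comes after its predecessors for `S`, and in
which consecutive vertices are related by `S` or by `Link`. -/
inductive IsLinkedSequence (S Link : V → V → Prop) : List V → Prop
  | nil : IsLinkedSequence S Link []
  | snoc {l : List V} {v : V} : IsLinkedSequence S Link l → IsAvailable S l v →
      (∀ e ∈ l.getLast?, S e v ∨ Link e v) → IsLinkedSequence S Link (l ++ [v])

variable {S Link : V → V → Prop} {l m r : List V} {v e : V}

theorem IsAvailable.available_or_exists_pred (h : IsAvailable S (l ++ m) v) :
    IsAvailable S l v ∨ ∃ u ∈ m, S u v := by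
  by_cases hv : ∃ u ∈ m, S u v
  · exact Or.inr hv
  · push Not at hv
    exact Or.inl ⟨fun hvl => h.1 (List.mem_append_left _ hvl), fun u hu =>
      (List.mem_append.1 (h.2 u hu)).resolve_right fun hum => hv u hum hu⟩

namespace IsLinkedSequence

theorem of_snoc (h : IsLinkedSequence S Link (l ++ [v])) :
    IsLinkedSequence S Link l ∧ IsAvailable S l v ∧ (∀ e ∈ l.getLast?, S e v ∨ Link e v) := by
  generalize hm : l ++ [v] = m at h
  cases h with
  | nil => simp at hm
  | snoc good available link =>
    obtain ⟨rfl, h⟩ := List.append_inj' hm rfl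
    obtain rfl : v = _ := by simpa using h
    exact ⟨good, available, link⟩

theorem nodup (h : IsLinkedSequence S Link l) : l.Nodup := by
  induction h with
  | nil => simp
  | snoc _ available _ ih =>
    refine List.nodup_append.2 ⟨ih, by simp, fun a ha b hb hab => available.1 ?_⟩
    obtain rfl : b = _ := by simpa using hb
    exact hab ▸ ha

theorem mem_of_pred (h : IsLinkedSequence S Link l) {u : V} (hv : v ∈ l) (huv : S u v) :
    u ∈ l := by
  induction h with
  | nil => simp at hv
  | snoc _ available _ ih =>
    rcases List.mem_append.1 hv with hv | hv
    · exact List.mem_append_left _ (ih hv)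
    · obtain rfl : v = _ := by simpa using hv
      exact List.mem_append_left _ (available.2 u huv)

theorem insert_middle (hr : IsLinkedSequence S Link (l ++ r))
    (hm : IsLinkedSequence S Link (l ++ m)) (he : m.getLast? = some e) (hdis : ∀ v ∈ r, v ∉ m)
    (hlink : ∀ s ∈ r, Link e s) : IsLinkedSequence S Link (l ++ m ++ r) := by
  induction r using List.reverseRecOn with
  | nil => simpa using hm
  | append_singleton r v ih =>
    rw [← List.append_assoc] at hr ⊢
    obtain ⟨good, available, link⟩ := hr.of_snoc
    refine (ih good (fun w hw => hdis w (by simp [hw])) fun s hs => hlink s (by simp [hs])).snoc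
      ⟨?_, fun u hu => ?_⟩ fun a ha => ?_
    · have := available.1
      have := hdis v (by simp)
      simp only [List.mem_append] at *
      tauto
    · have := available.2 u hu
      simp only [List.mem_append] at this ⊢
      tauto
    · by_cases hr0 : r = []
      · obtain rfl : e = a := by simpa [hr0, he] using ha
        exact Or.inr (hlink v (by simp))
      · rw [List.getLast?_append_of_ne_nil _ hr0] at ha
        exact link a (by rwa [List.getLast?_append_of_ne_nil _ hr0])

theorem append_isolated (hl : IsLinkedSequence S Link l) (hm : m.Pairwise Link)
    (hnd : m.Nodup) (hdis : ∀ v ∈ m, v ∉ l) (hiso : ∀ v ∈ m, ∀ u, ¬ S u v)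
    (hlink : ∀ e ∈ l.getLast?, ∀ s ∈ m, Link e s) : IsLinkedSequence S Link (l ++ m) := by
  induction m generalizing l with
  | nil => simpa using hl
  | cons a m ih =>
    rw [List.append_cons]
    rw [List.pairwise_cons] at hm
    rw [List.nodup_cons] at hnd
    have ha : a ∈ a :: m := List.mem_cons_self
    refine ih (hl.snoc ⟨hdis a ha, fun u hu => absurd hu (hiso a ha u)⟩
      fun e he => Or.inr (hlink e he a ha)) hm.2 hnd.2 ?_ (fun v hv => hiso v (by simp [hv])) ?_
    · intro v hv hv'
      rcases List.mem_append.1 hv' with h | h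
      · exact hdis v (by simp [hv]) h
      · obtain rfl : v = a := by simpa using h
        exact hnd.1 hv
    · intro e he s hs
      obtain rfl : a = e := by simpa using he
      exact hm.1 s hs

end IsLinkedSequence

theorem exists_maximal_append [Finite V] {P : List V → Prop} (hP : ∀ l, P l → l.Nodup)
    (hl : P l) : ∃ m, P m ∧ ∀ r, r ≠ [] → ¬ P (m ++ r) := by
  cases nonempty_fintype V
  induction hk : Fintype.card V - l.length using Nat.strong_induction_on generalizing l with
  | _ k ih =>
  subst hk
  by_cases h : ∃ r, r ≠ [] ∧ P (l ++ r)
  · obtain ⟨r, hr, h⟩ := h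
    refine ih _ ?_ h rfl
    have := (hP _ h).length_le_card
    have := List.length_pos_of_ne_nil hr
    simp only [List.length_append] at *
    omega
  · push Not at h
    exact ⟨l, hl, h⟩

/-- A vertex with at least two successors. -/
def IsFork (S : V → V → Prop) (x : V) : Prop := ∃ s t, S x s ∧ S x t ∧ s ≠ t

/-- A vertex with at least two predecessors. -/
def IsJoin (S : V → V → Prop) (x : V) : Prop := ∃ s t, S s x ∧ S t x ∧ s ≠ t

theorem succ_unique_of_not_isFork {x s t : V} (h : ¬ IsFork S x) (hs : S x s) (ht : S x t) :
    s = t := by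
  by_contra hne
  exact h ⟨s, t, hs, ht, hne⟩

theorem pred_unique_of_not_isJoin {x s t : V} (h : ¬ IsJoin S x) (hs : S s x) (ht : S t x) :
    s = t := by
  by_contra hne
  exact h ⟨s, t, hs, ht, hne⟩

variable (S Link) in
/-- The combinatorial properties of the arcs of a pair of modified involutions from which a
Hamiltonian linear extension can be built. The vertices are sorted into cells; `δ` is constant on
cells and grows along the arcs that join different cells. -/
structure IsArcSystem (δ : V → ℤ) (cell : V → γ) : Prop where
  acyclic : ∀ v, ¬ TransGen S v v
  cell_eq_or_cross : ∀ u v, S u v → cell u = cell v ∨ (δ u ≤ 0 ∧ 0 ≤ δ v ∧ δ u < δ v)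
  δ_eq : ∀ u v, cell u = cell v → δ u = δ v
  fork : ∀ x, IsFork S x → (∀ u, ¬ S u x) ∧ δ x < 0
  join : ∀ x, IsJoin S x → (∀ u, ¬ S x u) ∧ 0 < δ x
  succ_eq_or_eq : ∀ x s t u, S x s → S x t → s ≠ t → S x u → u = s ∨ u = t
  pred_eq_or_eq : ∀ z s t u, S s z → S t z → s ≠ t → S u z → u = s ∨ u = t
  nonpos_of_source : ∀ u v, S u v → (∀ x, ¬ S x u) → δ u ≤ 0
  nonneg_of_sink : ∀ u v, S u v → (∀ x, ¬ S v x) → 0 ≤ δ v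
  link_of_le : ∀ u v, δ v ≤ δ u → cell u ≠ cell v → Link u v
  link_of_fork : ∀ x s t u v, S x s → S x t → s ≠ t → cell s ≠ cell x → cell t ≠ cell x →
    cell u = cell s → cell v = cell t → Link u v
  link_of_join : ∀ z s t u v, S s z → S t z → s ≠ t → cell s ≠ cell z → cell t ≠ cell z →
    cell u = cell s → cell v = cell t → Link u v
  cell_ne_of_join : ∀ z s t, S s z → S t z → s ≠ t → cell s ≠ cell z → cell t ≠ cell z →
    cell s ≠ cell t
  common_succ_unique : ∀ u v w x, S u w → S v w → S u x → S v x → u ≠ v → w = x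
  source_unique : ∀ u v, δ u = 0 → cell u = cell v → (∀ x, ¬ S x u) → (∀ x, ¬ S x v) → u = v
  isolated_unique : ∀ u v, cell u = cell v → (∀ x, ¬ S x u) → (∀ x, ¬ S u x) → (∀ x, ¬ S x v) →
    (∀ x, ¬ S v x) → u = v

variable {δ : V → ℤ} {cell : V → γ}

variable (S Link) in
/-- A path that continues the list `l` up to the vertex `e` and cannot be prolonged. -/
structure IsRun (l m : List V) (e : V) : Prop where
  linked : IsLinkedSequence S Link (l ++ m)
  last : m.getLast? = some e
  path : ∀ u ∈ m, ReflTransGen S u e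
  not_available : ∀ u ∈ m, ∀ t, S u t → ¬ IsAvailable S (l ++ m) t

variable (S Link δ) in
/-- A path that continues the list `l` up to the vertex `e`, where successors with `δ < 0` of
forks may remain available. -/
structure IsContinuation (l m : List V) (e : V) : Prop where
  linked : IsLinkedSequence S Link (l ++ m)
  last : m.getLast? = some e
  path : ∀ u ∈ m, ReflTransGen S u e
  neg_of_available : ∀ u ∈ m, ∀ t, S u t → IsAvailable S (l ++ m) t → δ t < 0 ∧ IsFork S u

variable (S Link δ) in
/-- The invariant of the greedy construction. -/
structure IsGreedy (l : List V) : Prop where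
  linked : IsLinkedSequence S Link l
  nonneg_last : ∀ e ∈ l.getLast?, 0 ≤ δ e
  neg_of_available : ∀ v, IsAvailable S l v → δ v < 0

variable (S Link δ) in
/-- No extension of the list satisfies the invariant of the greedy construction. -/
structure IsStuck (l : List V) : Prop extends IsGreedy S Link δ l where
  maximal : ∀ m, m ≠ [] → ¬ IsGreedy S Link δ (l ++ m)

theorem IsRun.isContinuation (h : IsRun S Link l m e) : IsContinuation S Link δ l m e where
  linked := h.linked
  last := h.last
  path := h.path
  neg_of_available u hu t hut ht := absurd ht (h.not_available u hu t hut)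

theorem IsRun.available_of_available (h : IsRun S Link l m e) (hv : IsAvailable S (l ++ m) v) :
    IsAvailable S l v :=
  hv.available_or_exists_pred.resolve_right fun ⟨u, hu, huv⟩ => h.not_available u hu v huv hv

theorem IsStuck.last_neg (hl : IsStuck S Link δ l) (linked : IsLinkedSequence S Link (l ++ m))
    (last : m.getLast? = some e)
    (neg : ∀ u ∈ m, ∀ t, S u t → IsAvailable S (l ++ m) t → δ t < 0) : δ e < 0 := by
  by_contra! he
  refine hl.maximal m (by rintro rfl; simp at last) ⟨linked, ?_, fun v hv => ?_⟩
  · intro a ha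
    obtain rfl : e = a := by simpa [last] using ha
    exact he
  · rcases hv.available_or_exists_pred with h | ⟨u, hu, huv⟩
    · exact hl.neg_of_available v h
    · exact neg u hu v huv hv

theorem IsContinuation.last_neg (hm : IsContinuation S Link δ l m e) (hl : IsStuck S Link δ l) :
    δ e < 0 :=
  hl.last_neg hm.linked hm.last fun u hu t hut ht => (hm.neg_of_available u hu t hut ht).1

namespace IsArcSystem

variable (H : IsArcSystem S Link δ cell)
include H

theorem cell_ne_of_lt {u v : V} (h : δ u < δ v) : cell u ≠ cell v :=
  fun huv => h.ne (H.δ_eq _ _ huv)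

theorem cell_eq_or_cross_of_reflTransGen {u v : V} (h : ReflTransGen S u v) :
    cell u = cell v ∨ (δ u ≤ 0 ∧ 0 ≤ δ v ∧ δ u < δ v) := by
  induction h with
  | refl => exact Or.inl rfl
  | tail _ hbc ih =>
    rcases ih with ih | ih <;> rcases H.cell_eq_or_cross _ _ hbc with h | h
    · exact Or.inl (ih.trans h)
    · rw [H.δ_eq _ _ ih]
      exact Or.inr h
    · rw [← H.δ_eq _ _ h]
      exact Or.inr ih
    · exact Or.inr ⟨ih.1, h.2.1, ih.2.2.trans h.2.2⟩

theorem δ_le_of_reflTransGen {u v : V} (h : ReflTransGen S u v) : δ u ≤ δ v := by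
  rcases H.cell_eq_or_cross_of_reflTransGen h with h | h
  · exact (H.δ_eq _ _ h).le
  · exact h.2.2.le

theorem cell_eq_of_continuation (hl : IsStuck S Link δ l) (hm : IsContinuation S Link δ l m e)
    {u : V} (hu : u ∈ m) : cell u = cell e :=
  (H.cell_eq_or_cross_of_reflTransGen (hm.path u hu)).resolve_right fun h =>
    h.2.1.not_gt (hm.last_neg hl)

theorem wellFounded [Finite V] : WellFounded S := by
  have : Std.Irrefl (TransGen S) := ⟨H.acyclic⟩
  have : IsStrictOrder V (TransGen S) := {}
  exact (Finite.wellFounded_of_trans_of_irrefl (TransGen S)).mono fun _ _ h => .single h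

theorem wellFounded_flip [Finite V] : WellFounded (flip S) := by
  have : Std.Irrefl (flip (TransGen S)) := ⟨H.acyclic⟩
  have : IsTrans V (flip (TransGen S)) := ⟨fun _ _ _ h1 h2 => h2.trans h1⟩
  have : IsStrictOrder V (flip (TransGen S)) := {}
  exact (Finite.wellFounded_of_trans_of_irrefl (flip (TransGen S))).mono fun _ _ h => .single h

theorem not_isFork_of_pred {u p : V} (hp : S p u) : ¬ IsFork S u :=
  fun hu => (H.fork u hu).1 p hp

theorem not_isJoin_of_succ {u p : V} (hp : S u p) : ¬ IsJoin S u :=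
  fun hu => (H.join u hu).1 p hp

theorem exists_isRun [Finite V] (hl : IsLinkedSequence S Link l) {s : V} (hs : IsAvailable S l s)
    (hfork : ¬ IsFork S s) (hlink : ∀ e ∈ l.getLast?, S e s ∨ Link e s) :
    ∃ m e, IsRun S Link l m e ∧ s ∈ m := by
  induction s using H.wellFounded_flip.induction generalizing l with
  | _ s ih =>
  have hls : IsLinkedSequence S Link (l ++ [s]) := hl.snoc hs hlink
  by_cases h : ∃ t, S s t ∧ IsAvailable S (l ++ [s]) t
  · obtain ⟨t, hst, ht⟩ := h
    obtain ⟨m, e, hm, htm⟩ := ih t hst hls ht (H.not_isFork_of_pred hst) fun a ha => by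
      obtain rfl : s = a := by simpa using ha
      exact Or.inl hst
    refine ⟨s :: m, e, ⟨by simpa using hm.linked, by simp [List.getLast?_cons, hm.last], ?_, ?_⟩,
      List.mem_cons_self⟩
    · rintro u (_ | ⟨_, hu⟩)
      · exact .head hst (hm.path t htm)
      · exact hm.path u hu
    · rintro u (_ | ⟨_, hu⟩) a hua ha
      · obtain rfl := succ_unique_of_not_isFork hfork hst hua
        exact ha.1 (by simp [htm])
      · exact hm.not_available u hu a hua (by simpa using ha)
  · push Not at h
    refine ⟨[s], s, ⟨hls, rfl, ?_, ?_⟩, List.mem_singleton_self s⟩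
    · simp only [List.mem_singleton, forall_eq]
      exact .refl
    · simp only [List.mem_singleton, forall_eq]
      exact h

theorem link_of_neg {e s : V} (he : 0 ≤ δ e) (hs : δ s < 0) : Link e s :=
  H.link_of_le e s (hs.le.trans he) (H.cell_ne_of_lt (hs.trans_le he)).symm

theorem link_last_of_available (hl : IsGreedy S Link δ l) {s : V} (hs : IsAvailable S l s) :
    ∀ e ∈ l.getLast?, S e s ∨ Link e s := fun e he =>
  Or.inr (H.link_of_neg (hl.nonneg_last e he) (hl.neg_of_available s hs))

section Fork

variable {x t : V} (hx : IsFork S x) (hxl : x ∉ l)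
include hx hxl

theorem isLinkedSequence_snoc_of_isFork (hl : IsGreedy S Link δ l) :
    IsLinkedSequence S Link (l ++ [x]) :=
  have available : IsAvailable S l x := ⟨hxl, fun u hu => absurd hu ((H.fork x hx).1 u)⟩
  hl.linked.snoc available (H.link_last_of_available hl available)

theorem exists_isRun_of_isFork [Finite V] (hl : IsGreedy S Link δ l) (hxt : S x t)
    (ht : IsAvailable S (l ++ [x]) t) : ∃ m e, IsRun S Link (l ++ [x]) m e ∧ t ∈ m :=
  H.exists_isRun (H.isLinkedSequence_snoc_of_isFork hx hxl hl) ht (H.not_isFork_of_pred hxt)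
    fun e he => by
      obtain rfl : x = e := by simpa using he
      exact Or.inl hxt

omit hxl in
theorem link_of_fork_of_reflTransGen {a : V} (hxt : S x t) (hxa : S x a) (hta : t ≠ a)
    (ha : 0 ≤ δ a) (hat : δ a ≤ δ t) (hte : ReflTransGen S t e) : Link e a := by
  have hδx := (H.fork x hx).2
  rcases H.cell_eq_or_cross_of_reflTransGen hte with h | h
  · exact H.link_of_fork x t a e a hxt hxa hta
      (H.cell_ne_of_lt (hδx.trans_le (ha.trans hat))).symm
      (H.cell_ne_of_lt (hδx.trans_le ha)).symm h.symm rfl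
  · have hae : δ a < δ e := hat.trans_lt h.2.2
    exact H.link_of_le e a hae.le (H.cell_ne_of_lt hae).symm

omit hx hxl in
theorem last_neg_of_two_runs (hl : IsStuck S Link δ l) {a e' : V} {m' : List V}
    (hm : IsRun S Link (l ++ [x]) m e) (hm' : IsRun S Link (l ++ [x] ++ m) m' e')
    (htm : t ∈ m) (ham : a ∈ m') (hxt : S x t) (hxa : S x a) (hta : t ≠ a) : δ e' < 0 := by
  have assoc : l ++ [x] ++ m ++ m' = l ++ (x :: m ++ m') := by simp
  refine hl.last_neg (m := x :: m ++ m') (assoc ▸ hm'.linked) ?_ fun u hu b hub hb => ?_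
  · rw [List.getLast?_append, hm'.last]
    rfl
  rw [← assoc] at hb
  rcases List.mem_append.1 hu with (_ | ⟨_, hu⟩) | hu
  · rcases H.succ_eq_or_eq x t a b hxt hxa hta hub with rfl | rfl
    · exact absurd (by simp [htm]) hb.1
    · exact absurd (by simp [ham]) hb.1
  · exact absurd (hm'.available_of_available hb) (hm.not_available u hu b hub)
  · exact absurd hb (hm'.not_available u hu b hub)

theorem neg_of_isFork [Finite V] (hl : IsStuck S Link δ l) (hxt : S x t)
    (ht : IsAvailable S (l ++ [x]) t) : δ t < 0 := by
  by_contra! hpos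
  obtain ⟨t, ⟨hxt, ht, hpos⟩, hmax⟩ :
      ∃ t, (S x t ∧ IsAvailable S (l ++ [x]) t ∧ 0 ≤ δ t) ∧
        ∀ s, (S x s ∧ IsAvailable S (l ++ [x]) s ∧ 0 ≤ δ s) → δ s ≤ δ t :=
    Set.exists_max_image {t | S x t ∧ IsAvailable S (l ++ [x]) t ∧ 0 ≤ δ t} δ (Set.toFinite _)
      ⟨t, hxt, ht, hpos⟩
  obtain ⟨m, e, hm, htm⟩ := H.exists_isRun_of_isFork hx hxl hl.toIsGreedy hxt ht
  have hδe : 0 ≤ δ e := hpos.trans (H.δ_le_of_reflTransGen (hm.path t htm))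
  obtain ⟨a, hxa, ha, hδa⟩ : ∃ a, S x a ∧ IsAvailable S (l ++ [x] ++ m) a ∧ 0 ≤ δ a := by
    by_contra! hneg
    refine hδe.not_gt (hl.last_neg (m := x :: m) (by simpa using hm.linked)
      (by simp [List.getLast?_cons, hm.last]) fun u hu a hua ha => ?_)
    replace ha : IsAvailable S (l ++ [x] ++ m) a := by simpa using ha
    rcases hu with _ | ⟨_, hu⟩
    · exact hneg a hua ha
    · exact absurd ha (hm.not_available u hu a hua)
  have hta : t ≠ a := by
    rintro rfl
    exact ha.1 (List.mem_append_right _ htm)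
  have hlink : Link e a := H.link_of_fork_of_reflTransGen hx hxt hxa hta hδa
    (hmax a ⟨hxa, hm.available_of_available ha, hδa⟩) (hm.path t htm)
  obtain ⟨m', e', hm', ham⟩ := H.exists_isRun hm.linked ha (H.not_isFork_of_pred hxa)
    fun b hb => by
      rw [List.getLast?_append, hm.last] at hb
      obtain rfl : e = b := by simpa using hb
      exact Or.inr hlink
  have := H.last_neg_of_two_runs hl hm hm' htm ham hxt hxa hta
  have := H.δ_le_of_reflTransGen (hm'.path a ham)
  omega

theorem isContinuation_singleton_of_isFork [Finite V] (hl : IsStuck S Link δ l) :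
    IsContinuation S Link δ l [x] x where
  linked := H.isLinkedSequence_snoc_of_isFork hx hxl hl.toIsGreedy
  last := rfl
  path u hu := by
    obtain rfl : u = x := by simpa using hu
    exact .refl
  neg_of_available u hu t hut ht := by
    obtain rfl : u = x := by simpa using hu
    exact ⟨H.neg_of_isFork hx hxl hl hut ht, hx⟩

theorem exists_isContinuation_of_isFork [Finite V] (hl : IsStuck S Link δ l) (hxt : S x t)
    (ht : δ t < 0) : ∃ m e, IsContinuation S Link δ l m e ∧ t ∈ m := by
  have available : IsAvailable S (l ++ [x]) t := by
    refine ⟨fun h => ?_, fun u hu => ?_⟩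
    · rcases List.mem_append.1 h with h | h
      · exact hxl (hl.linked.mem_of_pred h hxt)
      · obtain rfl : t = x := by simpa using h
        exact H.acyclic t (.single hxt)
    · have not_join : ¬ IsJoin S t := fun h => ht.not_gt (H.join t h).2
      simp [pred_unique_of_not_isJoin not_join hu hxt]
  obtain ⟨m, e, hm, htm⟩ := H.exists_isRun_of_isFork hx hxl hl.toIsGreedy hxt available
  refine ⟨x :: m, e, ⟨by simpa using hm.linked, by simp [List.getLast?_cons, hm.last], ?_, ?_⟩,
    List.mem_cons_of_mem _ htm⟩
  · rintro u (_ | ⟨_, hu⟩)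
    · exact .head hxt (hm.path t htm)
    · exact hm.path u hu
  · intro u hu a hua ha
    replace ha : IsAvailable S (l ++ [x] ++ m) a := by simpa using ha
    rcases hu with _ | ⟨_, hu⟩
    · exact ⟨H.neg_of_isFork hx hxl hl hua (hm.available_of_available ha), hx⟩
    · exact absurd ha (hm.not_available u hu a hua)

end Fork

theorem exists_isContinuation [Finite V] (hl : IsStuck S Link δ l) (hvl : v ∉ l)
    (hv : ¬ IsJoin S v) : ∃ m e, IsContinuation S Link δ l m e ∧ v ∈ m := by
  induction v using H.wellFounded.induction with
  | _ v ih =>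
  by_cases available : IsAvailable S l v
  · by_cases hfork : IsFork S v
    · exact ⟨[v], v, H.isContinuation_singleton_of_isFork hfork hvl hl, List.mem_singleton_self v⟩
    · obtain ⟨m, e, hm, hvm⟩ := H.exists_isRun hl.linked available hfork
        (H.link_last_of_available hl.toIsGreedy available)
      exact ⟨m, e, hm.isContinuation, hvm⟩
  · obtain ⟨u, huv, hul⟩ : ∃ u, S u v ∧ u ∉ l := by
      simpa [IsAvailable, hvl] using available
    obtain ⟨m, e, hm, hum⟩ := ih u huv hul (H.not_isJoin_of_succ huv)
    by_cases hvm : v ∈ m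
    · exact ⟨m, e, hm, hvm⟩
    · have hfork := hm.neg_of_available u hum v huv ⟨by simp [hvl, hvm], fun w hwv => by
        obtain rfl := pred_unique_of_not_isJoin hv hwv huv
        exact List.mem_append_right _ hum⟩
      exact H.exists_isContinuation_of_isFork hfork.2 hul hl huv hfork.1

theorem neg_of_isStuck [Finite V] (hl : IsStuck S Link δ l) (hvl : v ∉ l) (hv : ¬ IsJoin S v) :
    δ v < 0 := by
  obtain ⟨m, e, hm, hvm⟩ := H.exists_isContinuation hl hvl hv
  exact (H.δ_le_of_reflTransGen (hm.path v hvm)).trans_lt (hm.last_neg hl)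

theorem exists_unused_isJoin [Finite V] (hl : IsStuck S Link δ l) (hvl : v ∉ l)
    (hv : (∃ u, S u v) ∨ ∃ u, S v u) : ∃ z, z ∉ l ∧ IsJoin S z := by
  induction v using H.wellFounded_flip.induction with
  | _ v ih =>
  by_cases hs : ∃ t, S v t
  · obtain ⟨t, ht⟩ := hs
    exact ih t ht (fun h => hvl (hl.linked.mem_of_pred h ht)) (Or.inl ⟨v, ht⟩)
  · obtain ⟨u, hu⟩ := hv.resolve_right hs
    refine ⟨v, hvl, ?_⟩
    by_contra hjoin
    exact (H.neg_of_isStuck hl hvl hjoin).not_ge (H.nonneg_of_sink u v hu (not_exists.1 hs))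

theorem pred_unused_of_isJoin [Finite V] (hl : IsStuck S Link δ l) {z : V} (hz : IsJoin S z)
    (hzl : z ∉ l) (hvz : S v z) : v ∉ l := by
  intro hv
  have hδz := (H.join z hz).2
  obtain ⟨w, hwz, hwl⟩ : ∃ w, S w z ∧ w ∉ l := by
    by_contra! h
    exact (hl.neg_of_available z ⟨hzl, h⟩).not_gt hδz
  obtain ⟨m, e, hm, hwm⟩ := H.exists_isContinuation hl hwl (H.not_isJoin_of_succ hwz)
  have hzm : z ∉ m := fun h =>
    ((H.δ_le_of_reflTransGen (hm.path z h)).trans_lt (hm.last_neg hl)).not_gt hδz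
  refine (hm.neg_of_available w hwm z hwz ⟨by simp [hzl, hzm], fun y hyz => ?_⟩).1.not_gt hδz
  rcases H.pred_eq_or_eq z v w y hvz hwz (fun h => hwl (h ▸ hv)) hyz with rfl | rfl
  · exact List.mem_append_left _ hv
  · exact List.mem_append_right _ hwm

theorem exists_isContinuation_to_pred [Finite V] (hl : IsStuck S Link δ l) {z : V}
    (hz : IsJoin S z) (hvl : v ∉ l) (hvz : S v z) :
    ∃ m, IsContinuation S Link δ l m v ∧ (IsFork S v → m = [v]) := by
  by_cases hv : IsFork S v
  · exact ⟨[v], H.isContinuation_singleton_of_isFork hv hvl hl, fun _ => rfl⟩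
  · obtain ⟨m, e, hm, hvm⟩ := H.exists_isContinuation hl hvl (H.not_isJoin_of_succ hvz)
    obtain rfl : v = e := by
      rcases ReflTransGen.cases_head (hm.path v hvm) with h | ⟨y, hy, hye⟩
      · exact h
      · obtain rfl := succ_unique_of_not_isFork hv hy hvz
        exact absurd (H.join y hz).2
          ((H.δ_le_of_reflTransGen hye).trans_lt (hm.last_neg hl)).not_gt
    exact ⟨m, hm, fun h => absurd h hv⟩

theorem isFork_of_conflict {u z t : V} (huv : ReflTransGen S u v) (hvz : S v z) (hut : S u t)
    (ht : IsJoin S t) (hv : δ v < 0) (htz : t ≠ z) : IsFork S u := by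
  rcases ReflTransGen.cases_head huv with rfl | ⟨y, hy, hyv⟩
  · exact ⟨t, z, hut, hvz, htz⟩
  · refine ⟨t, y, hut, hy, ?_⟩
    rintro rfl
    exact ((H.δ_le_of_reflTransGen hyv).trans_lt hv).not_gt (H.join t ht).2

/-- Joins all of whose predecessors are forks are to be used before the other joins. -/
theorem exists_unused_isJoin_of_priority [Finite V] (hl : IsStuck S Link δ l) (hvl : v ∉ l)
    (hv : (∃ u, S u v) ∨ ∃ u, S v u) : ∃ z, z ∉ l ∧ IsJoin S z ∧
      ∀ t, t ∉ l → IsJoin S t → (∀ u, S u t → IsFork S u) → ∀ u, S u z → IsFork S u := by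
  by_cases h : ∃ t, t ∉ l ∧ IsJoin S t ∧ ∀ u, S u t → IsFork S u
  · obtain ⟨t, htl, ht, hfork⟩ := h
    exact ⟨t, htl, ht, fun _ _ _ _ => hfork⟩
  · obtain ⟨z, hzl, hz⟩ := H.exists_unused_isJoin hl hvl hv
    exact ⟨z, hzl, hz, fun t htl ht hfork => absurd ⟨t, htl, ht, hfork⟩ h⟩

section Join

variable {z a b : V} {q : List V} (hl : IsStuck S Link δ l) (haz : S a z) (hbz : S b z)
  (hab : a ≠ b) (hm : IsContinuation S Link δ l m a) (hq : IsContinuation S Link δ l q b)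
include hl haz hbz hab hm hq

theorem cell_ne_of_isContinuation : cell a ≠ cell z ∧ cell b ≠ cell z ∧ cell a ≠ cell b := by
  have hδz := (H.join z ⟨a, b, haz, hbz, hab⟩).2
  have haz' := H.cell_ne_of_lt ((hm.last_neg hl).trans hδz)
  have hbz' := H.cell_ne_of_lt ((hq.last_neg hl).trans hδz)
  exact ⟨haz', hbz', H.cell_ne_of_join z a b haz hbz hab haz' hbz'⟩

theorem isLinkedSequence_join (hzl : z ∉ l) :
    IsLinkedSequence S Link (l ++ (m ++ q ++ [z])) := by
  obtain ⟨cell_az, cell_bz, cell_ab⟩ := H.cell_ne_of_isContinuation hl haz hbz hab hm hq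
  have cell_m {u : V} (hu : u ∈ m) := H.cell_eq_of_continuation hl hm hu
  have cell_q {u : V} (hu : u ∈ q) := H.cell_eq_of_continuation hl hq hu
  have linked : IsLinkedSequence S Link (l ++ m ++ q) :=
    hq.linked.insert_middle hm.linked hm.last
      (fun u hu hu' => cell_ab ((cell_m hu').symm.trans (cell_q hu)))
      fun s hs => H.link_of_join z a b a s haz hbz hab cell_az cell_bz rfl (cell_q hs)
  have hzm : z ∉ m := fun h => cell_az (cell_m h).symm
  have hzq : z ∉ q := fun h => cell_bz (cell_q h).symm
  have ha : a ∈ m := List.mem_of_getLast? hm.last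
  have hb : b ∈ q := List.mem_of_getLast? hq.last
  rw [← List.append_assoc, ← List.append_assoc]
  refine linked.snoc ⟨by simp [hzl, hzm, hzq], fun u hu => ?_⟩ fun e he => ?_
  · rcases H.pred_eq_or_eq z a b u haz hbz hab hu with rfl | rfl
    · simp [ha]
    · simp [hb]
  · obtain rfl : b = e := by simpa [List.getLast?_append, hq.last] using he
    exact Or.inl hbz

theorem eq_of_common_succ (ha : IsFork S a → m = [a]) (hb : IsFork S b → q = [b])
    (priority : ∀ t, t ∉ l → IsJoin S t → (∀ u, S u t → IsFork S u) → ∀ u, S u z → IsFork S u)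
    {u w t : V} (hu : u ∈ m) (hw : w ∈ q) (hut : S u t) (hwt : S w t) (htl : t ∉ l) : t = z := by
  by_contra htz
  have huw : u ≠ w := by
    rintro rfl
    exact (H.cell_ne_of_isContinuation hl haz hbz hab hm hq).2.2
      ((H.cell_eq_of_continuation hl hm hu).symm.trans (H.cell_eq_of_continuation hl hq hw))
  have ht : IsJoin S t := ⟨u, w, hut, hwt, huw⟩
  have fork_of_pred := priority t htl ht fun y hy => by
    rcases H.pred_eq_or_eq t u w y hut hwt huw hy with rfl | rfl
    · exact H.isFork_of_conflict (hm.path y hu) haz hut ht (hm.last_neg hl) htz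
    · exact H.isFork_of_conflict (hq.path y hw) hbz hwt ht (hq.last_neg hl) htz
  obtain rfl : u = a := by simpa [ha (fork_of_pred a haz)] using hu
  obtain rfl : w = b := by simpa [hb (fork_of_pred b hbz)] using hw
  exact htz (H.common_succ_unique u w t z hut hwt haz hbz huw)

end Join

theorem mem_of_isStuck [Finite V] (hl : IsStuck S Link δ l)
    (hv : (∃ u, S u v) ∨ ∃ u, S v u) : v ∈ l := by
  by_contra hvl
  obtain ⟨z, hzl, hz, priority⟩ := H.exists_unused_isJoin_of_priority hl hvl hv
  obtain ⟨z_sink, hδz⟩ := H.join z hz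
  obtain ⟨a, b, haz, hbz, hab⟩ := id hz
  obtain ⟨m, hm, ha⟩ :=
    H.exists_isContinuation_to_pred hl hz (H.pred_unused_of_isJoin hl hz hzl haz) haz
  obtain ⟨q, hq, hb⟩ :=
    H.exists_isContinuation_to_pred hl hz (H.pred_unused_of_isJoin hl hz hzl hbz) hbz
  refine hδz.not_gt (hl.last_neg (H.isLinkedSequence_join hl haz hbz hab hm hq hzl) (by simp) ?_)
  intro u hu t hut ht
  have not_mem : t ∉ l ∧ t ∉ m ∧ t ∉ q ∧ t ≠ z := by simpa using ht.1
  obtain ⟨htl, htm, htq, htz⟩ := not_mem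
  have common_succ {u w : V} (hu : u ∈ m) (hw : w ∈ q) (hut : S u t) (hwt : S w t) : t = z :=
    H.eq_of_common_succ hl haz hbz hab hm hq ha hb priority hu hw hut hwt htl
  have mem_of_pred {w : V} (hwt : S w t) : w ∈ l ∨ w ∈ m ∨ w ∈ q := by
    have hwz : w ≠ z := by
      rintro rfl
      exact z_sink t hwt
    simpa [hwz] using ht.2 w hwt
  simp only [List.mem_append, List.mem_singleton] at hu
  rcases hu with (hu | hu) | rfl
  · refine (hm.neg_of_available u hu t hut ⟨by simp [htl, htm], fun w hwt => ?_⟩).1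
    rcases mem_of_pred hwt with hw | hw | hw
    · simp [hw]
    · simp [hw]
    · exact absurd (common_succ hu hw hut hwt) htz
  · refine (hq.neg_of_available u hu t hut ⟨by simp [htl, htq], fun w hwt => ?_⟩).1
    rcases mem_of_pred hwt with hw | hw | hw
    · simp [hw]
    · exact absurd (common_succ hw hu hwt hut) htz
    · simp [hw]
  · exact absurd hut (z_sink t)

theorem exists_isolated_list [Finite V] (C : V → Prop) :
    ∃ m : List V, (∀ v, v ∈ m ↔ C v ∧ (∀ u, ¬ S u v) ∧ ∀ u, ¬ S v u) ∧ m.Nodup ∧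
      m.Pairwise Link := by
  classical
  cases nonempty_fintype V
  let m : List V := (Finset.univ.filter fun v => C v ∧ (∀ u, ¬ S u v) ∧ ∀ u, ¬ S v u).toList
  let sorted := m.mergeSort fun u v => decide (δ v ≤ δ u)
  have mem_sorted : ∀ v, v ∈ sorted ↔ C v ∧ (∀ u, ¬ S u v) ∧ ∀ u, ¬ S v u := fun v => by
    simp [sorted, m]
  have nodup_sorted : sorted.Nodup :=
    (List.mergeSort_perm _ _).nodup_iff.2 (Finset.nodup_toList _)
  have pairwise_sorted : sorted.Pairwise fun u v => decide (δ v ≤ δ u) = true :=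
    List.pairwise_mergeSort (fun a b c hab hbc => by simp only [decide_eq_true_eq] at *; omega)
      (fun a b => by simp only [Bool.or_eq_true, decide_eq_true_eq]; omega) m
  refine ⟨sorted, mem_sorted, nodup_sorted, (pairwise_sorted.and nodup_sorted).imp_of_mem ?_⟩
  rintro a b ha hb ⟨hab, hne⟩
  refine H.link_of_le a b (by simpa using hab) fun h => hne ?_
  rw [mem_sorted] at ha hb
  exact H.isolated_unique a b h ha.2.1 ha.2.2 hb.2.1 hb.2.2

omit H in
variable (S Link δ cell) in
/-- The invariant of the first phase of the greedy construction, in which the isolated vertices with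
`δ > 0` and then the sources with `δ = 0` are used up. -/
structure IsInitial (l : List V) : Prop where
  linked : IsLinkedSequence S Link l
  last : ∀ e ∈ l.getLast?, 0 < δ e ∨ δ e = 0 ∧ ∃ s ∈ l, (∀ u, ¬ S u s) ∧ cell s = cell e
  source_of_available : ∀ v, IsAvailable S l v → 0 ≤ δ v → δ v = 0 ∧ ∀ u, ¬ S u v

theorem exists_isInitial [Finite V] : ∃ l, IsInitial S Link δ cell l := by
  obtain ⟨m, mem_m, nodup_m, link_m⟩ := H.exists_isolated_list fun v => 0 < δ v
  have linked : IsLinkedSequence S Link m := by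
    simpa using IsLinkedSequence.nil.append_isolated link_m nodup_m (by simp)
      (fun v hv => ((mem_m v).1 hv).2.1) (by simp)
  refine ⟨m, linked, fun e he => Or.inl ((mem_m e).1 (List.mem_of_getLast? he)).1,
    fun v hv hδv => ?_⟩
  have source_v : ∀ u, ¬ S u v := fun u hu => ((mem_m u).1 (hv.2 u hu)).2.2 v hu
  refine ⟨hδv.antisymm' (not_lt.1 fun hpos => hv.1 ((mem_m v).2 ⟨hpos, source_v, fun t ht => ?_⟩)),
    source_v⟩
  exact (H.nonpos_of_source v t ht source_v).not_gt hpos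

theorem IsInitial.exists_append [Finite V] (hl : IsInitial S Link δ cell l)
    (hv : IsAvailable S l v) (hδv : 0 ≤ δ v) : ∃ m, m ≠ [] ∧ IsInitial S Link δ cell (l ++ m) := by
  obtain ⟨hδv, source_v⟩ := hl.source_of_available v hv hδv
  have link_last : ∀ e ∈ l.getLast?, Link e v := fun e he => by
    rcases hl.last e he with h | ⟨h, s, hsl, source_s, hse⟩
    · exact H.link_of_le e v (by omega) (H.cell_ne_of_lt (by omega)).symm
    · refine H.link_of_le e v (by omega) fun hev => hv.1 ?_
      rwa [← H.source_unique s v (by rw [H.δ_eq _ _ hse, h]) (hse.trans hev) source_s source_v]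
  obtain ⟨m, e, hm, hvm⟩ := H.exists_isRun hl.linked hv
    (fun h => (H.fork v h).2.ne hδv) fun e he => Or.inr (link_last e he)
  refine ⟨m, List.ne_nil_of_mem hvm, hm.linked, fun a ha => ?_, fun w hw =>
    hl.source_of_available w (hm.available_of_available hw)⟩
  obtain rfl : e = a := by simpa [hm.last] using ha
  rcases H.cell_eq_or_cross_of_reflTransGen (hm.path v hvm) with h | h
  · exact Or.inr ⟨by rw [← H.δ_eq _ _ h, hδv], v, List.mem_append_right _ hvm, source_v, h⟩
  · exact Or.inl (by omega)

theorem exists_isGreedy [Finite V] : ∃ l, IsGreedy S Link δ l := by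
  obtain ⟨_, hl₀⟩ := H.exists_isInitial
  obtain ⟨l, hl, maximal⟩ := exists_maximal_append (fun _ h => h.linked.nodup) hl₀
  refine ⟨l, hl.linked, fun e he => ?_, fun v hv => ?_⟩
  · rcases hl.last e he with h | h
    · exact h.le
    · exact h.1.ge
  · by_contra! hδv
    obtain ⟨m, hm, hlm⟩ := IsInitial.exists_append H hl hv hδv
    exact maximal m hm hlm

theorem exists_isLinkedSequence [Finite V] : ∃ l, IsLinkedSequence S Link l ∧ ∀ v, v ∈ l := by
  obtain ⟨_, hl₀⟩ := H.exists_isGreedy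
  obtain ⟨l, greedy, maximal⟩ := exists_maximal_append (fun _ h => h.linked.nodup) hl₀
  have hl : IsStuck S Link δ l := ⟨greedy, maximal⟩
  obtain ⟨m, mem_m, nodup_m, link_m⟩ := H.exists_isolated_list fun v => v ∉ l
  refine ⟨l ++ m, hl.linked.append_isolated link_m nodup_m (fun v hv => ((mem_m v).1 hv).1)
    (fun v hv => ((mem_m v).1 hv).2.1) ?_, fun v => ?_⟩
  · intro e he s hs
    obtain ⟨hsl, source_s, -⟩ := (mem_m s).1 hs
    exact H.link_of_neg (hl.nonneg_last e he)
      (hl.neg_of_available s ⟨hsl, fun u hu => absurd hu (source_s u)⟩)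
  · by_cases hvl : v ∈ l
    · exact List.mem_append_left _ hvl
    · exact List.mem_append_right _ ((mem_m v).2 ⟨hvl,
        fun u hu => hvl (H.mem_of_isStuck hl (Or.inl ⟨u, hu⟩)),
        fun u hu => hvl (H.mem_of_isStuck hl (Or.inr ⟨u, hu⟩))⟩)

end IsArcSystem

end LinkedSequence

/-! ### Marked pairs of interval partitions of the integers -/

/-- The opposite side. -/
def Side.swap : Side → Side
  | .above => .below
  | .below => .above

theorem Side.ne_swap (s : Side) : s ≠ s.swap := by
  cases s <;> simp [swap]

/-- Two partitions of the integers into bounded intervals; `[lo s x, hi s x]` is the interval that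
contains `x`. -/
structure IntervalPair where
  lo : Side → ℤ → ℤ
  hi : Side → ℤ → ℤ
  lo_le : ∀ s x, lo s x ≤ x
  le_hi : ∀ s x, x ≤ hi s x
  lo_eq : ∀ s x y, lo s x ≤ y → y ≤ hi s x → lo s y = lo s x
  hi_eq : ∀ s x y, lo s x ≤ y → y ≤ hi s x → hi s y = hi s x

namespace IntervalPair

variable (B : IntervalPair) {s : Side} {i x y : ℤ}

/-- The reflection of the interval of `x` is `y ↦ B.sum s x - y`. -/
def sum (s : Side) (x : ℤ) : ℤ := B.lo s x + B.hi s x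

/-- The difference of the two reflections. -/
def diff (x : ℤ) : ℤ := B.sum .below x - B.sum .above x

/-- The pair of intervals that contain `x`. -/
def cell (x : ℤ) : ℤ × ℤ := (B.lo .above x, B.lo .below x)

theorem lo_eq_of_le (hxy : x ≤ y) (hy : y ≤ B.hi s x) : B.lo s y = B.lo s x :=
  B.lo_eq s x y ((B.lo_le s x).trans hxy) hy

theorem lo_eq_of_ge (hy : B.lo s x ≤ y) (hyx : y ≤ x) : B.lo s y = B.lo s x :=
  B.lo_eq s x y hy (hyx.trans (B.le_hi s x))

theorem hi_eq_of_lo_eq (h : B.lo s x = B.lo s y) : B.hi s x = B.hi s y := by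
  rcases le_total x y with hxy | hxy
  · exact B.hi_eq s y x (h ▸ B.lo_le s x) (hxy.trans (B.le_hi s y))
  · exact (B.hi_eq s x y (h ▸ B.lo_le s y) (hxy.trans (B.le_hi s x))).symm

theorem sum_eq_of_lo_eq (h : B.lo s x = B.lo s y) : B.sum s x = B.sum s y := by
  rw [sum, sum, h, B.hi_eq_of_lo_eq h]

theorem sum_eq (hlo : B.lo s x ≤ y) (hhi : y ≤ B.hi s x) : B.sum s y = B.sum s x :=
  B.sum_eq_of_lo_eq (B.lo_eq s x y hlo hhi)

theorem diff_eq_of_lo_eq (h : ∀ s, B.lo s x = B.lo s y) : B.diff x = B.diff y := by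
  rw [diff, diff, B.sum_eq_of_lo_eq (h _), B.sum_eq_of_lo_eq (h _)]

theorem sum_eq_of_diff_eq_zero (h : B.diff x = 0) (s t : Side) : B.sum s x = B.sum t x := by
  rw [diff] at h
  cases s <;> cases t <;> omega

theorem hi_lt_lo (hxy : x < y) (h : B.lo s x ≠ B.lo s y) : B.hi s x < B.lo s y := by
  have hlt : B.hi s x < y := by
    by_contra! hle
    exact h (B.lo_eq_of_le hxy.le hle).symm
  by_contra! hle
  exact h ((B.lo_eq_of_le (B.le_hi s x) le_rfl).symm.trans (B.lo_eq_of_ge hle hlt.le))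

theorem lt_of_lo_ne {u v : ℤ} (hxy : x < y) (h : B.lo s x ≠ B.lo s y) (hu : B.lo s u = B.lo s x)
    (hv : B.lo s v = B.lo s y) : u < v :=
  calc u ≤ B.hi s u := B.le_hi s u
    _ = B.hi s x := B.hi_eq_of_lo_eq hu
    _ < B.lo s y := B.hi_lt_lo hxy h
    _ = B.lo s v := hv.symm
    _ ≤ v := B.lo_le s v

theorem sum_lt (hxy : x < y) (h : B.lo s x ≠ B.lo s y) : B.sum s x < B.sum s y := by
  have := B.hi_lt_lo hxy h
  have := B.lo_le s x
  have := B.le_hi s x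
  have := B.lo_le s y
  have := B.le_hi s y
  simp only [sum]
  omega

theorem cell_eq_iff : B.cell x = B.cell y ↔ ∀ s, B.lo s x = B.lo s y := by
  rw [cell, cell, Prod.mk.injEq]
  exact ⟨fun h s => by cases s; exacts [h.1, h.2], fun h => ⟨h _, h _⟩⟩

theorem lo_below_ne (h : B.lo .above x = B.lo .above y) (hc : B.cell x ≠ B.cell y) :
    B.lo .below x ≠ B.lo .below y := fun h' =>
  hc (B.cell_eq_iff.2 fun s => by cases s; exacts [h, h'])

theorem lo_above_ne (h : B.lo .below x = B.lo .below y) (hc : B.cell x ≠ B.cell y) :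
    B.lo .above x ≠ B.lo .above y := fun h' =>
  hc (B.cell_eq_iff.2 fun s => by cases s; exacts [h', h])

/-- The positions outside the support of the biparabolic subalgebra. -/
def Off (x y : ℤ) : Prop :=
  (x < y ∧ B.lo .above x ≠ B.lo .above y) ∨ (y < x ∧ B.lo .below x ≠ B.lo .below y)

theorem off_of_diff_le (h : B.diff y ≤ B.diff x) (hc : B.cell x ≠ B.cell y) : B.Off x y := by
  simp only [diff] at h
  rcases lt_trichotomy x y with hxy | rfl | hxy
  · refine Or.inl ⟨hxy, fun he => ?_⟩
    have := B.sum_eq_of_lo_eq he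
    have := B.sum_lt hxy (B.lo_below_ne he hc)
    omega
  · exact absurd rfl hc
  · refine Or.inr ⟨hxy, fun he => ?_⟩
    have := B.sum_eq_of_lo_eq he
    have := B.sum_lt hxy (B.lo_above_ne he hc).symm
    omega

theorem lo_le_mirror (h : i < B.hi s i) : B.lo s i ≤ B.sum s i - 1 - i := by
  simp only [sum]
  omega

theorem mirror_lt_hi (s : Side) (i : ℤ) : B.sum s i - 1 - i < B.hi s i := by
  have := B.lo_le s i
  simp only [sum]
  omega

theorem sum_mirror (h : i < B.hi s i) : B.sum s (B.sum s i - 1 - i) = B.sum s i :=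
  B.sum_eq (B.lo_le_mirror h) (B.mirror_lt_hi s i).le

theorem sum_succ (h : i < B.hi s i) : B.sum s (i + 1) = B.sum s i :=
  B.sum_eq ((B.lo_le s i).trans (lt_add_one i).le) h

/-- Interchange the two sides. -/
def swap : IntervalPair where
  lo s := B.lo s.swap
  hi s := B.hi s.swap
  lo_le s := B.lo_le s.swap
  le_hi s := B.le_hi s.swap
  lo_eq s := B.lo_eq s.swap
  hi_eq s := B.hi_eq s.swap

theorem diff_swap (x : ℤ) : B.swap.diff x = -B.diff x := (neg_sub _ _).symm

theorem off_swap : B.swap.Off x y ↔ B.Off y x := by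
  simp only [Off, swap, Side.swap, ne_comm (a := B.lo _ x)]
  exact or_comm

theorem cell_swap_eq_iff : B.swap.cell x = B.swap.cell y ↔ B.cell x = B.cell y := by
  simp only [cell, Prod.mk.injEq]
  exact and_comm

/-- Reflect the line. -/
def reflect : IntervalPair where
  lo s x := -B.hi s (-x)
  hi s x := -B.lo s (-x)
  lo_le s x := neg_le.1 (B.le_hi s (-x))
  le_hi s x := le_neg.1 (B.lo_le s (-x))
  lo_eq s x y hlo hhi := by rw [B.hi_eq s (-x) (-y) (by omega) (by omega)]
  hi_eq s x y hlo hhi := by rw [B.lo_eq s (-x) (-y) (by omega) (by omega)]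

theorem sum_reflect (s : Side) (x : ℤ) : B.reflect.sum s x = -B.sum s (-x) := by
  simp only [sum, reflect]
  omega

theorem diff_reflect (x : ℤ) : B.reflect.diff x = -B.diff (-x) := by
  simp only [diff, sum_reflect]
  omega

theorem lt_hi_reflect_iff : i < B.reflect.hi s i ↔ -1 - i < B.hi s (-1 - i) := by
  have := B.lo_le s (-1 - i)
  have := B.le_hi s (-i)
  constructor <;> intro h
  · have := B.hi_eq s (-i) (-1 - i) (by simp only [reflect] at h; omega) (by omega)
    omega
  · have := B.lo_eq s (-1 - i) (-i) (by omega) (by omega)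
    simp only [reflect]
    omega

theorem sum_reflect_of_lt (h : -1 - i < B.hi s (-1 - i)) :
    B.reflect.sum s i = -B.sum s (-1 - i) := by
  rw [sum_reflect, ← B.sum_succ h]
  congr 2
  omega

end IntervalPair

/-- A pair of interval partitions with marked half-integers. The half-integer between `i` and
`i + 1` is named by `i`; `Marked s i` says that the arc through `i` on the side `s` is marked, and
`SameMeander` is the relation of lying on one half-integer meander. -/
structure MarkedIntervalPair extends IntervalPair where
  Marked : Side → ℤ → Prop
  SameMeander : ℤ → ℤ → Prop
  equivalence : Equivalence SameMeander
  sameMeander_mirror : ∀ s i, i < hi s i → SameMeander i (toIntervalPair.sum s i - 1 - i)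
  lt_hi_of_marked : ∀ s i, Marked s i → i < hi s i
  marked_mirror : ∀ s i, Marked s i → Marked s (toIntervalPair.sum s i - 1 - i)
  marked_unique : ∀ s t i j, Marked s i → Marked t j → SameMeander i j →
    s = t ∧ (j = i ∨ j = toIntervalPair.sum s i - 1 - i)
  marked_of_end : ∀ s t i e, Marked s i → SameMeander i e → 2 * e = toIntervalPair.sum t e - 1 →
    2 * i = toIntervalPair.sum s i - 1
  exists_marked : ∀ i, (∀ s, i < hi s i) →
    toIntervalPair.sum .above i = toIntervalPair.sum .below i → ∃ s, Marked s i

namespace MarkedIntervalPair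

variable (E : MarkedIntervalPair) {s t : Side} {i x : ℤ}

theorem side_eq_of_marked (hs : E.Marked s i) (ht : E.Marked t i) : s = t :=
  (E.marked_unique _ _ _ _ hs ht (E.equivalence.refl i)).1

theorem not_marked_above_below (ha : E.Marked .above i) (hb : E.Marked .below i) : False :=
  nomatch E.side_eq_of_marked ha hb

theorem marked_iff_marked_pred_of_center (hx : 2 * x = E.sum s x) :
    E.Marked s x ↔ E.Marked s (x - 1) := by
  constructor <;> intro h
  · have := E.marked_mirror s x h
    rwa [show E.sum s x - 1 - x = x - 1 by omega] at this
  · have hsum := E.sum_succ (E.lt_hi_of_marked _ _ h)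
    have := E.marked_mirror s _ h
    rw [sub_add_cancel] at hsum
    rwa [← hsum, show E.sum s x - 1 - (x - 1) = x by omega] at this

theorem exists_marked_of_sum_eq {P : ℤ} (hP : ∀ s, E.sum s x = P) (hlo : ∀ s, E.lo s x ≤ i)
    (hhi : ∀ s, i < E.hi s x) : ∃ s, E.Marked s i := by
  refine E.exists_marked i (fun s => ?_) ?_
  · rw [E.hi_eq s x i (hlo s) (hhi s).le]
    exact hhi s
  · rw [E.sum_eq (hlo _) (hhi _).le, E.sum_eq (hlo _) (hhi _).le, hP, hP]

/-- Interchange the two sides. -/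
def swap : MarkedIntervalPair where
  toIntervalPair := E.toIntervalPair.swap
  Marked s := E.Marked s.swap
  SameMeander := E.SameMeander
  equivalence := E.equivalence
  sameMeander_mirror s := E.sameMeander_mirror s.swap
  lt_hi_of_marked s := E.lt_hi_of_marked s.swap
  marked_mirror s := E.marked_mirror s.swap
  marked_unique s t i j hi hj h := by
    obtain ⟨hst, h⟩ := E.marked_unique s.swap t.swap i j hi hj h
    refine ⟨?_, h⟩
    cases s <;> cases t <;> first | rfl | cases hst
  marked_of_end s t := E.marked_of_end s.swap t.swap
  exists_marked i hlt hsum := by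
    obtain ⟨_ | _, hs⟩ := E.exists_marked i
      (fun s => by cases s; exacts [hlt .below, hlt .above]) hsum.symm
    exacts [⟨.below, hs⟩, ⟨.above, hs⟩]

/-- Reflect the line. -/
def reflect : MarkedIntervalPair where
  toIntervalPair := E.toIntervalPair.reflect
  Marked s i := E.Marked s (-1 - i)
  SameMeander i j := E.SameMeander (-1 - i) (-1 - j)
  equivalence := E.equivalence.comap _
  sameMeander_mirror s i h := by
    rw [E.lt_hi_reflect_iff] at h
    convert E.sameMeander_mirror s (-1 - i) h using 1
    rw [E.sum_reflect_of_lt h]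
    omega
  lt_hi_of_marked s i h := E.lt_hi_reflect_iff.2 (E.lt_hi_of_marked s _ h)
  marked_mirror s i h := by
    convert E.marked_mirror s _ h using 1
    rw [E.sum_reflect_of_lt (E.lt_hi_of_marked s _ h)]
    omega
  marked_unique s t i j hi hj h := by
    obtain ⟨hst, h⟩ := E.marked_unique s t _ _ hi hj h
    rw [E.sum_reflect_of_lt (E.lt_hi_of_marked s _ hi)]
    exact ⟨hst, by omega⟩
  marked_of_end s t i e hi hie he := by
    have hlt : e < E.toIntervalPair.reflect.hi t e := by
      have := E.toIntervalPair.reflect.lo_le t e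
      simp only [IntervalPair.sum] at he
      omega
    rw [E.sum_reflect_of_lt (E.lt_hi_reflect_iff.1 hlt)] at he
    have := E.marked_of_end s t _ _ hi hie (by omega)
    rw [E.sum_reflect_of_lt (E.lt_hi_of_marked s _ hi)]
    omega
  exists_marked i hlt hsum := by
    have hlt' := fun s => E.lt_hi_reflect_iff.1 (hlt s)
    rw [E.sum_reflect_of_lt (hlt' _), E.sum_reflect_of_lt (hlt' _)] at hsum
    exact E.exists_marked (-1 - i) hlt' (by omega)

end MarkedIntervalPair

/-- The union of the interval `[p, q + 1]` and its mirror image under `x ↦ P - x`. -/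
def runSet (P p q : ℤ) : Set ℤ := {x | p ≤ x ∧ x ≤ P - p ∧ (x ≤ q + 1 ∨ P - (q + 1) ≤ x)}

theorem reflect_mem_runSet {P p q x : ℤ} : P - x ∈ runSet P p q ↔ x ∈ runSet P p q := by
  simp only [runSet, Set.mem_ofPred_eq]
  omega

theorem mem_runSet_of_two_mul_le {P p q x : ℤ} (hq : P ≤ 2 * q + 2) :
    x ∈ runSet P p q ↔ p ≤ x ∧ x ≤ P - p := by
  simp only [runSet, Set.mem_ofPred_eq]
  omega

theorem neg_mem_runSet {P p q x : ℤ} : -x ∈ runSet P p q ↔ x ∈ runSet (-P) (p - P) (q - P) := by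
  simp only [runSet, Set.mem_ofPred_eq]
  omega

/-- The involution `σ` permutes the run set transitively together with the reflection, and its
product with the reflection is transitive if the run reaches the centre. -/
structure IsAntiToeplitz (σ : ℤ → ℤ) (P p q : ℤ) : Prop where
  stable : ∀ x ∈ runSet P p q, σ x ∈ runSet P p q
  transitive : ∀ T ⊆ runSet P p q, T.Nonempty → (∀ x ∈ T, σ x ∈ T) → (∀ x ∈ T, P - x ∈ T) →
    runSet P p q ⊆ T
  cyclic : P ≤ 2 * q + 2 → ∀ T ⊆ runSet P p q, T.Nonempty → (∀ x ∈ T, P - σ x ∈ T) →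
    runSet P p q ⊆ T

theorem IsAntiToeplitz.reflect {σ : ℤ → ℤ} {P p q : ℤ} (h : IsAntiToeplitz σ P p q) :
    IsAntiToeplitz (fun x => -σ (-x)) (-P) (p - P) (q - P) where
  stable x hx := by
    rw [← neg_mem_runSet] at hx ⊢
    simpa only [neg_neg] using h.stable _ hx
  transitive T hTP hT hσ hP x hx := by
    have := h.transitive {y | -y ∈ T} (fun y hy => by simpa [← neg_mem_runSet] using hTP hy)
      (hT.neg) (fun y hy => by simpa using hσ (-y) hy)
      (fun y hy => by
        have := hP (-y) hy
        rwa [neg_sub_neg, ← neg_sub] at this) (neg_mem_runSet.2 hx)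
    simpa using this
  cyclic hq T hTP hT hσ x hx := by
    have := h.cyclic (by omega) {y | -y ∈ T}
      (fun y hy => by simpa [← neg_mem_runSet] using hTP hy) (hT.neg)
      (fun y hy => by
        have := hσ (-y) hy
        rwa [neg_sub_neg, ← neg_sub, neg_neg] at this) (neg_mem_runSet.2 hx)
    simpa using this

/-- The run of marks through `i` to the left of the centre is `[p, q]`, and `σ` is anti-Toeplitz on
its extended component. -/
structure MarkedIntervalPair.IsModifiedRun (E : MarkedIntervalPair) (σ : ℤ → ℤ) (s : Side)
    (i p q : ℤ) : Prop where
  lo_le : E.lo s i ≤ p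
  le_left : p ≤ i
  le_right : i ≤ q
  two_mul_lt : 2 * q + 1 ≤ E.sum s i
  marked : ∀ j, p ≤ j → j ≤ q → E.Marked s j
  not_marked : ¬ E.Marked s (p - 1)
  isAntiToeplitz : IsAntiToeplitz σ (E.sum s i) p q

theorem MarkedIntervalPair.IsModifiedRun.reflect {E : MarkedIntervalPair} {σ : ℤ → ℤ} {s : Side}
    {i p q P : ℤ} (hi : E.Marked s (-1 - i)) (hP : E.sum s (-1 - i) = P)
    (h : E.IsModifiedRun σ s (P - 1 - (-1 - i)) p q) :
    E.reflect.IsModifiedRun (fun x => -σ (-x)) s i (p - P) (q - P) := by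
  have hlt := E.lt_hi_of_marked s _ hi
  have hlo : E.lo s (P - 1 - (-1 - i)) = E.lo s (-1 - i) :=
    E.lo_eq s _ _ (hP ▸ E.lo_le_mirror hlt) (hP ▸ (E.mirror_lt_hi s _).le)
  have hsum : E.sum s (P - 1 - (-1 - i)) = P := (E.sum_eq_of_lo_eq hlo).trans hP
  have hp := h.lo_le
  have hq := h.two_mul_lt
  have hpi := h.le_left
  have hiq := h.le_right
  have hlohi : E.lo s (-1 - i) + E.hi s (-1 - i) = P := hP
  have hsum_reflect : E.reflect.sum s i = -P := hP ▸ E.sum_reflect_of_lt hlt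
  have sum_eq : ∀ j, E.lo s (-1 - i) ≤ j → j ≤ E.hi s (-1 - i) → E.sum s j = P :=
    fun j hlo hhi => (E.sum_eq hlo hhi).trans hP
  rw [hlo] at hp
  rw [hsum] at hq
  refine ⟨?_, by omega, by omega, by omega, fun j hpj hjq => ?_, fun hm => h.not_marked ?_, ?_⟩
  · have := E.reflect.lo_le s i
    have := E.lt_hi_reflect_iff.2 hlt
    have : E.reflect.lo s i = -E.hi s (-1 - i) :=
      congrArg Neg.neg (E.hi_eq s _ _ (by omega) (by omega))
    omega
  · have := E.marked_mirror s _ (h.marked (j + P) (by omega) (by omega))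
    rw [sum_eq _ (by omega) (by omega)] at this
    change E.Marked s (-1 - j)
    convert this using 1
    omega
  · have := E.marked_mirror s _ hm
    rw [sum_eq _ (by omega) (by omega)] at this
    convert this using 1
    omega
  · rw [hsum_reflect]
    exact (hsum ▸ h.isAntiToeplitz).reflect

/-- A marked pair of interval partitions with a pair of modified involutions. -/
structure ModifiedIntervalPair extends MarkedIntervalPair where
  σ : Side → ℤ → ℤ
  σ_σ : ∀ s x, σ s (σ s x) = x
  lo_σ : ∀ s x, lo s (σ s x) = lo s x
  antidiagonal : ∀ s x, x < σ s x →
    2 * x ≤ toIntervalPair.sum s x ∧ toIntervalPair.sum s x ≤ 2 * σ s x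
  marked_of_lt : ∀ s x i, x ≤ i → i < toIntervalPair.sum s x - σ s x → Marked s i
  marked_of_gt : ∀ s x i, toIntervalPair.sum s x - σ s x ≤ i → i < x → Marked s i
  exists_run : ∀ s i, Marked s i → 2 * i + 1 ≤ toIntervalPair.sum s i →
    ∃ p q, toMarkedIntervalPair.IsModifiedRun (σ s) s i p q

namespace ModifiedIntervalPair

/-- Interchange the two sides. -/
def swap (E : ModifiedIntervalPair) : ModifiedIntervalPair where
  toMarkedIntervalPair := E.toMarkedIntervalPair.swap
  σ s := E.σ s.swap
  σ_σ s := E.σ_σ s.swap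
  lo_σ s := E.lo_σ s.swap
  antidiagonal s := E.antidiagonal s.swap
  marked_of_lt s := E.marked_of_lt s.swap
  marked_of_gt s := E.marked_of_gt s.swap
  exists_run s i hi h := by
    obtain ⟨p, q, h⟩ := E.exists_run s.swap i hi h
    exact ⟨p, q, ⟨h.1, h.2, h.3, h.4, h.5, h.6, h.7⟩⟩

variable (E : ModifiedIntervalPair) {s : Side} {x : ℤ}

theorem hi_σ (s : Side) (x : ℤ) : E.hi s (E.σ s x) = E.hi s x := E.hi_eq_of_lo_eq (E.lo_σ s x)

theorem sum_σ (s : Side) (x : ℤ) : E.sum s (E.σ s x) = E.sum s x := E.sum_eq_of_lo_eq (E.lo_σ s x)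

theorem lo_le_σ (s : Side) (x : ℤ) : E.lo s x ≤ E.σ s x := E.lo_σ s x ▸ E.lo_le s _

theorem σ_le_hi (s : Side) (x : ℤ) : E.σ s x ≤ E.hi s x := E.hi_σ s x ▸ E.le_hi s _

theorem σ_injective (s : Side) : Function.Injective (E.σ s) :=
  Function.Involutive.injective (E.σ_σ s)

theorem antidiagonal_of_lt (h : E.σ s x < x) :
    2 * E.σ s x ≤ E.sum s x ∧ E.sum s x ≤ 2 * x := by
  have := E.antidiagonal s (E.σ s x) (by rwa [E.σ_σ])
  rwa [E.σ_σ, E.sum_σ] at this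

theorem σ_eq_of_not_marked (hx : ¬ E.Marked s x) (hx' : ¬ E.Marked s (x - 1)) :
    E.σ s x = E.sum s x - x := by
  by_contra h
  rcases lt_or_gt_of_ne h with h | h
  · exact hx (E.marked_of_lt s x x le_rfl (by omega))
  · exact hx' (E.marked_of_gt s x (x - 1) (by omega) (by omega))

/-- Reflect the line. -/
def reflect : ModifiedIntervalPair where
  toMarkedIntervalPair := E.toMarkedIntervalPair.reflect
  σ s x := -E.σ s (-x)
  σ_σ s x := by simp [E.σ_σ]
  lo_σ s x := by simp [MarkedIntervalPair.reflect, IntervalPair.reflect, E.hi_σ]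
  antidiagonal s x h := by
    have := E.antidiagonal_of_lt (s := s) (x := -x) (by omega)
    have : E.toMarkedIntervalPair.reflect.sum s x = _ := E.sum_reflect s x
    omega
  marked_of_lt s x i hxi hi := by
    have : E.toMarkedIntervalPair.reflect.sum s x = _ := E.sum_reflect s x
    exact E.marked_of_gt s (-x) (-1 - i) (by omega) (by omega)
  marked_of_gt s x i hi hix := by
    have : E.toMarkedIntervalPair.reflect.sum s x = _ := E.sum_reflect s x
    exact E.marked_of_lt s (-x) (-1 - i) (by omega) (by omega)
  exists_run s i hi h := by
    have hlt := E.lt_hi_of_marked s _ hi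
    have : E.toMarkedIntervalPair.reflect.sum s i = _ := E.sum_reflect_of_lt hlt
    obtain ⟨p, q, h⟩ := E.exists_run s _ (E.marked_mirror s _ hi) (by
      rw [E.sum_mirror hlt]
      omega)
    exact ⟨_, _, h.reflect hi rfl⟩

end ModifiedIntervalPair

/-! ### The difference of the two reflections along arcs -/

section Spiral

variable {rel : ℤ → ℤ → Prop} {c d δ : ℤ}

theorem rel_add_natCast_mul (hr : Equivalence rel) (hδ : 0 ≤ δ)
    (hstep : ∀ j, c ≤ j → j + δ < d → rel j (j + δ)) (k : ℕ) {j : ℤ} (hj : c ≤ j)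
    (hjd : j + k * δ < d) : rel j (j + k * δ) := by
  induction k with
  | zero => simpa using hr.refl j
  | succ k ih =>
    have hsucc : ((k + 1 : ℕ) : ℤ) * δ = k * δ + δ := by push_cast; ring
    have hk : (0 : ℤ) ≤ k * δ := by positivity
    rw [hsucc, ← add_assoc] at hjd ⊢
    exact hr.trans (ih (by omega)) (hstep _ (by omega) hjd)

/-- The orbit of `c` under two overlapping reflections with a common right end either returns to
`[c, c + δ)` or ends at a fixed point of one of them, as in the Euclidean algorithm. -/
theorem exists_rel_of_overlap (hr : Equivalence rel) (hδ : 0 < δ) (hcd : c + δ ≤ d)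
    (hsmall : ∀ i, c ≤ i → i < d → rel i (c + d - 1 - i))
    (hlarge : ∀ i, c + δ ≤ i → i < d → rel i (c + d + δ - 1 - i)) :
    (∃ i, c < i ∧ i < c + δ ∧ rel c i) ∨
      ∃ e, c ≤ e ∧ e < d ∧ rel c e ∧
        (2 * e = c + d - 1 ∨ c + δ ≤ e ∧ 2 * e = c + d + δ - 1) := by
  have hshift : ∀ (k : ℕ) {j}, c ≤ j → j + k * δ < d → rel j (j + k * δ) :=
    rel_add_natCast_mul hr hδ.le fun j hj hjd => by
      refine hr.trans (hsmall j hj (by omega)) ?_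
      convert hlarge (c + d - 1 - j) (by omega) (by omega) using 1
      omega
  obtain ⟨m, hm⟩ : ∃ m : ℕ, (m : ℤ) = (d - 1 - c) / δ :=
    ⟨((d - 1 - c) / δ).toNat, Int.toNat_of_nonneg (Int.ediv_nonneg (by omega) hδ.le)⟩
  have hdiv := Int.emod_add_mul_ediv (d - 1 - c) δ
  have hnonneg := Int.emod_nonneg (d - 1 - c) hδ.ne'
  have hlt := Int.emod_lt_of_pos (d - 1 - c) hδ
  rw [← hm, mul_comm] at hdiv
  rcases eq_or_ne ((d - 1 - c) % δ) 0 with hzero | hzero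
  · right
    obtain ⟨j, rfl | rfl⟩ := m.even_or_odd'
    all_goals have hj : (0 : ℤ) ≤ j * δ := by positivity
    · have hdouble : ((2 * j : ℕ) : ℤ) * δ = 2 * (j * δ) := by push_cast; ring
      exact ⟨c + j * δ, by omega, by omega, hshift j le_rfl (by omega), Or.inl (by omega)⟩
    · have hdouble : ((2 * j + 1 : ℕ) : ℤ) * δ = 2 * (j * δ) + δ := by push_cast; ring
      have hsucc : ((j + 1 : ℕ) : ℤ) * δ = j * δ + δ := by push_cast; ring
      exact ⟨c + (j + 1 : ℕ) * δ, by omega, by omega, hshift _ le_rfl (by omega),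
        Or.inr ⟨by omega, by omega⟩⟩
  · refine Or.inl ⟨c + (d - 1 - c) % δ, by omega, by omega, ?_⟩
    refine hr.trans (hsmall c le_rfl (by omega)) (hr.symm ?_)
    convert hshift m (j := c + (d - 1 - c) % δ) (by omega) (by omega) using 1
    omega

end Spiral

theorem MarkedIntervalPair.exists_sameMeander_of_overlap (E : MarkedIntervalPair) {c d δ : ℤ}
    {r s t : Side} (hδ : 0 < δ) (hcd : c + δ ≤ d)
    (hs : ∀ i, c ≤ i → i < d → i < E.hi s i ∧ E.sum s i = c + d)
    (ht : ∀ i, c + δ ≤ i → i < d → i < E.hi t i ∧ E.sum t i = c + d + δ)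
    (hc : E.Marked r c) (hcenter : 2 * c ≠ E.sum r c - 1) :
    ∃ i, c < i ∧ i < c + δ ∧ E.SameMeander c i := by
  refine (exists_rel_of_overlap E.equivalence hδ hcd (fun i hi hid => ?_)
    (fun i hi hid => ?_)).resolve_right ?_
  · rw [← (hs i hi hid).2]
    exact E.sameMeander_mirror s i (hs i hi hid).1
  · rw [← (ht i hi hid).2]
    exact E.sameMeander_mirror t i (ht i hi hid).1
  · rintro ⟨e, hce, hed, he, h | ⟨hle, h⟩⟩
    · exact hcenter (E.marked_of_end r s c e hc he (by rwa [(hs e hce hed).2]))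
    · exact hcenter (E.marked_of_end r t c e hc he (by rwa [(ht e hle hed).2]))

namespace ModifiedIntervalPair

variable (E : ModifiedIntervalPair) {u v x y : ℤ}

/-- The arrows `x → y` for the roots `ε_x - ε_y` given by the modified involutions. -/
def Arrow (x y : ℤ) : Prop := (x < y ∧ E.σ .above x = y) ∨ (y < x ∧ E.σ .below x = y)

theorem arrow_comm :
    E.Arrow x y ↔ (x < y ∧ E.σ .above y = x) ∨ (y < x ∧ E.σ .below y = x) := by
  constructor
  all_goals
    rintro (⟨h, rfl⟩ | ⟨h, rfl⟩)
    exacts [Or.inl ⟨h, E.σ_σ _ _⟩, Or.inr ⟨h, E.σ_σ _ _⟩]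

theorem swap_arrow : E.swap.Arrow x y ↔ E.Arrow y x := by
  rw [E.arrow_comm]
  exact or_comm

theorem exists_arrow_iff : (∃ y, E.Arrow x y) ↔ x < E.σ .above x ∨ E.σ .below x < x := by
  constructor
  · rintro ⟨y, ⟨h, rfl⟩ | ⟨h, rfl⟩⟩
    exacts [Or.inl h, Or.inr h]
  · rintro (h | h)
    exacts [⟨_, Or.inl ⟨h, rfl⟩⟩, ⟨_, Or.inr ⟨h, rfl⟩⟩]

theorem forall_not_arrow_from_iff :
    (∀ y, ¬ E.Arrow x y) ↔ E.σ .above x ≤ x ∧ x ≤ E.σ .below x := by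
  rw [← not_exists, exists_arrow_iff, not_or, not_lt, not_lt]

theorem forall_not_arrow_to_iff :
    (∀ y, ¬ E.Arrow y x) ↔ x ≤ E.σ .above x ∧ E.σ .below x ≤ x := by
  have h := E.swap.forall_not_arrow_from_iff (x := x)
  simp only [swap_arrow] at h
  rw [h, and_comm]
  rfl

theorem diff_neg_of_full_source (ha : x < E.σ .above x) (hb : E.σ .below x < x) :
    E.diff x < 0 := by
  have := E.antidiagonal _ _ ha
  have := E.antidiagonal_of_lt hb
  rw [IntervalPair.diff]
  by_contra! h
  have hpred := E.marked_of_gt .above x (x - 1) (by omega) (by omega)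
  have hx := E.marked_of_lt .below x x le_rfl (by omega)
  have hsum := E.sum_succ (E.lt_hi_of_marked _ _ hpred)
  rw [sub_add_cancel] at hsum
  exact E.not_marked_above_below ((E.marked_iff_marked_pred_of_center (by omega)).2 hpred) hx

theorem diff_pos_of_full_sink (ha : E.σ .above x < x) (hb : x < E.σ .below x) :
    0 < E.diff x := by
  have := E.swap.diff_neg_of_full_source (x := x) hb ha
  have : E.swap.diff x = _ := E.diff_swap x
  omega

theorem diff_nonpos_of_fixed_above (ha : E.σ .above x = x) (hb : E.σ .below x < x) :
    E.diff x ≤ 0 := by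
  have := E.antidiagonal_of_lt hb
  rw [IntervalPair.diff]
  by_contra! h
  have marked : ∀ i, E.sum .above x - x ≤ i → i < x → E.Marked .above i := fun i hi hix =>
    E.marked_of_gt .above x i (by omega) hix
  have hpred := marked (x - 1) (by omega) (by omega)
  have hsum := E.sum_succ (E.lt_hi_of_marked _ _ hpred)
  rw [sub_add_cancel] at hsum
  rcases eq_or_ne (2 * x) (E.sum .below x) with hcenter | hcenter
  · have hx := E.marked_of_lt .below x x le_rfl (by omega)
    exact E.not_marked_above_below hpred ((E.marked_iff_marked_pred_of_center hcenter).1 hx)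
  · have hlo := E.lo_le_σ .below x
    have hhi := E.le_hi .below x
    have hsum_below : E.sum .below (x - 1) = E.sum .below x := E.sum_eq (by omega) (by omega)
    have hhi_below : E.hi .below (x - 1) = E.hi .below x := E.hi_eq _ _ _ (by omega) (by omega)
    have hmirror := E.sameMeander_mirror .below (x - 1) (by omega)
    rw [hsum_below] at hmirror
    have := E.marked_unique _ _ _ _ hpred (marked _ (by omega) (by omega)) hmirror
    have := E.marked_of_end _ .below _ _ hpred (E.equivalence.refl _) (by omega)
    omega

theorem diff_nonpos_of_fixed_below (hb : E.σ .below x = x) (ha : x < E.σ .above x) :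
    E.diff x ≤ 0 := by
  have h := E.reflect.swap.diff_nonpos_of_fixed_above (x := -x)
    (by simp [swap, reflect, Side.swap, hb]) (by simp [swap, reflect, Side.swap, ha])
  have hswap : E.reflect.swap.diff (-x) = _ := E.reflect.diff_swap (-x)
  have hreflect : E.reflect.diff (-x) = _ := E.diff_reflect (-x)
  rw [neg_neg] at hreflect
  omega

theorem diff_nonpos_of_source (hto : ∀ y, ¬ E.Arrow y x) (hfrom : ∃ y, E.Arrow x y) :
    E.diff x ≤ 0 := by
  rw [forall_not_arrow_to_iff] at hto
  rw [exists_arrow_iff] at hfrom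
  rcases hto.1.lt_or_eq with ha | ha <;> rcases hto.2.lt_or_eq with hb | hb
  · exact (E.diff_neg_of_full_source ha hb).le
  · exact E.diff_nonpos_of_fixed_below hb ha
  · exact E.diff_nonpos_of_fixed_above ha.symm hb
  · omega

theorem diff_nonneg_of_sink (hfrom : ∀ y, ¬ E.Arrow x y) (hto : ∃ y, E.Arrow y x) :
    0 ≤ E.diff x := by
  have := E.swap.diff_nonpos_of_source (x := x) (by simpa only [swap_arrow])
    (by simpa only [swap_arrow])
  have : E.swap.diff x = _ := E.diff_swap x
  omega

theorem not_lt_of_isolated (hlo : ∀ s, E.lo s x = E.lo s y) (hx : ∀ s, E.σ s x = x)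
    (hy : ∀ s, E.σ s y = y) : ¬ x < y := by
  intro hxy
  wlog hdiff : 0 ≤ E.diff x generalizing E
  · have hswap : E.swap.diff x = _ := E.diff_swap x
    exact this E.swap (fun s => hlo _) (fun s => hx _) (fun s => hy _) (by omega)
  have hsum := fun s => E.sum_eq_of_lo_eq (hlo s)
  have hsum_above := hsum .above
  have hsum_below := hsum .below
  rw [IntervalPair.diff] at hdiff
  have marked_x := fun s i => E.marked_of_lt s x i
  have marked_y := fun s i => E.marked_of_gt s y i
  simp only [hx, hy] at marked_x marked_y
  by_cases habove : 2 * x < E.sum .above x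
  · exact E.not_marked_above_below (marked_x .above x le_rfl (by omega))
      (marked_x .below x le_rfl (by omega))
  by_cases hbelow : E.sum .below x < 2 * y
  · exact E.not_marked_above_below (marked_y .above (y - 1) (by omega) (by omega))
      (marked_y .below (y - 1) (by omega) (by omega))
  · exact E.not_marked_above_below (marked_y .above x (by omega) (by omega))
      (marked_x .below x le_rfl (by omega))

theorem isolated_unique (hlo : ∀ s, E.lo s x = E.lo s y) (hx : ∀ s, E.σ s x = x)
    (hy : ∀ s, E.σ s y = y) : x = y :=
  le_antisymm (not_lt.1 (E.not_lt_of_isolated (fun s => (hlo s).symm) hy hx))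
    (not_lt.1 (E.not_lt_of_isolated hlo hx hy))

theorem eq_hi_below_of_cross (huv : u < v) (hσ : E.σ .above u = v)
    (hlo : E.lo .below u ≠ E.lo .below v) (hneg : E.diff v < 0) : v = E.hi .below v := by
  have hsum : E.sum .above v = E.sum .above u := by rw [← hσ, E.sum_σ]
  have hanti := E.antidiagonal .above u (by omega)
  have hgap := E.hi_lt_lo huv hlo
  have hu := E.le_hi .below u
  have hv := E.lo_le .below v
  have marked : ∀ i, u ≤ i → i < E.sum .above v - v → E.Marked .above i := fun i hi hiv =>
    E.marked_of_lt .above u i hi (by omega)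
  by_contra hne
  have hlt : v < E.hi .below v := lt_of_le_of_ne (E.le_hi _ _) hne
  rw [IntervalPair.diff] at hneg
  have hbelow : E.sum .below v = E.lo .below v + E.hi .below v := rfl
  have hmarked : E.Marked .above v := by
    have hsum' : E.sum .above (E.sum .above v - v - 1) = E.sum .above v :=
      (E.sum_eq (by have := E.lo_le .above u; omega)
        (by have := E.σ_le_hi .above u; omega)).trans hsum.symm
    convert E.marked_mirror _ _ (marked (E.sum .above v - v - 1) (by omega) (by omega)) using 1
    omega
  have := E.marked_unique _ _ _ _ hmarked (marked _ (by omega) (by omega))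
    (E.sameMeander_mirror .below v hlt)
  have := E.marked_of_end .above .below v v hmarked (E.equivalence.refl v) (by omega)
  omega

theorem diff_nonneg_of_cross (huv : u < v) (hσ : E.σ .above u = v)
    (hlo : E.lo .below u ≠ E.lo .below v) : 0 ≤ E.diff v := by
  by_contra! hneg
  have hhi := E.eq_hi_below_of_cross huv hσ hlo hneg
  have hsum : E.sum .above v = E.sum .above u := by rw [← hσ, E.sum_σ]
  have hanti := E.antidiagonal .above u (by omega)
  have hgap := E.hi_lt_lo huv hlo
  have hu := E.le_hi .below u
  have hv := E.lo_le .below v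
  have hbelow : E.sum .below v = E.lo .below v + E.hi .below v := rfl
  rw [IntervalPair.diff] at hneg
  have above : ∀ i, u ≤ i → i < v → i < E.hi .above i ∧ E.sum .above i = E.sum .above v := by
    intro i hui hiv
    have := E.lo_le .above u
    have := E.σ_le_hi .above u
    have := E.hi_eq .above u i (by omega) (by omega)
    exact ⟨by omega, (E.sum_eq (by omega) (by omega)).trans hsum.symm⟩
  have marked : ∀ i, u ≤ i → i < E.sum .above v - v → E.Marked .above i := fun i hi hiv =>
    E.marked_of_lt .above u i hi (by omega)
  have hlo_above := (above (E.lo .below v) (by omega) (by omega)).2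
  obtain ⟨i, hi, hi', hsame⟩ := E.exists_sameMeander_of_overlap (s := .below) (t := .above)
    (c := E.lo .below v) (d := E.hi .below v) (δ := E.sum .above v - E.sum .below v) (by omega)
    (by omega) (fun i hi hi' => by
      have := E.hi_eq .below v i hi hi'.le
      exact ⟨by omega, E.sum_eq hi hi'.le⟩)
    (fun i hi hi' => by
      have := above i (by omega) (by omega)
      omega)
    (marked _ (by omega) (by omega)) (by omega)
  have := E.marked_unique _ _ _ _ (marked _ (by omega) (by omega))
    (marked i (by omega) (by omega)) hsame
  omega

theorem diff_lt_of_cross_above (huv : u < v) (hσ : E.σ .above u = v)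
    (hlo : E.lo .below u ≠ E.lo .below v) :
    E.diff u ≤ 0 ∧ 0 ≤ E.diff v ∧ E.diff u < E.diff v := by
  refine ⟨?_, E.diff_nonneg_of_cross huv hσ hlo, ?_⟩
  · have h := E.reflect.diff_nonneg_of_cross (u := -v) (v := -u) (by omega)
      (by simp [reflect, ← hσ, E.σ_σ]) (fun h => by
        have : E.hi .below v = E.hi .below u := by
          simpa [reflect, MarkedIntervalPair.reflect, IntervalPair.reflect] using h
        have := E.hi_lt_lo huv hlo
        have := E.lo_le .below v
        have := E.le_hi .below v
        omega)
    have hreflect : E.reflect.diff (-u) = _ := E.diff_reflect (-u)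
    rw [neg_neg] at hreflect
    omega
  · have := E.sum_lt huv hlo
    have := E.sum_σ .above u
    rw [hσ] at this
    simp only [IntervalPair.diff]
    omega

theorem cell_eq_or_cross (h : E.Arrow u v) :
    E.cell u = E.cell v ∨ (E.diff u ≤ 0 ∧ 0 ≤ E.diff v ∧ E.diff u < E.diff v) := by
  refine or_iff_not_imp_left.2 fun hc => ?_
  rcases h with ⟨huv, rfl⟩ | ⟨hvu, rfl⟩
  · exact E.diff_lt_of_cross_above huv rfl (E.lo_below_ne (E.lo_σ .above u).symm hc)
  · have := E.swap.diff_lt_of_cross_above (u := E.σ .below u) (v := u) hvu (E.σ_σ _ _)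
      (E.lo_above_ne (E.lo_σ .below u).symm hc).symm
    have hdiff : ∀ x, E.swap.diff x = _ := E.diff_swap
    simp only [hdiff] at this
    omega

section Fork

variable (ha : x < E.σ .above x) (hb : x < E.σ .below x) (hdiff : 0 < E.diff x)
  (hle : E.σ .below x ≤ E.σ .above x)

include ha hb hdiff hle

theorem sum_above_sub_σ_le : E.sum .above x - E.σ .above x ≤ x := by
  rw [IntervalPair.diff] at hdiff
  have := E.antidiagonal _ _ ha
  have := E.antidiagonal _ _ hb
  by_contra! h
  exact E.not_marked_above_below (E.marked_of_lt .above x x le_rfl h)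
    (E.marked_of_lt .below x x le_rfl (by omega))

theorem le_sum_below_sub_σ : x ≤ E.sum .below x - E.σ .below x := by
  rw [IntervalPair.diff] at hdiff
  have := E.antidiagonal _ _ ha
  have := E.antidiagonal _ _ hb
  by_contra! h
  exact E.not_marked_above_below (E.marked_of_gt .above x (x - 1) (by omega) (by omega))
    (E.marked_of_gt .below x (x - 1) (by omega) (by omega))

omit hle in
theorem σ_above_lt_σ_below (hc : E.lo .below (E.σ .above x) = E.lo .below x) :
    E.σ .above x < E.σ .below x := by
  by_contra! hle
  have hsub_le := E.sum_above_sub_σ_le ha hb hdiff hle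
  have hle_sub := E.le_sum_below_sub_σ ha hb hdiff hle
  rw [IntervalPair.diff] at hdiff
  have := E.antidiagonal _ _ ha
  have := E.antidiagonal _ _ hb
  have marked_above := E.marked_of_gt .above x
  have marked_below := E.marked_of_lt .below x
  have hhi : E.σ .above x ≤ E.hi .below x := by
    rw [← E.hi_eq_of_lo_eq hc]
    exact E.le_hi _ _
  have hsum : ∀ s, E.sum s x = E.lo s x + E.hi s x := fun s => rfl
  have block : ∀ s i, E.lo s x ≤ i → i < E.σ .above x →
      i < E.hi s i ∧ E.sum s i = E.sum s x := by
    intro s i hi hi'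
    have hhi' : E.σ .above x ≤ E.hi s x := by cases s; exacts [E.σ_le_hi .above x, hhi]
    have := E.hi_eq s x i hi (by omega)
    exact ⟨by omega, E.sum_eq hi (by omega)⟩
  have := E.σ_le_hi .above x
  have hsum_above := hsum .above
  have hsum_below := hsum .below
  have overlap := fun r => E.exists_sameMeander_of_overlap (r := r) (s := .above) (t := .below)
    (c := E.sum .above x - E.σ .above x) (d := E.σ .above x)
    (δ := E.sum .below x - E.sum .above x) (by omega) (by omega)
    (fun i hi hi' => by have := block .above i (by omega) hi'; omega)
    (fun i hi hi' => by have := block .below i (by omega) hi'; omega)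
  rcases hsub_le.lt_or_eq with hlt | heq
  · have hsum' := (block .above (E.sum .above x - E.σ .above x) (by omega) (by omega)).2
    have hmarked := marked_above _ le_rfl hlt
    obtain ⟨i, hi, hi', hsame⟩ := overlap .above hmarked (by omega)
    rcases lt_or_ge i x with hix | hix
    · have := E.marked_unique _ _ _ _ hmarked (marked_above i (by omega) hix) hsame
      omega
    · exact nomatch (E.marked_unique _ _ _ _ hmarked (marked_below i hix (by omega)) hsame).1
  · rw [heq] at overlap
    have hmarked := marked_below x le_rfl (by omega)
    obtain ⟨i, hi, hi', hsame⟩ := overlap .below hmarked (by omega)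
    have := E.marked_unique _ _ _ _ hmarked (marked_below i (by omega) (by omega)) hsame
    omega

end Fork

end ModifiedIntervalPair

/-! ### Acyclicity of the arcs -/

namespace ModifiedIntervalPair

/-- A set of points of the cell of `x₀` that is a union of meanders and on which the arcs above and
below leave in the same direction, as they do along a directed cycle. -/
structure IsAlternating (E : ModifiedIntervalPair) (x₀ : ℤ) (K : Set ℤ) : Prop where
  mem : x₀ ∈ K
  lo_eq : ∀ x ∈ K, ∀ s, E.lo s x = E.lo s x₀
  σ_mem : ∀ x ∈ K, ∀ s, E.σ s x ∈ K
  lt_or_gt : ∀ x ∈ K, (∀ s, x < E.σ s x) ∨ ∀ s, E.σ s x < x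

namespace IsAlternating

variable {E : ModifiedIntervalPair} {x₀ x P p q t : ℤ} {K : Set ℤ} {s : Side}

theorem lo_le (hK : E.IsAlternating x₀ K) (hx : x ∈ K) (s : Side) : E.lo s x₀ ≤ x :=
  hK.lo_eq x hx s ▸ E.lo_le s x

theorem le_hi (hK : E.IsAlternating x₀ K) (hx : x ∈ K) (s : Side) : x ≤ E.hi s x₀ :=
  E.hi_eq_of_lo_eq (hK.lo_eq x hx s) ▸ E.le_hi s x

theorem σ_σ_lt (hK : E.IsAlternating x₀ K) (hx : x ∈ K) (h : x < E.σ s x) (t : Side) :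
    E.σ t (E.σ s x) < E.σ s x := by
  refine (hK.lt_or_gt _ (hK.σ_mem x hx s)).resolve_left (fun h' => ?_) t
  have := h' s
  rw [E.σ_σ] at this
  omega

theorem lt_σ_σ (hK : E.IsAlternating x₀ K) (hx : x ∈ K) (h : E.σ s x < x) (t : Side) :
    E.σ s x < E.σ t (E.σ s x) := by
  refine (hK.lt_or_gt _ (hK.σ_mem x hx s)).resolve_right (fun h' => ?_) t
  have := h' s
  rw [E.σ_σ] at this
  omega

theorem swap (hK : E.IsAlternating x₀ K) : E.swap.IsAlternating x₀ K where
  mem := hK.mem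
  lo_eq x hx s := hK.lo_eq x hx s.swap
  σ_mem x hx s := hK.σ_mem x hx s.swap
  lt_or_gt x hx := (hK.lt_or_gt x hx).imp (fun h s => h s.swap) fun h s => h s.swap

theorem diff_nonpos (hK : E.IsAlternating x₀ K) : E.diff x₀ ≤ 0 := by
  by_contra! hdiff
  obtain ⟨r₀, hr₀, hr₀σ⟩ : ∃ r ∈ K, ∀ s, E.σ s r < r :=
    (hK.lt_or_gt x₀ hK.mem).elim
      (fun h => ⟨_, hK.σ_mem x₀ hK.mem .above, hK.σ_σ_lt hK.mem (h .above)⟩)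
      (fun h => ⟨x₀, hK.mem, h⟩)
  have hfin : {r | r ∈ K ∧ ∀ s, E.σ s r < r}.Finite :=
    (Set.finite_Icc (E.lo .above x₀) (E.hi .above x₀)).subset fun x hx =>
      ⟨hK.lo_le hx.1 _, hK.le_hi hx.1 _⟩
  obtain ⟨r, ⟨hr, hrσ⟩, hmax⟩ := Set.exists_max_image _ id hfin ⟨r₀, hr₀, hr₀σ⟩
  have hleft := hK.σ_mem r hr .above
  have hleftσ := hK.lt_σ_σ hr (hrσ .above)
  have hlt := E.σ_above_lt_σ_below (hleftσ .above) (hleftσ .below)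
    (by rwa [E.diff_eq_of_lo_eq (hK.lo_eq _ hleft)])
    (by rw [E.σ_σ, hK.lo_eq r hr, hK.lo_eq _ hleft])
  have hle := hmax _ ⟨hK.σ_mem _ hleft .below, hK.σ_σ_lt hleft (hleftσ .below)⟩
  rw [E.σ_σ] at hlt
  exact absurd hle (not_le.2 hlt)

theorem lo_lt_hi (hK : E.IsAlternating x₀ K) (s : Side) : E.lo s x₀ < E.hi s x₀ := by
  have := E.lo_le_σ s x₀
  have := E.σ_le_hi s x₀
  have := E.lo_le s x₀
  have := E.le_hi s x₀
  rcases hK.lt_or_gt x₀ hK.mem with h | h <;> have := h s <;> omega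

section Zero

variable (hK : E.IsAlternating x₀ K) (hP : ∀ s, E.sum s x₀ = P)

include hK hP

theorem sum_eq (hx : x ∈ K) (s : Side) : E.sum s x = P :=
  (E.sum_eq_of_lo_eq (hK.lo_eq x hx s)).trans (hP s)

theorem block_of_folded (hx : x ∈ K ∨ P - x ∈ K) (s : Side) :
    E.lo s x₀ ≤ x ∧ x ≤ E.hi s x₀ := by
  have hsum : E.lo s x₀ + E.hi s x₀ = P := hP s
  rcases hx with h | h
  all_goals
    have := hK.lo_le h s
    have := hK.le_hi h s
    omega

theorem exists_marked (hx : 2 * x ≤ P) (hx' : x ∈ K ∨ P - x ∈ K) : ∃ s, E.Marked s x := by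
  have hsum : ∀ s, E.lo s x₀ + E.hi s x₀ = P := hP
  refine E.exists_marked_of_sum_eq hP (fun s => (hK.block_of_folded hP hx' s).1) fun s => ?_
  have := hsum s
  have := hK.lo_lt_hi s
  omega

theorem two_mul_ne (hx : x ∈ K) : 2 * x ≠ P := by
  intro hcenter
  obtain ⟨s, hs⟩ := hK.exists_marked hP hcenter.le (Or.inl hx)
  have hns : ¬ E.Marked s.swap x := fun h => s.ne_swap (E.side_eq_of_marked hs h)
  have hσ := E.σ_eq_of_not_marked hns fun h =>
    hns ((E.marked_iff_marked_pred_of_center (by rw [hK.sum_eq hP hx, hcenter])).2 h)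
  rw [hK.sum_eq hP hx] at hσ
  rcases hK.lt_or_gt x hx with h | h <;> have := h s.swap <;> omega

theorem two_mul_lt (hx : x ∈ K) (h : x < E.σ s x) : 2 * x < P := by
  have hle := (E.antidiagonal s x h).1
  rw [hK.sum_eq hP hx] at hle
  exact lt_of_le_of_ne hle (hK.two_mul_ne hP hx)

theorem lt_two_mul (hx : x ∈ K) (h : E.σ s x < x) : P < 2 * x := by
  have hle := (E.antidiagonal_of_lt h).2
  rw [hK.sum_eq hP hx] at hle
  exact lt_of_le_of_ne hle (hK.two_mul_ne hP hx).symm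

theorem lt_two_mul_σ (hx : x ∈ K) (h : 2 * x < P) (s : Side) : P < 2 * E.σ s x := by
  refine hK.lt_two_mul hP (hK.σ_mem x hx s) (hK.σ_σ_lt hx ?_ s)
  exact (hK.lt_or_gt x hx).resolve_right (fun h' => (hK.lt_two_mul hP hx (h' s)).not_gt h) s

theorem two_mul_σ_lt (hx : x ∈ K) (h : P < 2 * x) (s : Side) : 2 * E.σ s x < P := by
  refine hK.two_mul_lt hP (hK.σ_mem x hx s) (hK.lt_σ_σ hx ?_ s)
  exact (hK.lt_or_gt x hx).resolve_left (fun h' => (hK.two_mul_lt hP hx (h' s)).not_gt h) s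

theorem exists_max_folded : ∃ t, 2 * t < P ∧ (t ∈ K ∨ P - t ∈ K) ∧
    ∀ x, 2 * x < P → x ∈ K ∨ P - x ∈ K → x ≤ t := by
  have hfin : {x : ℤ | 2 * x < P ∧ (x ∈ K ∨ P - x ∈ K)}.Finite :=
    (Set.finite_Icc (E.lo .above x₀) (E.hi .above x₀)).subset fun x hx =>
      hK.block_of_folded hP hx.2 .above
  have hne : {x : ℤ | 2 * x < P ∧ (x ∈ K ∨ P - x ∈ K)}.Nonempty := by
    rcases lt_or_gt_of_ne (hK.two_mul_ne hP hK.mem) with h | h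
    · exact ⟨x₀, h, Or.inl hK.mem⟩
    · exact ⟨P - x₀, by omega, Or.inr (by simpa using hK.mem)⟩
  obtain ⟨t, ⟨ht, htK⟩, hmax⟩ := Set.exists_max_image _ id hfin hne
  exact ⟨t, ht, htK, fun x hx hxK => hmax x ⟨hx, hxK⟩⟩

end Zero

/-- The points of `K` in `[p, P / 2)`. -/
def leftPart (P p : ℤ) (K : Set ℤ) : Set ℤ := {x | p ≤ x ∧ 2 * x < P ∧ x ∈ K}

theorem finite_leftPart (P p : ℤ) (K : Set ℤ) : (leftPart P p K).Finite :=
  (Set.finite_Icc p (P - p)).subset fun x ⟨hp, hx, _⟩ => ⟨hp, by omega⟩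

section Run

variable (hK : E.IsAlternating x₀ K) (hP : ∀ s, E.sum s x₀ = P)
  (hmax : ∀ x, 2 * x < P → x ∈ K ∨ P - x ∈ K → x ≤ q) (hrun : E.IsModifiedRun (E.σ s) s t p q)

include hK hP hrun in
theorem σ_swap_eq (hpx : p < x) (hxq : x ≤ q) (hx : x ∈ K ∨ P - x ∈ K) :
    E.σ s.swap x = P - x := by
  have not_marked : ∀ y, p ≤ y → y ≤ q → ¬ E.Marked s.swap y := fun y hpy hyq h =>
    s.ne_swap (E.side_eq_of_marked (hrun.marked y hpy hyq) h)
  obtain ⟨hlo, hhi⟩ := hK.block_of_folded hP hx s.swap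
  rw [E.σ_eq_of_not_marked (not_marked x hpx.le hxq) (not_marked _ (by omega) (by omega)),
    E.sum_eq hlo hhi, hP]

include hK hP hmax hrun in
theorem mem_leftPart_iff (hxp : x ≠ p) :
    x ∈ leftPart P p K ↔ x ∈ leftPart P p ((P - ·) ⁻¹' K) := by
  constructor
  · rintro ⟨hpx, hxP, hx⟩
    have hσ := hK.σ_swap_eq hP hrun (lt_of_le_of_ne hpx hxp.symm) (hmax x hxP (Or.inl hx))
      (Or.inl hx)
    exact ⟨hpx, hxP, show P - x ∈ K from hσ ▸ hK.σ_mem x hx _⟩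
  · rintro ⟨hpx, hxP, hx⟩
    have hσ := hK.σ_swap_eq hP hrun (lt_of_le_of_ne hpx hxp.symm) (hmax x hxP (Or.inr hx))
      (Or.inr hx)
    have := hK.σ_mem (P - x) hx s.swap
    rw [← hσ, E.σ_σ] at this
    exact ⟨hpx, hxP, this⟩

variable (htP : E.sum s t = P)

include hmax in
theorem mem_runSet (hx : x ∈ leftPart P p K) : x ∈ runSet P p q := by
  have := hmax x hx.2.1 (Or.inl hx.2.2)
  simp only [runSet, Set.mem_ofPred_eq]
  have := hx.1
  have := hx.2.1
  omega

include hK hP hmax hrun htP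

theorem sub_σ_mem_leftPart (hx : x ∈ leftPart P p K) :
    P - E.σ s x ∈ leftPart P p ((P - ·) ⁻¹' K) := by
  have hmem := hrun.isAntiToeplitz.stable x (by rw [htP]; exact mem_runSet hmax hx)
  rw [htP] at hmem
  have := hK.lt_two_mul_σ hP hx.2.2 hx.2.1 s
  exact ⟨by have := hmem.2.1; omega, by omega, by simpa using hK.σ_mem x hx.2.2 s⟩

theorem σ_sub_mem_leftPart (hx : x ∈ leftPart P p ((P - ·) ⁻¹' K)) :
    E.σ s (P - x) ∈ leftPart P p K := by
  have hmem := hrun.isAntiToeplitz.stable (P - x) (by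
    rw [htP, reflect_mem_runSet]
    refine mem_runSet (K := (P - ·) ⁻¹' K) (fun y hy hyK => hmax y hy ?_) hx
    simpa [or_comm] using hyK)
  have := hx.2.1
  exact ⟨hmem.1, hK.two_mul_σ_lt (x := P - x) hP hx.2.2 (by omega) s, hK.σ_mem _ hx.2.2 s⟩

/-- The two finite sets agree except possibly at `p`, and `σ` composed with the reflection embeds
each into the other. -/
theorem leftPart_eq : leftPart P p K = leftPart P p ((P - ·) ⁻¹' K) := by
  have hcard : (leftPart P p K).ncard = (leftPart P p ((P - ·) ⁻¹' K)).ncard := by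
    apply le_antisymm
    · refine Set.ncard_le_ncard_of_injOn (P - E.σ s ·)
        (fun x hx => hK.sub_σ_mem_leftPart hP hmax hrun htP hx) ?_ (finite_leftPart _ _ _)
      exact ((sub_right_injective).comp (E.σ_injective s)).injOn
    · refine Set.ncard_le_ncard_of_injOn (E.σ s <| P - ·)
        (fun x hx => hK.σ_sub_mem_leftPart hP hmax hrun htP hx) ?_ (finite_leftPart _ _ _)
      exact ((E.σ_injective s).comp (sub_right_injective)).injOn
  have hne : ∀ x ≠ p, x ∈ leftPart P p K ↔ x ∈ leftPart P p ((P - ·) ⁻¹' K) := fun x hx =>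
    hK.mem_leftPart_iff hP hmax hrun hx
  by_cases hp : p ∈ leftPart P p K
  · refine (Set.eq_of_subset_of_ncard_le (fun x hx => ?_) hcard.le (finite_leftPart _ _ _)).symm
    rcases eq_or_ne x p with rfl | hxp
    exacts [hp, (hne x hxp).2 hx]
  · refine Set.eq_of_subset_of_ncard_le (fun x hx => ?_) hcard.ge (finite_leftPart _ _ _)
    exact (hne x fun h => hp (h ▸ hx)).1 hx

theorem leftPart_eq_empty : leftPart P p K = ∅ := by
  by_contra! hne
  have hrun' := hrun.isAntiToeplitz
  rw [htP] at hrun'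
  have heq := hK.leftPart_eq hP hmax hrun htP
  have runSet_of_mem := fun x => mem_runSet (x := x) (p := p) hmax
  have step : ∀ x ∈ leftPart P p K, P - E.σ s x ∈ leftPart P p K := fun x hx =>
    heq ▸ hK.sub_σ_mem_leftPart hP hmax hrun htP hx
  have step' : ∀ x ∈ leftPart P p K, E.σ s (P - x) ∈ leftPart P p K := fun x hx =>
    hK.σ_sub_mem_leftPart hP hmax hrun htP (heq ▸ hx)
  rcases le_or_gt P (2 * q + 2) with hq | hq
  · obtain ⟨x, hx⟩ := hne
    have := (hrun'.cyclic hq _ runSet_of_mem ⟨x, hx⟩ step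
      (reflect_mem_runSet.2 (runSet_of_mem x hx))).2.1
    have := hx.2.1
    omega
  · have hsub := hrun'.transitive {x | x ∈ leftPart P p K ∨ P - x ∈ leftPart P p K}
      (fun x hx => hx.elim (runSet_of_mem x) fun hx =>
        reflect_mem_runSet.1 (runSet_of_mem _ hx))
      (hne.mono fun x hx => Or.inl hx)
      (fun x hx => hx.elim (fun hx => Or.inr (step x hx)) fun hx => Or.inl (by
        simpa using step' _ hx))
      (fun x hx => hx.elim (fun hx => Or.inr (by simpa using hx)) Or.inl)
    have := hrun.le_left
    have := hrun.le_right
    rcases hsub (show q + 1 ∈ runSet P p q from ⟨by omega, by omega, by omega⟩) with h | h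
    · have := hmax _ h.2.1 (Or.inl h.2.2)
      omega
    · have := hmax _ h.2.1 (Or.inl h.2.2)
      omega

end Run

theorem diff_ne_zero (hK : E.IsAlternating x₀ K) : E.diff x₀ ≠ 0 := by
  intro hdiff
  have hP := fun s => E.sum_eq_of_diff_eq_zero hdiff s .above
  generalize E.sum .above x₀ = P at hP
  obtain ⟨t, ht, htK, hmax⟩ := hK.exists_max_folded hP
  obtain ⟨s, hs⟩ := hK.exists_marked hP ht.le htK
  have htP : E.sum s t = P :=
    (E.sum_eq (hK.block_of_folded hP htK s).1 (hK.block_of_folded hP htK s).2).trans (hP s)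
  obtain ⟨p, q, hrun⟩ := E.exists_run s t hs (by omega)
  have hmax' : ∀ x, 2 * x < P → x ∈ K ∨ P - x ∈ K → x ≤ q := fun x hx hxK =>
    (hmax x hx hxK).trans hrun.le_right
  have hempty := hK.leftPart_eq_empty hP hmax' hrun htP
  have heq := hK.leftPart_eq hP hmax' hrun htP
  rcases htK with h | h
  · exact Set.notMem_empty t (hempty ▸ ⟨hrun.le_left, ht, h⟩)
  · exact Set.notMem_empty t (heq.symm.trans hempty ▸ ⟨hrun.le_left, ht, h⟩)

end IsAlternating

variable (E : ModifiedIntervalPair) {u v x x₀ : ℤ} {K : Set ℤ}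

theorem not_isAlternating : ¬ E.IsAlternating x₀ K := fun hK => by
  have := hK.diff_nonpos
  have := hK.diff_ne_zero
  have := hK.swap.diff_nonpos
  have : E.swap.diff x₀ = _ := E.diff_swap x₀
  omega

open Relation

theorem diff_le_of_reflTransGen (h : ReflTransGen E.Arrow u v) : E.diff u ≤ E.diff v := by
  induction h with
  | refl => exact le_rfl
  | tail _ h ih =>
    refine ih.trans ?_
    rcases E.cell_eq_or_cross h with h | h
    · exact (E.diff_eq_of_lo_eq (E.cell_eq_iff.1 h)).le
    · exact h.2.2.le

theorem lo_eq_of_arrow_of_reflTransGen (h : E.Arrow u v) (h' : ReflTransGen E.Arrow v u)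
    (s : Side) : E.lo s u = E.lo s v :=
  E.cell_eq_iff.1 ((E.cell_eq_or_cross h).resolve_right
    fun h => h.2.2.not_ge (E.diff_le_of_reflTransGen h')) s

theorem acyclic (x₀ : ℤ) : ¬ TransGen E.Arrow x₀ x₀ := by
  intro hx₀
  set K : Set ℤ := {x | TransGen E.Arrow x x ∧ ∀ s, E.lo s x = E.lo s x₀}
  have neighbours : ∀ x ∈ K,
      (∀ s, E.σ s x ∈ K) ∧ ((∀ s, x < E.σ s x) ∨ ∀ s, E.σ s x < x) := by
    rintro x ⟨hx, hxc⟩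
    obtain ⟨w, hxw, hwx⟩ := TransGen.head'_iff.1 hx
    obtain ⟨v, hxv, hvx⟩ := TransGen.tail'_iff.1 hx
    have hw : w ∈ K := ⟨TransGen.tail' hwx hxw, fun s =>
      (E.lo_eq_of_arrow_of_reflTransGen hxw hwx s).symm.trans (hxc s)⟩
    have hv : v ∈ K := ⟨TransGen.head' hvx hxv, fun s =>
      (E.lo_eq_of_arrow_of_reflTransGen hvx hxv s).trans (hxc s)⟩
    rw [E.arrow_comm] at hvx
    rcases hxw with ⟨hxw, rfl⟩ | ⟨hxw, rfl⟩ <;> rcases hvx with ⟨hvx, rfl⟩ | ⟨hvx, rfl⟩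
    · omega
    · exact ⟨fun s => by cases s; exacts [hw, hv], Or.inl fun s => by cases s; exacts [hxw, hvx]⟩
    · exact ⟨fun s => by cases s; exacts [hv, hw], Or.inr fun s => by cases s; exacts [hvx, hxw]⟩
    · omega
  exact E.not_isAlternating (x₀ := x₀) (K := K)
    ⟨⟨hx₀, fun _ => rfl⟩, fun x hx => hx.2, fun x hx => (neighbours x hx).1,
      fun x hx => (neighbours x hx).2⟩

end ModifiedIntervalPair

/-! ### Sources on which the difference vanishes -/

/-- The modified involution followed by the reflection in the centre of its block. -/
def rotation (σ : ℤ → ℤ) (P x : ℤ) : ℤ := P - σ x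

theorem iterate_rotation_σ_iterate {σ : ℤ → ℤ} (hσ : Function.Involutive σ) (P x : ℤ) (k : ℕ) :
    (rotation σ P)^[k] (σ ((rotation σ P)^[k] x)) = σ x := by
  induction k with
  | zero => rfl
  | succ k ih =>
    rw [Function.iterate_succ_apply, Function.iterate_succ_apply']
    simpa only [rotation, hσ _, sub_sub_cancel] using ih

namespace IsAntiToeplitz

open Function

variable {σ : ℤ → ℤ} {P p q x y z : ℤ} (h : IsAntiToeplitz σ P p q)

include h

theorem iterate_rotation_mem (hx : x ∈ runSet P p q) (k : ℕ) :
    (rotation σ P)^[k] x ∈ runSet P p q := by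
  induction k with
  | zero => exact hx
  | succ k ih =>
    rw [iterate_succ_apply']
    exact reflect_mem_runSet.2 (h.stable _ ih)

theorem exists_left_of_right (hσ : Injective σ) (hq : P ≤ 2 * q + 2) (hx : x ∈ runSet P p q)
    (hPx : P < 2 * x) : ∃ v ∈ runSet P p q, 2 * v < P ∧ (2 * σ v ≤ P ∨ σ v = x) := by
  by_contra! hne
  set L := {v | v ∈ runSet P p q ∧ 2 * v < P}
  set R := {v | v ∈ runSet P p q ∧ P < 2 * v}
  have finite : (runSet P p q).Finite :=
    (Set.finite_Icc p (P - p)).subset fun v hv => (mem_runSet_of_two_mul_le hq).1 hv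
  have hL : L.Finite := finite.subset fun v hv => hv.1
  have hR : R.Finite := finite.subset fun v hv => hv.1
  have card_le : R.ncard ≤ L.ncard :=
    Set.ncard_le_ncard_of_injOn (P - ·)
      (fun v hv => ⟨reflect_mem_runSet.2 hv.1, show 2 * (P - v) < P by have := hv.2; omega⟩)
      sub_right_injective.injOn hL
  have le_card : L.ncard ≤ (R \ {x}).ncard :=
    Set.ncard_le_ncard_of_injOn σ
      (fun v hv => ⟨⟨h.stable v hv.1, (hne v hv.1 hv.2).1⟩, (hne v hv.1 hv.2).2⟩)
      hσ.injOn hR.sdiff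
  have := Set.ncard_sdiff_singleton_lt_of_mem (show x ∈ R from ⟨hx, hPx⟩) hR
  omega

variable (hq : P ≤ 2 * q + 2)

include hq

theorem exists_iterate_rotation_eq (hx : x ∈ runSet P p q) (hy : y ∈ runSet P p q) :
    ∃ k : ℕ, (rotation σ P)^[k + 1] x = y := by
  refine h.cyclic hq {y | ∃ k : ℕ, (rotation σ P)^[k + 1] x = y} ?_ ⟨_, 0, rfl⟩ ?_ hy
  · rintro _ ⟨k, rfl⟩
    exact h.iterate_rotation_mem hx _
  · rintro _ ⟨k, rfl⟩
    exact ⟨k + 1, by rw [iterate_succ_apply', rotation]⟩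

theorem minimalPeriod_rotation_pos (hx : x ∈ runSet P p q) :
    0 < minimalPeriod (rotation σ P) x := by
  obtain ⟨k, hk⟩ := h.exists_iterate_rotation_eq hq hx hx
  exact IsPeriodicPt.minimalPeriod_pos k.succ_pos hk

theorem σ_ne_of_two_mul_eq (hx : x ∈ runSet P p q) (hxP : 2 * x = P) (hy : y ∈ runSet P p q)
    (hyx : y ≠ x) : σ x ≠ x := fun hσx =>
  hyx <| h.cyclic hq {x} (Set.singleton_subset_iff.2 hx) (Set.singleton_nonempty x)
    (by
      rintro _ rfl
      rw [hσx, Set.mem_singleton_iff]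
      omega) hy

variable (hσ : Involutive σ) (hx : x ∈ runSet P p q) (hσx : σ x = x) (hy : y ∈ runSet P p q)
  (hσy : σ y = y)

include hσ hx hσx hy hσy

theorem exists_iterate_rotation_eq_of_fixed (hxy : x ≠ y) :
    ∃ k : ℕ, (rotation σ P)^[k] x = y ∧ 2 * k = minimalPeriod (rotation σ P) x := by
  obtain ⟨k, hk⟩ := h.exists_iterate_rotation_eq hq hx hy
  rw [← iterate_mod_minimalPeriod_eq] at hk
  have hlt := Nat.mod_lt (k + 1) (h.minimalPeriod_rotation_pos hq hx)
  generalize (k + 1) % minimalPeriod (rotation σ P) x = j at hk hlt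
  have hperiodic := iterate_rotation_σ_iterate hσ P x j
  rw [hk, hσy, ← hk, ← iterate_add_apply, hσx] at hperiodic
  have hj : j ≠ 0 := fun hj => hxy (by rwa [hj] at hk)
  refine ⟨j, hk, ?_⟩
  have := Nat.eq_of_dvd_of_lt_two_mul (by omega)
    (IsPeriodicPt.minimalPeriod_dvd (f := rotation σ P) hperiodic) (by omega)
  omega

theorem eq_of_fixed (hz : z ∈ runSet P p q) (hσz : σ z = z) (hxy : x ≠ y) (hxz : x ≠ z) :
    y = z := by
  obtain ⟨k, rfl, hk⟩ := h.exists_iterate_rotation_eq_of_fixed hq hσ hx hσx hy hσy hxy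
  obtain ⟨l, rfl, hl⟩ := h.exists_iterate_rotation_eq_of_fixed hq hσ hx hσx hz hσz hxz
  congr 1
  omega

/-- If the rotation passes through the centre then its period at a fixed point of `σ` is odd. -/
theorem eq_of_fixed_of_center (hz : z ∈ runSet P p q) (hzP : 2 * z = P) : x = y := by
  by_contra hxy
  obtain ⟨k, -, hk⟩ := h.exists_iterate_rotation_eq_of_fixed hq hσ hx hσx hy hσy hxy
  obtain ⟨j, rfl⟩ := h.exists_iterate_rotation_eq hq hx hz
  have hperiodic := iterate_rotation_σ_iterate hσ P x (j + 1)
  have center : rotation σ P (σ ((rotation σ P)^[j + 1] x)) = (rotation σ P)^[j + 1] x := by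
    rw [rotation, hσ]
    omega
  rw [iterate_succ_apply, center, ← iterate_add_apply, hσx] at hperiodic
  have := (Dvd.intro k hk).trans (IsPeriodicPt.minimalPeriod_dvd hperiodic)
  omega

omit hσx hσy

theorem eq_of_fixed_or_center
    (anti : ∀ v ∈ runSet P p q, v < σ v → 2 * v ≤ P ∧ P ≤ 2 * σ v)
    (hx' : σ x = x ∧ P < 2 * x ∨ 2 * x = P ∧ x < σ x)
    (hy' : σ y = y ∧ P < 2 * y ∨ 2 * y = P ∧ y < σ y) : x = y := by
  wlog hσx : σ x = x ∧ P < 2 * x generalizing x y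
  · have hxP := hx'.resolve_left hσx
    by_cases hσy : σ y = y ∧ P < 2 * y
    · exact (this hy hx hy' hx' hσy).symm
    · have hyP := hy'.resolve_left hσy
      omega
  obtain ⟨v, hv, hvP, hσv⟩ := h.exists_left_of_right hσ.injective hq (h.stable y hy) (by omega)
  replace hσv : 2 * σ v ≤ P := hσv.resolve_right fun hvy => by
    have := hσ.injective hvy
    omega
  have fixed_or_center : σ v = v ∨ 2 * σ v = P := by
    rcases lt_trichotomy v (σ v) with hlt | heq | hlt
    · have := anti v hv hlt
      omega
    · exact Or.inl heq.symm
    · have := anti (σ v) (h.stable v hv) (by rwa [hσ v])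
      rw [hσ v] at this
      omega
  rcases fixed_or_center with hv' | hv' <;> rcases hy' with ⟨hσy, hyP⟩ | ⟨hyP, hσy⟩
  · exact h.eq_of_fixed hq hσ hv hv' hx hσx.1 hy hσy (by omega) (by omega)
  · have := h.eq_of_fixed_of_center hq hσ hv hv' hx hσx.1 hy hyP
    omega
  · exact h.eq_of_fixed_of_center hq hσ hx hσx.1 hy hσy (h.stable v hv) hv'
  · have : σ v = y := by omega
    have := hσ v
    simp_all
    omega

end IsAntiToeplitz

namespace ModifiedIntervalPair

variable (E : ModifiedIntervalPair) {u v w x y z P p i : ℤ}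

theorem exists_isModifiedRun_of_central (hM : E.Marked .above i) (hP : E.sum .above i = P)
    (hi : 2 * i + 1 = P ∨ 2 * i + 2 = P) :
    ∃ p, E.IsModifiedRun (E.σ .above) .above i p i := by
  obtain ⟨p, q, hrun⟩ := E.exists_run .above i hM (by omega)
  have := hrun.two_mul_lt
  have := hrun.le_right
  obtain rfl : q = i := by omega
  exact ⟨p, hrun⟩

theorem fixed_above_of_source (hM : E.Marked .above i) (hi : 2 * i + 1 = P ∨ 2 * i + 2 = P)
    (hx : ∀ s, E.sum s x = P) (ha : x ≤ E.σ .above x) (hb : E.σ .below x ≤ x) (hxP : 2 * x ≠ P) :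
    E.σ .above x = x ∧ P < 2 * x := by
  have hne : E.σ .below x ≠ x := fun hfix => by
    have hlt := E.marked_of_lt .below x i
    have hgt := E.marked_of_gt .below x i
    rw [hfix, hx] at hlt hgt
    rcases lt_or_gt_of_ne hxP with h | h
    · exact E.not_marked_above_below hM (hlt (by omega) (by omega))
    · exact E.not_marked_above_below hM (hgt (by omega) (by omega))
  have hb' := lt_of_le_of_ne hb hne
  have := (E.antidiagonal_of_lt hb').2
  rw [hx] at this
  refine ⟨?_, by omega⟩
  by_contra hne'
  have := E.diff_neg_of_full_source (lt_of_le_of_ne ha (Ne.symm hne')) hb'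
  rw [IntervalPair.diff, hx, hx] at this
  omega

theorem source_unique_of_marked_above (hM : E.Marked .above i) (hP : E.sum .above i = P)
    (hi : 2 * i + 1 = P ∨ 2 * i + 2 = P) (hx : ∀ s, E.sum s x = P) (hy : ∀ s, E.sum s y = P)
    (hx' : x ≤ E.σ .above x ∧ E.σ .below x ≤ x) (hy' : y ≤ E.σ .above y ∧ E.σ .below y ≤ y) :
    x = y := by
  obtain ⟨p, hrun⟩ := E.exists_isModifiedRun_of_central hM hP hi
  have anti := hrun.isAntiToeplitz
  have hlo := hrun.lo_le
  have hpi := hrun.le_left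
  have hsum : E.lo .above i + E.hi .above i = P := hP
  rw [hP] at anti
  have mem_of_sum : ∀ z, (∀ s, E.sum s z = P) → z ≤ E.σ .above z ∧ E.σ .below z ≤ z →
      z ∈ runSet P p i ∧ (E.σ .above z = z ∧ P < 2 * z ∨ 2 * z = P ∧ z < E.σ .above z) := by
    intro z hz hz'
    by_cases hzP : 2 * z = P
    · have hmem : z ∈ runSet P p i := ⟨by omega, by omega, by omega⟩
      have := anti.σ_ne_of_two_mul_eq (by omega) hmem hzP (y := i)
        ⟨by omega, by omega, by omega⟩ (by omega)
      exact ⟨hmem, Or.inr ⟨hzP, lt_of_le_of_ne hz'.1 this.symm⟩⟩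
    · have hfix := E.fixed_above_of_source hM hi hz hz'.1 hz'.2 hzP
      have : p ≤ P - z := by
        by_contra! hlt
        refine hrun.not_marked (E.marked_of_gt .above z (p - 1) ?_ (by omega))
        rw [hz, hfix.1]
        omega
      exact ⟨⟨by omega, by omega, by omega⟩, Or.inl hfix⟩
  refine anti.eq_of_fixed_or_center (by omega) (E.σ_σ .above) (mem_of_sum x hx hx').1
    (mem_of_sum y hy hy').1 (fun v hv hlt => ?_) (mem_of_sum x hx hx').2 (mem_of_sum y hy hy').2
  have := E.antidiagonal .above v hlt
  rwa [E.sum_eq (hlo.trans hv.1) (by have := hv.2.1; omega), hP] at this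

theorem source_unique_of_marked {s : Side} (hM : E.Marked s i) (hP : E.sum s i = P)
    (hi : 2 * i + 1 = P ∨ 2 * i + 2 = P) (hx : ∀ s, E.sum s x = P) (hy : ∀ s, E.sum s y = P)
    (hx' : x ≤ E.σ .above x ∧ E.σ .below x ≤ x) (hy' : y ≤ E.σ .above y ∧ E.σ .below y ≤ y) :
    x = y := by
  cases s with
  | above => exact E.source_unique_of_marked_above hM hP hi hx hy hx' hy'
  | below =>
    have hlt := E.lt_hi_of_marked _ _ hM
    have hle := E.lo_le .below i
    have hsum : E.lo .below i + E.hi .below i = P := hP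
    have hM' : E.reflect.swap.Marked .above (i - P) := by
      have := E.marked_mirror _ _ hM
      rw [hP] at this
      change E.Marked .below (-1 - (i - P))
      convert this using 1
      omega
    have sum_neg : ∀ z s, E.sum s.swap z = P → E.reflect.swap.sum s (-z) = -P := fun z s hz =>
      (E.sum_reflect s.swap (-z)).trans (by rw [neg_neg, hz])
    have source_neg : ∀ z, z ≤ E.σ .above z ∧ E.σ .below z ≤ z →
        -z ≤ E.reflect.swap.σ .above (-z) ∧ E.reflect.swap.σ .below (-z) ≤ -z := fun z hz => by
      change -z ≤ -E.σ .below (- -z) ∧ -E.σ .above (- -z) ≤ -z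
      rw [neg_neg]
      omega
    have hP' : E.reflect.swap.sum .above (i - P) = -P := by
      rw [← neg_sub]
      exact sum_neg _ _ ((E.sum_eq (x := i) (s := .below) (by omega) (by omega)).trans hP)
    exact neg_inj.1 <| E.reflect.swap.source_unique_of_marked_above hM' hP' (by omega)
      (fun s => sum_neg x s (hx _)) (fun s => sum_neg y s (hy _)) (source_neg x hx')
      (source_neg y hy')

theorem source_unique (hlo : ∀ s, E.lo s x = E.lo s y) (hdiff : E.diff x = 0)
    (hx : x ≤ E.σ .above x ∧ E.σ .below x ≤ x) (hy : y ≤ E.σ .above y ∧ E.σ .below y ≤ y) :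
    x = y := by
  by_contra hxy
  obtain ⟨P, hxP⟩ : ∃ P, ∀ s, E.sum s x = P :=
    ⟨_, fun s => E.sum_eq_of_diff_eq_zero hdiff s .above⟩
  have hyP : ∀ s, E.sum s y = P := fun s => (E.sum_eq_of_lo_eq (hlo s)).symm.trans (hxP s)
  have lo_lt_hi : ∀ s, E.lo s x < E.hi s x := fun s => by
    have := E.lo_le s x
    have := E.le_hi s x
    have := hlo s ▸ E.lo_le s y
    have := E.hi_eq_of_lo_eq (hlo s) ▸ E.le_hi s y
    omega
  have lo_add_hi : ∀ s, E.lo s x + E.hi s x = P := hxP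
  obtain ⟨i, hi⟩ : ∃ i, 2 * i + 1 = P ∨ 2 * i + 2 = P := ⟨(P - 1) / 2, by omega⟩
  have hix : ∀ s, E.lo s x ≤ i ∧ i < E.hi s x := fun s => by
    have := lo_lt_hi s
    have := lo_add_hi s
    omega
  obtain ⟨s, hs⟩ := E.exists_marked_of_sum_eq hxP (fun s => (hix s).1) fun s => (hix s).2
  exact hxy <| E.source_unique_of_marked hs
    ((E.sum_eq (hix s).1 (hix s).2.le).trans (hxP s)) hi hxP hyP hx hy

/-! ### The arc system of a modified interval pair -/

theorem full_of_fork (huv : E.Arrow u v) (huw : E.Arrow u w) (hvw : v ≠ w) :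
    u < E.σ .above u ∧ E.σ .below u < u := by
  rcases huv with ⟨huv, rfl⟩ | ⟨huv, rfl⟩ <;> rcases huw with ⟨huw, rfl⟩ | ⟨huw, rfl⟩
  exacts [absurd rfl hvw, ⟨huv, huw⟩, ⟨huw, huv⟩, absurd rfl hvw]

theorem full_of_join (huw : E.Arrow u w) (hvw : E.Arrow v w) (huv : u ≠ v) :
    E.σ .above w < w ∧ w < E.σ .below w :=
  (E.swap.full_of_fork (E.swap_arrow.2 huw) (E.swap_arrow.2 hvw) huv).symm

theorem succ_eq_or_eq (huv : E.Arrow u v) (huw : E.Arrow u w) (hvw : v ≠ w)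
    (hux : E.Arrow u x) : x = v ∨ x = w := by
  rcases huv with ⟨huv, rfl⟩ | ⟨huv, rfl⟩ <;> rcases huw with ⟨huw, rfl⟩ | ⟨huw, rfl⟩ <;>
    rcases hux with ⟨hux, rfl⟩ | ⟨hux, rfl⟩ <;> simp_all

variable {s t : ℤ}

theorem off_of_fork (hs : E.Arrow x s) (ht : E.Arrow x t) (hst : s ≠ t)
    (hsx : E.cell s ≠ E.cell x) (htx : E.cell t ≠ E.cell x) (hu : E.cell u = E.cell s)
    (hv : E.cell v = E.cell t) : E.Off u v := by
  have hu := E.cell_eq_iff.1 hu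
  have hv := E.cell_eq_iff.1 hv
  rcases hs with ⟨hs, rfl⟩ | ⟨hs, rfl⟩ <;> rcases ht with ⟨ht, rfl⟩ | ⟨ht, rfl⟩
  · exact absurd rfl hst
  · have hne := E.lo_below_ne (E.lo_σ .above x) hsx
    have hvx := (hv .below).trans (E.lo_σ .below x)
    exact Or.inr ⟨E.lt_of_lo_ne hs hne.symm hvx (hu .below), by rwa [hu, hvx]⟩
  · have hne := E.lo_above_ne (E.lo_σ .below x) hsx
    have hvx := (hv .above).trans (E.lo_σ .above x)
    exact Or.inl ⟨E.lt_of_lo_ne hs hne (hu .above) hvx, by rwa [hu, hvx]⟩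
  · exact absurd rfl hst

theorem cell_ne_of_fork (hs : E.Arrow x s) (ht : E.Arrow x t) (hst : s ≠ t)
    (hsx : E.cell s ≠ E.cell x) (htx : E.cell t ≠ E.cell x) : E.cell s ≠ E.cell t := by
  intro h
  have h := E.cell_eq_iff.1 h
  rcases E.off_of_fork hs ht hst hsx htx rfl rfl with h' | h'
  exacts [h'.2 (h _), h'.2 (h _)]

theorem common_succ_unique (huw : E.Arrow u w) (hvw : E.Arrow v w) (hux : E.Arrow u x)
    (hvx : E.Arrow v x) (huv : u ≠ v) : w = x := by
  have hne := fun s => (E.σ_injective s).ne huv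
  have := hne .above
  have := hne .below
  rcases huw with ⟨_, _⟩ | ⟨_, _⟩ <;> rcases hvw with ⟨_, _⟩ | ⟨_, _⟩ <;>
    rcases hux with ⟨_, _⟩ | ⟨_, _⟩ <;> rcases hvx with ⟨_, _⟩ | ⟨_, _⟩ <;> omega

theorem isArcSystem : IsArcSystem E.Arrow E.Off E.diff E.cell where
  acyclic := E.acyclic
  cell_eq_or_cross _ _ := E.cell_eq_or_cross
  δ_eq _ _ h := E.diff_eq_of_lo_eq (E.cell_eq_iff.1 h)
  fork := by
    rintro x ⟨s, t, hs, ht, hst⟩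
    have := E.full_of_fork hs ht hst
    exact ⟨E.forall_not_arrow_to_iff.2 ⟨this.1.le, this.2.le⟩,
      E.diff_neg_of_full_source this.1 this.2⟩
  join := by
    rintro x ⟨s, t, hs, ht, hst⟩
    have := E.full_of_join hs ht hst
    exact ⟨E.forall_not_arrow_from_iff.2 ⟨this.1.le, this.2.le⟩,
      E.diff_pos_of_full_sink this.1 this.2⟩
  succ_eq_or_eq _ _ _ _ := E.succ_eq_or_eq
  pred_eq_or_eq _ _ _ _ hs ht hst hu :=
    E.swap.succ_eq_or_eq (E.swap_arrow.2 hs) (E.swap_arrow.2 ht) hst (E.swap_arrow.2 hu)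
  nonpos_of_source _ v huv hu := E.diff_nonpos_of_source hu ⟨v, huv⟩
  nonneg_of_sink u _ huv hv := E.diff_nonneg_of_sink hv ⟨u, huv⟩
  link_of_le _ _ := E.off_of_diff_le
  link_of_fork _ _ _ _ _ := E.off_of_fork
  link_of_join _ _ _ _ _ hs ht hst hsz htz hu hv := by
    rw [← E.cell_swap_eq_iff] at hu hv
    rw [← E.cell_swap_eq_iff.ne] at hsz htz
    exact E.off_swap.1 <|
      E.swap.off_of_fork (E.swap_arrow.2 ht) (E.swap_arrow.2 hs) hst.symm htz hsz hv hu
  cell_ne_of_join _ _ _ hs ht hst hsz htz := by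
    rw [← E.cell_swap_eq_iff.ne] at hsz htz ⊢
    exact E.swap.cell_ne_of_fork (E.swap_arrow.2 hs) (E.swap_arrow.2 ht) hst hsz htz
  common_succ_unique _ _ _ _ := E.common_succ_unique
  source_unique _ _ hu huv hu' hv' := E.source_unique (E.cell_eq_iff.1 huv) hu
    (E.forall_not_arrow_to_iff.1 hu') (E.forall_not_arrow_to_iff.1 hv')
  isolated_unique u v h hu hu' hv hv' := by
    rw [forall_not_arrow_to_iff] at hu hv
    rw [forall_not_arrow_from_iff] at hu' hv'
    exact E.isolated_unique (E.cell_eq_iff.1 h) (fun s => by cases s <;> omega)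
      (fun s => by cases s <;> omega)

end ModifiedIntervalPair

/-! ### Interval partitions of `[1, n]` in integer coordinates -/

section Blocks

variable {n : ℕ} (c : Composition n)

/-- The first point of the interval of `x`. -/
def blockLo (x : Fin n) : ℤ := c.sizeUpTo (c.index x)

/-- The last point of the interval of `x`. -/
def blockHi (x : Fin n) : ℤ := c.sizeUpTo (c.index x + 1) - 1

/-- The sum of the end-points of the interval of `x`: the interval is reversed by
`y ↦ blockSum c x - y`, and its half-integers (named by their left neighbours) by
`i ↦ blockSum c x - 1 - i`. -/
def blockSum (x : Fin n) : ℤ := blockLo c x + blockHi c x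

theorem blockLo_le (x : Fin n) : blockLo c x ≤ x :=
  Int.ofNat_le.2 (c.sizeUpTo_index_le x)

theorem le_blockHi (x : Fin n) : (x : ℤ) ≤ blockHi c x := by
  have h : (x : ℕ) < c.sizeUpTo (c.index x + 1) := c.lt_sizeUpTo_index_succ x
  rw [blockHi]
  omega

theorem blockLo_nonneg (x : Fin n) : 0 ≤ blockLo c x :=
  Int.natCast_nonneg _

theorem blockHi_lt (x : Fin n) : blockHi c x < n := by
  have := c.sizeUpTo_le (c.index x + 1)
  rw [blockHi]
  omega

variable {c} {x y : Fin n}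

theorem index_eq_of_mem_block (hlo : blockLo c x ≤ y) (hhi : (y : ℤ) ≤ blockHi c x) :
    c.index y = c.index x := by
  refine (c.mem_range_embedding_iff'.1 (c.mem_range_embedding_iff.2 ⟨?_, ?_⟩)).symm
  · exact Int.ofNat_le.1 hlo
  · rw [blockHi] at hhi
    rw [Nat.succ_eq_add_one]
    omega

theorem exists_fin_of_mem_block {z : ℤ} (hlo : blockLo c x ≤ z) (hhi : z ≤ blockHi c x) :
    ∃ y : Fin n, (y : ℤ) = z := by
  have h0 := blockLo_nonneg c x
  have hn := blockHi_lt c x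
  exact ⟨⟨z.toNat, by omega⟩, Int.toNat_of_nonneg (by omega)⟩

theorem blockLo_congr (h : c.index x = c.index y) : blockLo c x = blockLo c y := by
  rw [blockLo, blockLo, h]

theorem blockHi_congr (h : c.index x = c.index y) : blockHi c x = blockHi c y := by
  rw [blockHi, blockHi, h]

theorem blockSum_congr (h : c.index x = c.index y) : blockSum c x = blockSum c y := by
  rw [blockSum, blockSum, blockLo_congr h, blockHi_congr h]

theorem blockLo_eq_iff : blockLo c x = blockLo c y ↔ c.index x = c.index y := by
  refine ⟨fun h => ?_, blockLo_congr⟩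
  rcases le_total x y with hxy | hxy
  · exact index_eq_of_mem_block (h ▸ blockLo_le c x)
      ((Int.ofNat_le.2 hxy).trans (le_blockHi c y))
  · exact (index_eq_of_mem_block (h ▸ blockLo_le c y)
      ((Int.ofNat_le.2 hxy).trans (le_blockHi c x))).symm

theorem coe_kappa (x : Fin n) : ((kappa c x : Fin n) : ℤ) = blockSum c x - x := by
  have hκ : kappa c x = c.embedding (c.index x) (Fin.rev (c.invEmbedding x)) := rfl
  have hx := congrArg Fin.val (c.embedding_comp_inv x)
  rw [c.coe_embedding] at hx
  have hsize := c.sizeUpTo_succ' (c.index x)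
  rw [hκ, c.coe_embedding, Fin.val_rev, blockSum, blockLo, blockHi]
  omega

theorem index_kappa (x : Fin n) : c.index (kappa c x) = c.index x := by
  have hlo := blockLo_le c x
  have hhi := le_blockHi c x
  apply index_eq_of_mem_block <;> rw [coe_kappa, blockSum] <;> omega

theorem kappa_kappa (x : Fin n) : kappa c (kappa c x) = x := by
  apply Fin.ext
  have h := coe_kappa (c := c) (kappa c x)
  rw [blockSum_congr (index_kappa x), coe_kappa x] at h
  omega

theorem dynkinSwap_iff :
    DynkinSwap c x y ↔ (x : ℤ) < blockHi c x ∧ (y : ℤ) = blockSum c x - 1 - x := by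
  have hκ := coe_kappa (c := c) x
  have hlo := blockLo_le c x
  have hhi := le_blockHi c x
  rw [blockSum] at *
  constructor
  · rintro ⟨hindex, hswap⟩
    have hlo' := blockLo_congr hindex ▸ blockLo_le c y
    omega
  · rintro ⟨hlt, hy⟩
    exact ⟨(index_eq_of_mem_block (by omega) (by omega)).symm, by omega⟩

theorem exists_dynkinSwap (h : (x : ℤ) < blockHi c x) :
    ∃ y : Fin n, (y : ℤ) = blockSum c x - 1 - x ∧ DynkinSwap c x y := by
  have hlo := blockLo_le c x
  obtain ⟨y, hy⟩ := exists_fin_of_mem_block (c := c) (x := x) (z := blockSum c x - 1 - x)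
    (by rw [blockSum]; omega) (by rw [blockSum]; omega)
  exact ⟨y, hy, dynkinSwap_iff.2 ⟨h, hy⟩⟩

theorem DynkinSwap.symm (h : DynkinSwap c x y) : DynkinSwap c y x := by
  have hindex := h.1
  have hlo := blockLo_le c x
  rw [dynkinSwap_iff] at h ⊢
  rw [← blockSum_congr hindex, ← blockHi_congr hindex]
  rw [blockSum] at *
  omega

theorem dynkinSwap_self_iff : DynkinSwap c x x ↔ 2 * (x : ℤ) = blockSum c x - 1 := by
  have hlo := blockLo_le c x
  rw [dynkinSwap_iff, blockSum]
  omega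

theorem DynkinSwap.right_unique {z : Fin n} (hy : DynkinSwap c x y) (hz : DynkinSwap c x z) :
    y = z :=
  Fin.ext (Nat.succ_injective (hy.2.symm.trans hz.2))

end Blocks

/-! ### Runs of marked points -/

section Runs

variable {n : ℕ}

theorem mem_ordConnectedComponent_iff_of_succ {m : Set (Fin n)} {i s t : Fin n}
    (hst : (t : ℕ) = s + 1) (hs : s ∈ m) (ht : t ∈ m) :
    s ∈ m.ordConnectedComponent i ↔ t ∈ m.ordConnectedComponent i := by
  have huIcc : Set.uIcc s t ⊆ m := by
    intro r hr
    rw [Set.uIcc_of_le (Fin.le_def.2 (by omega)), Set.mem_Icc, Fin.le_def, Fin.le_def] at hr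
    rcases (by omega : (r : ℕ) = s ∨ (r : ℕ) = t) with h | h
    · rwa [Fin.ext h]
    · rwa [Fin.ext h]
  rw [Set.mem_ordConnectedComponent_comm, Set.mem_ordConnectedComponent_comm (x := i),
    Set.ordConnectedComponent_eq huIcc]

theorem exists_isMarkedRun {m : Set (Fin n)} {i : Fin n} (hi : i ∈ m) :
    ∃ p q, IsMarkedRun m p q ∧ p ≤ i ∧ i ≤ q := by
  have hne := Set.nonempty_ordConnectedComponent.2 hi
  have hii := Set.self_mem_ordConnectedComponent.2 hi
  obtain ⟨p, hp, hmin⟩ := Set.exists_min_image (m.ordConnectedComponent i) id (Set.toFinite _) hne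
  obtain ⟨q, hq, hmax⟩ := Set.exists_max_image (m.ordConnectedComponent i) id (Set.toFinite _) hne
  have hsub : Set.Icc p q ⊆ m :=
    (Set.OrdConnected.out inferInstance hp hq).trans Set.ordConnectedComponent_subset
  refine ⟨p, q, ⟨hmin q hq, fun t hpt htq => hsub ⟨hpt, htq⟩, fun t ht htm => ?_,
    fun t ht htm => ?_⟩, hmin i hii, hmax i hii⟩
  · have hpt : p ≤ t := hmin t <| (mem_ordConnectedComponent_iff_of_succ ht.symm htm
      (Set.ordConnectedComponent_subset hp)).2 hp
    rw [Fin.le_def] at hpt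
    omega
  · have htq : t ≤ q := hmax t <| (mem_ordConnectedComponent_iff_of_succ ht
      (Set.ordConnectedComponent_subset hq) htm).1 hq
    rw [Fin.le_def] at htq
    omega

/-- Every point of the set, as a half-integer, is the left end-point of an arc of its interval. -/
def IsLeftSet (c : Composition n) (m : Set (Fin n)) : Prop :=
  ∀ i ∈ m, (i : ℤ) < blockHi c i ∧ 2 * (i : ℤ) + 1 ≤ blockSum c i

namespace IsLeftSet

variable {c : Composition n} {m : Set (Fin n)} {p q x : Fin n}
variable (hm : IsLeftSet c m) (hr : IsMarkedRun m p q)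
include hm hr

-- Otherwise the last point of the interval of `p` would be marked.
theorem index_eq_of_run (hpx : p ≤ x) (hxq : x ≤ q) : c.index x = c.index p := by
  have hlo := (blockLo_le c p).trans (Int.ofNat_le.2 hpx)
  refine index_eq_of_mem_block hlo ?_
  by_contra! hx
  obtain ⟨j, hj⟩ := exists_fin_of_mem_block (c := c) (x := p) (z := blockHi c p)
    ((blockLo_le c p).trans (le_blockHi c p)) le_rfl
  have hpj : p ≤ j := Int.ofNat_le.1 (hj ▸ le_blockHi c p)
  have hjx : j ≤ x := Int.ofNat_le.1 (hj ▸ hx.le)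
  have hindex : c.index j = c.index p :=
    index_eq_of_mem_block ((blockLo_le c p).trans (Int.ofNat_le.2 hpj)) hj.le
  have hlt := (hm j (hr.2.1 j hpj (hjx.trans hxq))).1
  rw [blockHi_congr hindex] at hlt
  omega

theorem run_bounds : blockLo c p ≤ p ∧ (p : ℤ) ≤ q ∧ 2 * (q : ℤ) + 1 ≤ blockSum c p ∧
    (q : ℤ) < blockHi c p := by
  have hindex := hm.index_eq_of_run hr hr.1 le_rfl
  have hq := hm q (hr.2.1 q hr.1 le_rfl)
  rw [blockSum_congr hindex, blockHi_congr hindex] at hq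
  exact ⟨blockLo_le c p, Int.ofNat_le.2 hr.1, hq.2, hq.1⟩

theorem coe_kappa_right : ((kappa c q : Fin n) : ℤ) = blockSum c p - q := by
  rw [coe_kappa, blockSum_congr (hm.index_eq_of_run hr hr.1 le_rfl)]

theorem mem_leftHalf : x ∈ leftHalf c p q ↔
    (p : ℤ) ≤ x ∧ ((x : ℤ) ≤ q ∨ (x : ℤ) = q + 1 ∧ 2 * (q : ℤ) + 1 < blockSum c p) := by
  have hκ := hm.coe_kappa_right hr
  obtain ⟨-, -, hq, -⟩ := hm.run_bounds hr
  simp only [leftHalf, Set.mem_ofPred_eq, Fin.le_def, ne_eq, Fin.ext_iff]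
  omega

theorem index_eq_of_mem_leftHalf (hx : x ∈ leftHalf c p q) : c.index x = c.index p := by
  rw [hm.mem_leftHalf hr] at hx
  obtain ⟨hlo, -, -, hhi⟩ := hm.run_bounds hr
  exact index_eq_of_mem_block (by omega) (by omega)

theorem mem_rightHalf : x ∈ rightHalf c p q ↔
    (x : ℤ) ≤ blockSum c p - p ∧ (blockSum c p - q ≤ (x : ℤ) ∨
      (x : ℤ) = blockSum c p - (q + 1) ∧ 2 * (q : ℤ) + 1 < blockSum c p) := by
  obtain ⟨hlo, -, hq, hhi⟩ := hm.run_bounds hr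
  constructor
  · rintro ⟨y, hy, rfl⟩
    rw [coe_kappa, blockSum_congr (hm.index_eq_of_mem_leftHalf hr hy)]
    rw [hm.mem_leftHalf hr] at hy
    omega
  · intro hx
    have hindex : c.index x = c.index p := by
      apply index_eq_of_mem_block <;> rw [blockSum] at * <;> omega
    refine ⟨kappa c x, ?_, kappa_kappa x⟩
    rw [hm.mem_leftHalf hr, coe_kappa, blockSum_congr hindex]
    omega

theorem mem_extendedComponent :
    x ∈ extendedComponent c p q ↔ (x : ℤ) ∈ runSet (blockSum c p) p q := by
  obtain ⟨-, -, hq, -⟩ := hm.run_bounds hr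
  rw [extendedComponent, Set.mem_union, hm.mem_leftHalf hr, hm.mem_rightHalf hr]
  simp only [runSet, Set.mem_ofPred_eq]
  omega

theorem index_eq_of_mem_extendedComponent (hx : x ∈ extendedComponent c p q) :
    c.index x = c.index p := by
  rcases hx with hx | ⟨y, hy, rfl⟩
  · exact hm.index_eq_of_mem_leftHalf hr hx
  · rw [index_kappa, hm.index_eq_of_mem_leftHalf hr hy]

theorem exists_mem_extendedComponent {z : ℤ} (hz : z ∈ runSet (blockSum c p) p q) :
    ∃ y ∈ extendedComponent c p q, (y : ℤ) = z := by
  obtain ⟨hlo, -, -, -⟩ := hm.run_bounds hr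
  have hpz := hz.1
  have hzp := hz.2.1
  obtain ⟨y, rfl⟩ := exists_fin_of_mem_block (c := c) (x := p) (z := z) (by omega)
    (by rw [blockSum] at hzp; omega)
  exact ⟨y, (hm.mem_extendedComponent hr).2 hz, rfl⟩

theorem isCentralRun_iff : IsCentralRun c q ↔ blockSum c p ≤ 2 * q + 2 := by
  have hκ := hm.coe_kappa_right hr
  rw [IsCentralRun]
  omega

end IsLeftSet

end Runs

section Dihedral

open scoped Pointwise

variable {n : ℕ} {κ σ : Equiv.Perm (Fin n)}

theorem orbit_subset_of_le_stabilizer {G α : Type*} [Group G] [MulAction G α] {H : Subgroup G}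
    {T : Set α} (hH : H ≤ MulAction.stabilizer G T) {x : α}
    (hne : (MulAction.orbit H x ∩ T).Nonempty) : MulAction.orbit H x ⊆ T := by
  obtain ⟨y, hyx, hyT⟩ := hne
  rw [← MulAction.orbit_eq_iff.2 hyx]
  rintro _ ⟨g, rfl⟩
  exact (MulAction.mem_stabilizer_set.1 (hH g.2) y).2 hyT

theorem mem_stabilizer_of_forall_apply_mem {T : Set (Fin n)} (h : ∀ x ∈ T, σ x ∈ T) :
    σ ∈ MulAction.stabilizer (Equiv.Perm (Fin n)) T :=
  (MulAction.mem_stabilizer_set' T.toFinite).2 fun x hx => h x hx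

theorem IsMeander.subset {O T : Set (Fin n)} (hO : IsMeander κ σ O) (hne : (O ∩ T).Nonempty)
    (hκ : ∀ x ∈ T, κ x ∈ T) (hσ : ∀ x ∈ T, σ x ∈ T) : O ⊆ T := by
  obtain ⟨x, rfl⟩ := hO
  refine orbit_subset_of_le_stabilizer ((Subgroup.closure_le _).2 ?_) hne
  rintro _ (rfl | rfl)
  exacts [mem_stabilizer_of_forall_apply_mem hκ, mem_stabilizer_of_forall_apply_mem hσ]

theorem IsEdge.subset {O T : Set (Fin n)} (hO : IsEdge κ σ O) (hne : (O ∩ T).Nonempty)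
    (h : ∀ x ∈ T, κ (σ x) ∈ T) : O ⊆ T := by
  obtain ⟨-, x, rfl⟩ := hO
  exact orbit_subset_of_le_stabilizer
    (Subgroup.zpowers_le.2 (mem_stabilizer_of_forall_apply_mem (σ := κ * σ) h)) hne

theorem apply_zpow_mul_of_fixed (hκ : ∀ x, κ (κ x) = x) (hσ : ∀ x, σ (σ x) = x) {x : Fin n}
    (hx : σ x = x) (j : ℤ) : σ (((κ * σ) ^ j) x) = ((κ * σ) ^ (-j)) x := by
  have hκ_inv : κ⁻¹ = κ := inv_eq_of_mul_eq_one_left (Equiv.ext hκ)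
  have hσ_inv : σ⁻¹ = σ := inv_eq_of_mul_eq_one_left (Equiv.ext hσ)
  have hconj : σ * (κ * σ) * σ⁻¹ = (κ * σ)⁻¹ := by
    rw [mul_inv_rev, ← mul_assoc, mul_inv_cancel_right, hκ_inv, hσ_inv]
  rw [zpow_neg, ← inv_zpow, ← hconj, conj_zpow, hσ_inv, Equiv.Perm.mul_apply, Equiv.Perm.mul_apply,
    hx]

-- The orbit of a fixed point of `σ` under the rotation `κ * σ` is already stable under `σ`.
theorem IsLoop.apply_ne {O : Set (Fin n)} (hκ : ∀ x, κ (κ x) = x) (hσ : ∀ x, σ (σ x) = x)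
    (hO : IsLoop κ σ O) {x : Fin n} (hx : x ∈ O) : σ x ≠ x := by
  intro hfix
  have hσ_zpow := apply_zpow_mul_of_fixed hκ hσ hfix
  refine hO.2 ⟨hO.1, x, (hO.1.subset ⟨x, hx, MulAction.mem_orbit_self x⟩ ?_ ?_).antisymm ?_⟩
  · rintro _ ⟨⟨_, j, rfl⟩, rfl⟩
    refine ⟨⟨(κ * σ) ^ (1 - j), 1 - j, rfl⟩, ?_⟩
    change ((κ * σ) ^ (1 - j)) x = κ (((κ * σ) ^ j) x)
    rw [sub_eq_add_neg, zpow_add, zpow_one, Equiv.Perm.mul_apply, ← hσ_zpow, Equiv.Perm.mul_apply,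
      hσ]
  · rintro _ ⟨⟨_, j, rfl⟩, rfl⟩
    exact ⟨⟨(κ * σ) ^ (-j), -j, rfl⟩, (hσ_zpow j).symm⟩
  · obtain ⟨x₀, hx₀⟩ := hO.1
    rw [hx₀] at hx ⊢
    rw [← MulAction.orbit_eq_iff.2 hx]
    have hle : Subgroup.zpowers (κ * σ) ≤ Subgroup.closure {κ, σ} :=
      Subgroup.zpowers_le.2 (mul_mem (Subgroup.subset_closure (Or.inl rfl))
        (Subgroup.subset_closure (Or.inr rfl)))
    rintro _ ⟨g, rfl⟩
    exact ⟨⟨g, hle g.2⟩, rfl⟩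

end Dihedral

section Modified

variable {n : ℕ} {c : Composition n} {m : Set (Fin n)}

/-- The half-integer `i` is an end-point of an arc whose left end-point belongs to `m`. -/
def IsMarkedHalf (c : Composition n) (m : Set (Fin n)) (i : ℤ) : Prop :=
  ∃ j ∈ m, i = j ∨ i = blockSum c j - 1 - j

namespace IsLeftSet

variable (hm : IsLeftSet c m)
include hm

theorem mem_of_isMarkedHalf {i : Fin n} (h : IsMarkedHalf c m i)
    (hi : 2 * (i : ℤ) + 1 ≤ blockSum c i) : i ∈ m := by
  obtain ⟨j, hj, h | h⟩ := h
  · rwa [show i = j from Fin.ext (by omega)]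
  · obtain ⟨hlt, hle⟩ := hm j hj
    have hlo := blockLo_le c j
    have hindex : c.index i = c.index j := by
      apply index_eq_of_mem_block <;> rw [blockSum] at * <;> omega
    rw [blockSum_congr hindex] at hi
    rwa [show i = j from Fin.ext (by omega)]

theorem isMarkedHalf_of_run {p q : Fin n} (hr : IsMarkedRun m p q) {i : ℤ}
    (h : (p ≤ i ∧ i ≤ q) ∨ (blockSum c p - 1 - q ≤ i ∧ i ≤ blockSum c p - 1 - p)) :
    IsMarkedHalf c m i := by
  obtain ⟨hlo, -, -, hhi⟩ := hm.run_bounds hr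
  have exists_point : ∀ j : ℤ, (p : ℤ) ≤ j → j ≤ q →
      ∃ t ∈ m, (t : ℤ) = j ∧ blockSum c t = blockSum c p := by
    intro j hpj hjq
    obtain ⟨t, rfl⟩ := exists_fin_of_mem_block (c := c) (x := p) (z := j) (by omega) (by omega)
    have hpt : p ≤ t := Int.ofNat_le.1 hpj
    have htq : t ≤ q := Int.ofNat_le.1 hjq
    exact ⟨t, hr.2.1 t hpt htq, rfl, blockSum_congr (hm.index_eq_of_run hr hpt htq)⟩
  rcases h with ⟨hpi, hiq⟩ | ⟨hqi, hip⟩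
  · obtain ⟨t, ht, hti, -⟩ := exists_point i hpi hiq
    exact ⟨t, ht, Or.inl hti.symm⟩
  · obtain ⟨t, ht, hti, hsum⟩ := exists_point (blockSum c p - 1 - i) (by omega) (by omega)
    exact ⟨t, ht, Or.inr (by omega)⟩

end IsLeftSet

namespace IsModifiedInvolution

variable {σ : Equiv.Perm (Fin n)} {x p q : Fin n} (h : IsModifiedInvolution c m σ)
include h

theorem eq_kappa_or_mem_extendedComponent (x : Fin n) :
    σ x = kappa c x ∨ ∃ p q, IsMarkedRun m p q ∧ x ∈ extendedComponent c p q := by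
  by_contra! hx
  exact hx.1 (h.unmarked x hx.2)

variable (hm : IsLeftSet c m)
include hm

theorem index_apply (x : Fin n) : c.index (σ x) = c.index x := by
  rcases h.eq_kappa_or_mem_extendedComponent x with hκ | ⟨p, q, hr, hx⟩
  · rw [hκ, index_kappa]
  · rw [hm.index_eq_of_mem_extendedComponent hr hx,
      hm.index_eq_of_mem_extendedComponent hr (h.stable p q hr x hx)]

theorem two_mul_le_and_le_two_mul (hx : (x : ℤ) < σ x) :
    2 * (x : ℤ) ≤ blockSum c x ∧ blockSum c x ≤ 2 * (σ x : ℤ) := by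
  rcases h.eq_kappa_or_mem_extendedComponent x with hκ | ⟨p, q, hr, hmem⟩
  · rw [hκ, coe_kappa] at hx ⊢
    omega
  · obtain ⟨-, -, hq, -⟩ := hm.run_bounds hr
    have hhalves := h.antidiagonal p q hr x hmem fun hfix => by rw [hfix] at hx; omega
    rw [hm.mem_leftHalf hr, hm.mem_rightHalf hr, hm.mem_leftHalf hr, hm.mem_rightHalf hr]
      at hhalves
    rw [blockSum_congr (hm.index_eq_of_mem_extendedComponent hr hmem)]
    omega

-- The images of `x` under `σ` and under the reversal differ only inside an extended component.
theorem isMarkedHalf {i : ℤ}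
    (hi : ((x : ℤ) ≤ i ∧ i < blockSum c x - σ x) ∨ (blockSum c x - σ x ≤ i ∧ i < x)) :
    IsMarkedHalf c m i := by
  rcases h.eq_kappa_or_mem_extendedComponent x with hκ | ⟨p, q, hr, hmem⟩
  · rw [hκ, coe_kappa] at hi
    omega
  · refine hm.isMarkedHalf_of_run hr ?_
    rw [blockSum_congr (hm.index_eq_of_mem_extendedComponent hr hmem)] at hi
    by_cases hfix : σ x = x
    · have hcentral : IsCentralRun c q := by
        by_contra hcentral
        exact (h.loop p q hr hcentral).apply_ne kappa_kappa h.involutive hmem hfix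
      rw [hm.isCentralRun_iff hr] at hcentral
      obtain ⟨hpx, hxp, -⟩ := (hm.mem_extendedComponent hr).1 hmem
      rw [hfix] at hi
      omega
    · have hhalves := h.antidiagonal p q hr x hmem hfix
      rw [hm.mem_leftHalf hr, hm.mem_rightHalf hr, hm.mem_leftHalf hr, hm.mem_rightHalf hr]
        at hhalves
      omega

theorem isAntiToeplitz (hr : IsMarkedRun m p q) {τ : ℤ → ℤ} (hτ : ∀ x : Fin n, τ x = σ x) :
    IsAntiToeplitz τ (blockSum c p) p q := by
  have coe_kappa_of_mem : ∀ y ∈ extendedComponent c p q,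
      ((kappa c y : Fin n) : ℤ) = blockSum c p - y := fun y hy => by
    rw [coe_kappa, blockSum_congr (hm.index_eq_of_mem_extendedComponent hr hy)]
  have isMeander : IsMeander (kappa c) σ (extendedComponent c p q) := by
    by_cases hcentral : IsCentralRun c q
    · exact (h.edge p q hr hcentral).1
    · exact (h.loop p q hr hcentral).1
  have nonempty_preimage : ∀ T ⊆ runSet (blockSum c p) p q, T.Nonempty →
      (extendedComponent c p q ∩ {w : Fin n | (w : ℤ) ∈ T}).Nonempty := by
    rintro T hT ⟨z, hz⟩
    obtain ⟨y, hy, rfl⟩ := hm.exists_mem_extendedComponent hr (hT hz)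
    exact ⟨y, hy, hz⟩
  refine ⟨fun z hz => ?_, fun T hT hne hTσ hTκ z hz => ?_, fun hq T hT hne hTκσ z hz => ?_⟩ <;>
    obtain ⟨y, hy, rfl⟩ := hm.exists_mem_extendedComponent hr hz
  · rw [hτ, ← hm.mem_extendedComponent hr]
    exact h.stable p q hr y hy
  · refine isMeander.subset (nonempty_preimage T hT hne) (fun w hw => ?_) (fun w hw => ?_) hy
    · rw [Set.mem_ofPred_eq, coe_kappa_of_mem w ((hm.mem_extendedComponent hr).2 (hT hw))]
      exact hTκ _ hw
    · rw [Set.mem_ofPred_eq, ← hτ]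
      exact hTσ _ hw
  · have isEdge := h.edge p q hr ((hm.isCentralRun_iff hr).2 hq)
    refine isEdge.subset (nonempty_preimage T hT hne) (fun w hw => ?_) hy
    have hw' := h.stable p q hr w ((hm.mem_extendedComponent hr).2 (hT hw))
    rw [Set.mem_ofPred_eq, coe_kappa_of_mem _ hw', ← hτ]
    exact hTκσ _ hw

end IsModifiedInvolution

end Modified

section Intervals

variable {n : ℕ}

/-- The extension of a function on `Fin n` to the integers by the identity. -/
noncomputable def extendFin (f : Fin n → ℤ) : ℤ → ℤ :=
  Function.extend (fun x : Fin n => (x : ℤ)) f id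

theorem coe_fin_injective : Function.Injective fun x : Fin n => (x : ℤ) :=
  fun _ _ h => Fin.ext (Int.ofNat_inj.1 h)

theorem extendFin_coe (f : Fin n → ℤ) (x : Fin n) : extendFin f x = f x :=
  coe_fin_injective.extend_apply f id x

theorem extendFin_of_not {f : Fin n → ℤ} {x : ℤ} (h : ¬ ∃ y : Fin n, (y : ℤ) = x) :
    extendFin f x = x :=
  Function.extend_apply' f id x h

theorem extendFin_eq_of_mem_block {c : Composition n} {f : Fin n → ℤ}
    (hf : ∀ x y, c.index x = c.index y → f x = f y) {x y : ℤ}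
    (hlo : extendFin (blockLo c) x ≤ y) (hhi : y ≤ extendFin (blockHi c) x) :
    extendFin f y = extendFin f x := by
  by_cases hx : ∃ z : Fin n, (z : ℤ) = x
  · obtain ⟨x, rfl⟩ := hx
    rw [extendFin_coe] at hlo hhi
    obtain ⟨y, rfl⟩ := exists_fin_of_mem_block hlo hhi
    rw [extendFin_coe, extendFin_coe, hf y x (index_eq_of_mem_block hlo hhi)]
  · rw [extendFin_of_not hx] at hlo hhi
    rw [le_antisymm hhi hlo]

/-- The interval partitions of a double partition, extended to the integers: an integer outside
`[1, n]` is an interval of its own. -/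
noncomputable def DoublePartition.intervals (D : DoublePartition n) : IntervalPair where
  lo s := extendFin (blockLo (D.part s))
  hi s := extendFin (blockHi (D.part s))
  lo_le s x := by
    by_cases hx : ∃ y : Fin n, (y : ℤ) = x
    · obtain ⟨y, rfl⟩ := hx
      exact extendFin_coe _ y ▸ blockLo_le _ y
    · rw [extendFin_of_not hx]
  le_hi s x := by
    by_cases hx : ∃ y : Fin n, (y : ℤ) = x
    · obtain ⟨y, rfl⟩ := hx
      exact extendFin_coe _ y ▸ le_blockHi _ y
    · rw [extendFin_of_not hx]
  lo_eq _ _ _ := extendFin_eq_of_mem_block fun _ _ => blockLo_congr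
  hi_eq _ _ _ := extendFin_eq_of_mem_block fun _ _ => blockHi_congr

variable {D : DoublePartition n} {s : Side} {x : ℤ}

theorem intervals_lo_coe (s : Side) (x : Fin n) : D.intervals.lo s x = blockLo (D.part s) x :=
  extendFin_coe _ x

theorem intervals_hi_coe (s : Side) (x : Fin n) : D.intervals.hi s x = blockHi (D.part s) x :=
  extendFin_coe _ x

theorem intervals_sum_coe (s : Side) (x : Fin n) : D.intervals.sum s x = blockSum (D.part s) x := by
  rw [IntervalPair.sum, intervals_lo_coe, intervals_hi_coe, blockSum]

theorem intervals_hi_of_not (hx : ¬ ∃ y : Fin n, (y : ℤ) = x) : D.intervals.hi s x = x :=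
  extendFin_of_not hx

theorem intervals_sum_of_not (hx : ¬ ∃ y : Fin n, (y : ℤ) = x) : D.intervals.sum s x = 2 * x := by
  rw [IntervalPair.sum, intervals_hi_of_not hx, two_mul]
  exact congrArg (· + x) (extendFin_of_not hx)

theorem exists_fin_of_lt_hi (h : x < D.intervals.hi s x) : ∃ y : Fin n, (y : ℤ) = x := by
  by_contra hx
  rw [intervals_hi_of_not hx] at h
  exact h.false

end Intervals

section Marking

variable {n : ℕ} {D : DoublePartition n}

theorem sameMeander_equivalence (D : DoublePartition n) : Equivalence (SameMeander D) :=
  Relation.EqvGen.is_equivalence _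

theorem SameMeander.mem_of_stable {T : Set (Fin n)}
    (hT : ∀ s i j, DynkinSwap (D.part s) i j → i ∈ T → j ∈ T) {i j : Fin n}
    (h : SameMeander D i j) (hi : i ∈ T) : j ∈ T := by
  suffices hiff : i ∈ T ↔ j ∈ T from hiff.1 hi
  clear hi
  induction h with
  | rel i j hij =>
    obtain ⟨s, hij⟩ := hij
    exact ⟨hT s i j hij, hT s j i hij.symm⟩
  | refl i => exact Iff.rfl
  | symm i j _ ih => exact ih.symm
  | trans i j l _ _ ih₁ ih₂ => exact ih₁.trans ih₂

theorem eq_or_eq_of_sameMeander {i i' j : Fin n} (hswap : ∀ s, DynkinSwap (D.part s) i i')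
    (h : SameMeander D i j) : j = i ∨ j = i' := by
  refine h.mem_of_stable (T := {i, i'}) ?_ (Or.inl rfl)
  rintro s a b hab (rfl | rfl)
  · exact Or.inr (hab.right_unique (hswap s))
  · exact Or.inl (hab.right_unique (hswap s).symm)

/-- Two half-integers are equal or lie on one meander in `[1, n]`. -/
def SameMeanderInt (D : DoublePartition n) (i j : ℤ) : Prop :=
  i = j ∨ ∃ a b : Fin n, (a : ℤ) = i ∧ (b : ℤ) = j ∧ SameMeander D a b

theorem sameMeanderInt_coe {a b : Fin n} : SameMeanderInt D a b ↔ SameMeander D a b := by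
  constructor
  · rintro (h | ⟨a', b', ha, hb, h⟩)
    · obtain rfl := coe_fin_injective h
      exact (sameMeander_equivalence D).refl _
    · obtain rfl := coe_fin_injective ha
      obtain rfl := coe_fin_injective hb
      exact h
  · exact fun h => Or.inr ⟨a, b, rfl, rfl, h⟩

theorem sameMeanderInt_equivalence (D : DoublePartition n) : Equivalence (SameMeanderInt D) where
  refl _ := Or.inl rfl
  symm := by
    rintro _ _ (rfl | ⟨a, b, rfl, rfl, h⟩)
    · exact Or.inl rfl
    · exact Or.inr ⟨b, a, rfl, rfl, (sameMeander_equivalence D).symm h⟩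
  trans := by
    rintro _ _ _ (rfl | ⟨a, b, rfl, rfl, h⟩) h'
    · exact h'
    · rcases h' with rfl | ⟨b', c, hb, rfl, h'⟩
      · exact Or.inr ⟨a, b, rfl, rfl, h⟩
      · obtain rfl := coe_fin_injective hb
        exact Or.inr ⟨a, c, rfl, rfl, (sameMeander_equivalence D).trans h h'⟩

namespace HalfArc

variable (a : HalfArc D) {i : Fin n}

theorem coe_right : (a.right : ℤ) = blockSum (D.part a.side) a.left - 1 - a.left :=
  (dynkinSwap_iff.1 a.swap).2

theorem left_add_one_lt : (a.left : ℕ) + 1 < n := by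
  have hlt := (dynkinSwap_iff.1 a.swap).1
  have hhi := blockHi_lt (D.part a.side) a.left
  omega

variable {a}

theorem sameMeander (hi : i = a.left ∨ i = a.right) : SameMeander D i a.left := by
  rcases hi with rfl | rfl
  · exact (sameMeander_equivalence D).refl _
  · exact (sameMeander_equivalence D).symm (.rel _ _ ⟨a.side, a.swap⟩)

theorem exists_dynkinSwap (hi : i = a.left ∨ i = a.right) : ∃ i', DynkinSwap (D.part a.side) i i' ∧
    ∀ j, j = a.left ∨ j = a.right ↔ j = i ∨ j = i' := by
  rcases hi with rfl | rfl
  exacts [⟨_, a.swap, fun _ => Iff.rfl⟩, ⟨_, a.swap.symm, fun _ => or_comm⟩]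

end HalfArc

theorem isLeftSet_markedPoints (𝓜 : Set (HalfArc D)) (s : Side) :
    IsLeftSet (D.part s) (markedPoints 𝓜 s) := by
  rintro _ ⟨a, -, rfl, rfl⟩
  have hle : (a.left : ℤ) ≤ a.right := Int.ofNat_le.2 a.le
  have hright := a.coe_right
  exact ⟨(dynkinSwap_iff.1 a.swap).1, by omega⟩

theorem isMarkedHalf_markedPoints_iff {𝓜 : Set (HalfArc D)} {s : Side} {i : ℤ} :
    IsMarkedHalf (D.part s) (markedPoints 𝓜 s) i ↔
      ∃ a ∈ 𝓜, a.side = s ∧ ∃ j : Fin n, (j = a.left ∨ j = a.right) ∧ (j : ℤ) = i := by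
  constructor
  · rintro ⟨_, ⟨a, ha, rfl, rfl⟩, hi⟩
    rw [← a.coe_right] at hi
    rcases hi with rfl | rfl
    exacts [⟨a, ha, rfl, _, Or.inl rfl, rfl⟩, ⟨a, ha, rfl, _, Or.inr rfl, rfl⟩]
  · rintro ⟨a, ha, rfl, j, hj, rfl⟩
    refine ⟨a.left, ⟨a, ha, rfl, rfl⟩, ?_⟩
    rw [← a.coe_right]
    rcases hj with rfl | rfl
    exacts [Or.inl rfl, Or.inr rfl]

end Marking

section Transfer

variable {n : ℕ} {D : DoublePartition n} {𝓜 : Set (HalfArc D)} {s t : Side} {i j : ℤ}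

theorem sameMeanderInt_mirror (hi : i < D.intervals.hi s i) :
    SameMeanderInt D i (D.intervals.sum s i - 1 - i) := by
  obtain ⟨i, rfl⟩ := exists_fin_of_lt_hi hi
  rw [intervals_hi_coe] at hi
  obtain ⟨i', hi', hswap⟩ := exists_dynkinSwap hi
  rw [intervals_sum_coe, ← hi']
  exact sameMeanderInt_coe.2 (.rel _ _ ⟨s, hswap⟩)

theorem lt_hi_of_isMarkedHalf (h : IsMarkedHalf (D.part s) (markedPoints 𝓜 s) i) :
    i < D.intervals.hi s i := by
  obtain ⟨a, -, rfl, i, hi, rfl⟩ := isMarkedHalf_markedPoints_iff.1 h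
  obtain ⟨i', hswap, -⟩ := HalfArc.exists_dynkinSwap hi
  rw [intervals_hi_coe]
  exact (dynkinSwap_iff.1 hswap).1

theorem isMarkedHalf_mirror (h : IsMarkedHalf (D.part s) (markedPoints 𝓜 s) i) :
    IsMarkedHalf (D.part s) (markedPoints 𝓜 s) (D.intervals.sum s i - 1 - i) := by
  obtain ⟨a, ha, rfl, i, hi, rfl⟩ := isMarkedHalf_markedPoints_iff.1 h
  obtain ⟨i', hswap, hends⟩ := HalfArc.exists_dynkinSwap hi
  rw [intervals_sum_coe, ← (dynkinSwap_iff.1 hswap).2]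
  exact isMarkedHalf_markedPoints_iff.2 ⟨a, ha, rfl, i', (hends i').2 (Or.inr rfl), rfl⟩

namespace IsMarking

variable (h𝓜 : IsMarking D 𝓜)
include h𝓜

theorem eq_of_sameMeander {a b : HalfArc D} (ha : a ∈ 𝓜) (hb : b ∈ 𝓜)
    (h : SameMeander D a.left b.left) : a = b := by
  obtain ⟨c, -, -, hunique, -⟩ := h𝓜 a.left a.left_add_one_lt
  rw [hunique a ha ((sameMeander_equivalence D).refl _), hunique b hb h]

theorem isEnd_of_sameMeander {a b : HalfArc D} (ha : a ∈ 𝓜) (hb : b.IsEnd)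
    (h : SameMeander D a.left b.left) : a.IsEnd := by
  obtain ⟨c, -, -, hunique, hend⟩ := h𝓜 a.left a.left_add_one_lt
  rw [hunique a ha ((sameMeander_equivalence D).refl _)]
  exact hend ⟨b, h, hb⟩

theorem isMarkedHalf_unique (hi : IsMarkedHalf (D.part s) (markedPoints 𝓜 s) i)
    (hj : IsMarkedHalf (D.part t) (markedPoints 𝓜 t) j) (hij : SameMeanderInt D i j) :
    s = t ∧ (j = i ∨ j = D.intervals.sum s i - 1 - i) := by
  have hequiv := sameMeander_equivalence D
  obtain ⟨a, ha, rfl, i, hia, rfl⟩ := isMarkedHalf_markedPoints_iff.1 hi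
  obtain ⟨b, hb, rfl, j, hjb, rfl⟩ := isMarkedHalf_markedPoints_iff.1 hj
  obtain rfl : a = b := h𝓜.eq_of_sameMeander ha hb <|
    hequiv.trans (hequiv.symm (HalfArc.sameMeander hia)) <|
      hequiv.trans (sameMeanderInt_coe.1 hij) (HalfArc.sameMeander hjb)
  obtain ⟨i', hswap, hends⟩ := HalfArc.exists_dynkinSwap hia
  rw [intervals_sum_coe, ← (dynkinSwap_iff.1 hswap).2]
  refine ⟨rfl, ?_⟩
  rcases (hends j).1 hjb with rfl | rfl
  exacts [Or.inl rfl, Or.inr rfl]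

theorem two_mul_eq_of_end (hi : IsMarkedHalf (D.part s) (markedPoints 𝓜 s) i)
    (hij : SameMeanderInt D i j) (hj : 2 * j = D.intervals.sum t j - 1) :
    2 * i = D.intervals.sum s i - 1 := by
  have hequiv := sameMeander_equivalence D
  obtain ⟨a, ha, rfl, i, hia, rfl⟩ := isMarkedHalf_markedPoints_iff.1 hi
  obtain ⟨j, rfl⟩ : ∃ y : Fin n, (y : ℤ) = j := by
    by_contra hout
    rw [intervals_sum_of_not hout] at hj
    omega
  rw [intervals_sum_coe, ← dynkinSwap_self_iff] at hj
  rw [intervals_sum_coe, ← dynkinSwap_self_iff]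
  have hend : a.left = a.right := h𝓜.isEnd_of_sameMeander (b := ⟨t, j, j, le_rfl, hj⟩) ha rfl <|
    hequiv.trans (hequiv.symm (HalfArc.sameMeander hia)) (sameMeanderInt_coe.1 hij)
  obtain rfl : i = a.left := hia.elim id fun h => h.trans hend.symm
  nth_rw 2 [hend]
  exact a.swap

-- Where both reversals agree, the half-integer meander is one arc above and the same arc below.
theorem exists_isMarkedHalf (hi : ∀ s, i < D.intervals.hi s i)
    (hsum : D.intervals.sum .above i = D.intervals.sum .below i) :
    ∃ s, IsMarkedHalf (D.part s) (markedPoints 𝓜 s) i := by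
  obtain ⟨i, rfl⟩ := exists_fin_of_lt_hi (hi .above)
  simp only [intervals_hi_coe] at hi
  simp only [intervals_sum_coe] at hsum
  obtain ⟨i', hi', -⟩ := exists_dynkinSwap (hi .above)
  have hswap : ∀ s, DynkinSwap (D.part s) i i' := fun s => dynkinSwap_iff.2 ⟨hi s, by
    cases s
    exacts [hi', hsum ▸ hi']⟩
  have hlt : (i : ℕ) + 1 < n := by
    have := hi .above
    have := blockHi_lt (D.part .above) i
    omega
  obtain ⟨a, ha, hmeander, -⟩ := h𝓜 i hlt
  refine ⟨a.side, isMarkedHalf_markedPoints_iff.2 ⟨a, ha, rfl, i, ?_, rfl⟩⟩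
  rcases eq_or_eq_of_sameMeander hswap hmeander with hleft | hleft
  · exact Or.inl hleft.symm
  · exact Or.inr ((hswap a.side).symm.right_unique (hleft ▸ a.swap))

/-- The interval partitions, marks and half-integer meanders of a marking, extended to the
integers. -/
noncomputable def markedIntervalPair : MarkedIntervalPair where
  toIntervalPair := D.intervals
  Marked s := IsMarkedHalf (D.part s) (markedPoints 𝓜 s)
  SameMeander := SameMeanderInt D
  equivalence := sameMeanderInt_equivalence D
  sameMeander_mirror _ _ := sameMeanderInt_mirror
  lt_hi_of_marked _ _ := lt_hi_of_isMarkedHalf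
  marked_mirror _ _ := isMarkedHalf_mirror
  marked_unique _ _ _ _ := h𝓜.isMarkedHalf_unique
  marked_of_end _ _ _ _ := h𝓜.two_mul_eq_of_end
  exists_marked _ := h𝓜.exists_isMarkedHalf

end IsMarking

theorem IsMarkedRun.not_isMarkedHalf {p q : Fin n} (hr : IsMarkedRun (markedPoints 𝓜 s) p q) :
    ¬ IsMarkedHalf (D.part s) (markedPoints 𝓜 s) (p - 1) := by
  intro hmarked
  have hlt := lt_hi_of_isMarkedHalf hmarked
  obtain ⟨r, hr'⟩ := exists_fin_of_lt_hi hlt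
  rw [← hr'] at hmarked hlt
  rw [intervals_hi_coe] at hlt
  have hm := isLeftSet_markedPoints 𝓜 s
  obtain ⟨-, hpq, hq, -⟩ := hm.run_bounds hr
  have hlo := blockLo_le (D.part s) r
  have hindex : (D.part s).index p = (D.part s).index r :=
    index_eq_of_mem_block (by omega) (by omega)
  refine hr.2.2.1 r (by omega) (hm.mem_of_isMarkedHalf hmarked ?_)
  rw [← blockSum_congr hindex]
  omega

namespace ModifiedPair

variable (A : ModifiedPair D)

theorem exists_isModifiedRun (hi : IsMarkedHalf (D.part s) (markedPoints A.marks s) i)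
    (hle : 2 * i + 1 ≤ D.intervals.sum s i) :
    ∃ p q, A.isMarking.markedIntervalPair.IsModifiedRun (extendFin fun x => A.σ s x) s i p q := by
  obtain ⟨i, rfl⟩ := exists_fin_of_lt_hi (lt_hi_of_isMarkedHalf hi)
  have hm := isLeftSet_markedPoints A.marks s
  rw [intervals_sum_coe] at hle
  obtain ⟨p, q, hr, hpi, hiq⟩ := exists_isMarkedRun (hm.mem_of_isMarkedHalf hi hle)
  obtain ⟨hlo, -, hq, -⟩ := hm.run_bounds hr
  have hindex := hm.index_eq_of_run hr hpi hiq
  have hlo_eq : D.intervals.lo s i = blockLo (D.part s) p := by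
    rw [intervals_lo_coe, blockLo_congr hindex]
  have hsum_eq : D.intervals.sum s i = blockSum (D.part s) p := by
    rw [intervals_sum_coe, blockSum_congr hindex]
  exact ⟨p, q,
    { lo_le := hlo_eq.trans_le hlo
      le_left := Int.ofNat_le.2 hpi
      le_right := Int.ofNat_le.2 hiq
      two_mul_lt := hq.trans_eq hsum_eq.symm
      marked := fun j hpj hjq => hm.isMarkedHalf_of_run hr (Or.inl ⟨hpj, hjq⟩)
      not_marked := hr.not_isMarkedHalf
      isAntiToeplitz := hsum_eq ▸ (A.isModified s).isAntiToeplitz hm hr (extendFin_coe _) }⟩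

theorem isMarkedHalf_of_between {x : ℤ}
    (hi : (x ≤ i ∧ i < D.intervals.sum s x - extendFin (fun y => A.σ s y) x) ∨
      (D.intervals.sum s x - extendFin (fun y => A.σ s y) x ≤ i ∧ i < x)) :
    IsMarkedHalf (D.part s) (markedPoints A.marks s) i := by
  by_cases hx : ∃ y : Fin n, (y : ℤ) = x
  · obtain ⟨y, rfl⟩ := hx
    rw [extendFin_coe, intervals_sum_coe] at hi
    exact (A.isModified s).isMarkedHalf (isLeftSet_markedPoints _ s) hi
  · rw [extendFin_of_not hx, intervals_sum_of_not hx] at hi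
    omega

/-- The marked interval partitions and the modified involutions of the construction, extended to
the integers; the involutions fix every integer outside `[1, n]`. -/
noncomputable def modifiedIntervalPair : ModifiedIntervalPair where
  toMarkedIntervalPair := A.isMarking.markedIntervalPair
  σ s := extendFin fun x => A.σ s x
  σ_σ s x := by
    by_cases hx : ∃ y : Fin n, (y : ℤ) = x
    · obtain ⟨y, rfl⟩ := hx
      rw [extendFin_coe, extendFin_coe, (A.isModified s).involutive]
    · rw [extendFin_of_not hx, extendFin_of_not hx]
  lo_σ s x := by
    by_cases hx : ∃ y : Fin n, (y : ℤ) = x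
    · obtain ⟨y, rfl⟩ := hx
      rw [extendFin_coe]
      exact (intervals_lo_coe s _).trans <| (blockLo_congr <|
        (A.isModified s).index_apply (isLeftSet_markedPoints _ s) y).trans
          (intervals_lo_coe s y).symm
    · rw [extendFin_of_not hx]
  antidiagonal s x hlt := by
    obtain ⟨y, rfl⟩ : ∃ y : Fin n, (y : ℤ) = x := by
      by_contra hx
      exact hlt.ne (extendFin_of_not hx).symm
    rw [extendFin_coe] at hlt ⊢
    have := (A.isModified s).two_mul_le_and_le_two_mul (isLeftSet_markedPoints _ s) hlt
    rwa [← intervals_sum_coe] at this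
  marked_of_lt _ _ _ hle hlt := A.isMarkedHalf_of_between (Or.inl ⟨hle, hlt⟩)
  marked_of_gt _ _ _ hle hlt := A.isMarkedHalf_of_between (Or.inr ⟨hle, hlt⟩)
  exists_run _ _ := A.exists_isModifiedRun

theorem modifiedIntervalPair_σ_coe (s : Side) (x : Fin n) :
    A.modifiedIntervalPair.σ s x = (A.σ s x : ℕ) :=
  extendFin_coe (fun x => ((A.σ s x : ℕ) : ℤ)) x

end ModifiedPair

end Transfer

/-! ### Adapted orders of the basis -/

section AdaptedOrder

open Relation

theorem IsArcSystem.comap {V W γ : Type*} {S Link : W → W → Prop} {δ : W → ℤ} {cell : W → γ}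
    (H : IsArcSystem S Link δ cell) {f : V → W} (hf : Function.Injective f)
    (hpred : ∀ a y, S y (f a) → y ∈ Set.range f) (hsucc : ∀ a y, S (f a) y → y ∈ Set.range f) :
    IsArcSystem (fun a b => S (f a) (f b)) (fun a b => Link (f a) (f b)) (fun a => δ (f a))
      fun a => cell (f a) := by
  have source {a} (h : ∀ b, ¬ S (f b) (f a)) (y : W) : ¬ S y (f a) := fun hy => by
    obtain ⟨b, rfl⟩ := hpred a y hy
    exact h b hy
  have sink {a} (h : ∀ b, ¬ S (f a) (f b)) (y : W) : ¬ S (f a) y := fun hy => by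
    obtain ⟨b, rfl⟩ := hsucc a y hy
    exact h b hy
  exact
  { acyclic := fun v h => H.acyclic (f v) (TransGen.lift f (fun _ _ h => h) _ _ h)
    cell_eq_or_cross := fun _ _ => H.cell_eq_or_cross _ _
    δ_eq := fun _ _ => H.δ_eq _ _
    fork := fun _ ⟨s, t, hs, ht, hst⟩ =>
      (H.fork _ ⟨f s, f t, hs, ht, hf.ne hst⟩).imp_left fun h _ => h _
    join := fun _ ⟨s, t, hs, ht, hst⟩ =>
      (H.join _ ⟨f s, f t, hs, ht, hf.ne hst⟩).imp_left fun h _ => h _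
    succ_eq_or_eq := fun _ _ _ _ hs ht hst hu =>
      (H.succ_eq_or_eq _ _ _ _ hs ht (hf.ne hst) hu).imp (@hf _ _) (@hf _ _)
    pred_eq_or_eq := fun _ _ _ _ hs ht hst hu =>
      (H.pred_eq_or_eq _ _ _ _ hs ht (hf.ne hst) hu).imp (@hf _ _) (@hf _ _)
    nonpos_of_source := fun _ _ huv hu => H.nonpos_of_source _ _ huv (source hu)
    nonneg_of_sink := fun _ _ huv hv => H.nonneg_of_sink _ _ huv (sink hv)
    link_of_le := fun _ _ => H.link_of_le _ _
    link_of_fork := fun _ _ _ _ _ hs ht hst => H.link_of_fork _ _ _ _ _ hs ht (hf.ne hst)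
    link_of_join := fun _ _ _ _ _ hs ht hst => H.link_of_join _ _ _ _ _ hs ht (hf.ne hst)
    cell_ne_of_join := fun _ _ _ hs ht hst => H.cell_ne_of_join _ _ _ hs ht (hf.ne hst)
    common_succ_unique := fun _ _ _ _ huw hvw hux hvx huv =>
      hf (H.common_succ_unique _ _ _ _ huw hvw hux hvx (hf.ne huv))
    source_unique := fun _ _ h0 huv hu hv =>
      hf (H.source_unique _ _ h0 huv (source hu) (source hv))
    isolated_unique := fun _ _ huv hu hu' hv hv' =>
      hf (H.isolated_unique _ _ huv (source hu) (sink hu') (source hv) (sink hv')) }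

namespace IsLinkedSequence

variable {V : Type*} {S Link : V → V → Prop} {l : List V}

theorem pairwise (h : IsLinkedSequence S Link l) : l.Pairwise fun u v => ¬ S v u := by
  induction h with
  | nil => exact List.Pairwise.nil
  | snoc good available _ ih =>
    refine List.pairwise_append.2 ⟨ih, List.pairwise_singleton _ _, fun u hu v hv hvu => ?_⟩
    obtain rfl := List.mem_singleton.1 hv
    exact available.1 (good.mem_of_pred hu hvu)

theorem isChain (h : IsLinkedSequence S Link l) : l.IsChain fun u v => S u v ∨ Link u v := by
  induction h with
  | nil => exact List.IsChain.nil
  | snoc _ _ link ih =>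
    exact ih.append (List.isChain_singleton _) fun u hu v hv => by
      obtain rfl := Option.some_inj.1 hv
      exact link u hu

theorem exists_equiv {n : ℕ} [Fintype V] (h : IsLinkedSequence S Link l) (hS : ∀ v, ¬ S v v)
    (hmem : ∀ v, v ∈ l) (hn : Fintype.card V = n) :
    ∃ e : Fin n ≃ V, (∀ i j, S (e i) (e j) → i < j) ∧
      ∀ i j : Fin n, (j : ℕ) = i + 1 → S (e i) (e j) ∨ Link (e i) (e j) := by
  classical
  let e := h.nodup.getEquivOfForallMemList l hmem
  obtain rfl : l.length = n := by rw [← hn, ← Fintype.card_congr e, Fintype.card_fin]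
  refine ⟨e, fun i j hij => ?_, fun i j hij => ?_⟩
  · rcases lt_trichotomy i j with hlt | rfl | hgt
    · exact hlt
    · exact absurd hij (hS _)
    · exact absurd hij (List.pairwise_iff_get.1 h.pairwise j i hgt)
  · obtain ⟨j, hj⟩ := j
    obtain rfl : j = i + 1 := hij
    exact h.isChain.getElem i hj

end IsLinkedSequence

variable {n : ℕ} {D : DoublePartition n}

/-- The root `ε_a - ε_b` belongs to the set `S`. -/
def ModifiedPair.Arrow (A : ModifiedPair D) (a b : Fin n) : Prop :=
  (a < b ∧ A.σ .above a = b) ∨ (b < a ∧ A.σ .below a = b)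

/-- The matrix unit `E_{ab}` is orthogonal to the biparabolic subalgebra for the trace form. -/
def DoublePartition.Off (D : DoublePartition n) (a b : Fin n) : Prop :=
  (a < b ∧ D.pos.index a ≠ D.pos.index b) ∨ (b < a ∧ D.neg.index a ≠ D.neg.index b)

theorem intervals_off_coe {a b : Fin n} : D.intervals.Off a b ↔ D.Off a b := by
  simp only [IntervalPair.Off, DoublePartition.Off, intervals_lo_coe, ne_eq, blockLo_eq_iff,
    Fin.lt_def, Nat.cast_lt, DoublePartition.part]

namespace ModifiedPair

variable (A : ModifiedPair D)

theorem mem_roots {α : Root n} : α ∈ A.roots ↔ A.Arrow α.1.1 α.1.2 :=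
  Finset.mem_filter.trans (and_iff_right (Finset.mem_univ _))

theorem modifiedIntervalPair_arrow_coe {a b : Fin n} :
    A.modifiedIntervalPair.Arrow a b ↔ A.Arrow a b := by
  simp only [ModifiedIntervalPair.Arrow, Arrow, modifiedIntervalPair_σ_coe, Fin.lt_def,
    Fin.ext_iff, Nat.cast_inj, Nat.cast_lt]

theorem isArcSystem :
    IsArcSystem A.Arrow D.Off (fun a => D.intervals.diff a) fun a => D.intervals.cell a := by
  have coe_mem (s : Side) (a : Fin n) :
      A.modifiedIntervalPair.σ s a ∈ Set.range fun b : Fin n => (b : ℤ) :=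
    ⟨A.σ s a, (A.modifiedIntervalPair_σ_coe s a).symm⟩
  have pred_mem (a : Fin n) (y : ℤ) (hy : A.modifiedIntervalPair.Arrow y a) :
      y ∈ Set.range fun b : Fin n => (b : ℤ) := by
    rcases A.modifiedIntervalPair.arrow_comm.1 hy with ⟨-, rfl⟩ | ⟨-, rfl⟩
    exacts [coe_mem _ a, coe_mem _ a]
  have succ_mem (a : Fin n) (y : ℤ) (hy : A.modifiedIntervalPair.Arrow a y) :
      y ∈ Set.range fun b : Fin n => (b : ℤ) := by
    rcases hy with ⟨-, rfl⟩ | ⟨-, rfl⟩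
    exacts [coe_mem _ a, coe_mem _ a]
  have H := A.modifiedIntervalPair.isArcSystem.comap coe_fin_injective pred_mem succ_mem
  simp only [modifiedIntervalPair_arrow_coe] at H
  exact (funext₂ fun _ _ => propext intervals_off_coe : _ = D.Off) ▸ H

theorem exists_adapted_order :
    ∃ e : Fin n ≃ Fin n, (∀ i j, A.Arrow (e i) (e j) → i < j) ∧
      ∀ i j : Fin n, (j : ℕ) = i + 1 → A.Arrow (e i) (e j) ∨ D.Off (e i) (e j) := by
  obtain ⟨l, hl, hmem⟩ := A.isArcSystem.exists_isLinkedSequence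
  exact hl.exists_equiv (fun v hv => A.isArcSystem.acyclic v (.single hv)) hmem (Fintype.card_fin n)

end ModifiedPair

end AdaptedOrder

/-! ### The regular nilpotent extension of `η` -/

section Extension

attribute [local instance 100] LieRing.ofAssociativeRing

variable {n : ℕ} {D : DoublePartition n} {k : Type*} [Field k]

theorem restrictForm_killingForm_eq_zero {N : sl (Fin n) k}
    (hN : ∀ a b, N.val a b ≠ 0 → D.Off a b) :
    restrictForm k D (killingForm k (sl (Fin n) k) N) = 0 := by
  ext x
  obtain ⟨lower, upper⟩ := x.1.2
  change killingForm k (sl (Fin n) k) N x.1.1 = 0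
  rw [killingForm_sl]
  refine mul_eq_zero_of_right _ (Finset.sum_eq_zero fun a _ => ?_)
  rw [Matrix.diag_apply, Matrix.mul_apply]
  refine Finset.sum_eq_zero fun b _ => ?_
  by_cases hab : N.val a b = 0
  · exact mul_eq_zero_of_left hab _
  · refine mul_eq_zero_of_right _ ?_
    rcases hN a b hab with ⟨hlt, hne⟩ | ⟨hlt, hne⟩
    exacts [upper b a fun h => h.elim hlt.not_ge fun h => hne h.symm,
      lower b a fun h => h.elim hlt.not_ge fun h => hne h.symm]

/-- The sum of the matrix units in the positions `(e i, e (i + 1))` at which `P` holds: they are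
added to a sum of root vectors to make its superdiagonal, in the order `e` of the basis, non-zero
everywhere. -/
def superdiagonalUnits (k : Type*) [Field k] (e : Fin n ≃ Fin n) (P : Fin n → Fin n → Prop)
    [DecidableRel P] : Matrix (Fin n) (Fin n) k :=
  fun a b => if (e.symm b : ℕ) = e.symm a + 1 ∧ P a b then 1 else 0

section SuperdiagonalUnits

variable (e : Fin n ≃ Fin n) (P : Fin n → Fin n → Prop) [DecidableRel P]

theorem trace_superdiagonalUnits : (superdiagonalUnits k e P).trace = 0 :=
  Finset.sum_eq_zero fun _ _ => if_neg fun h => Nat.succ_ne_self _ h.1.symm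

theorem superdiagonalUnits_apply (i j : Fin n) : superdiagonalUnits k e P (e i) (e j) =
    if (j : ℕ) = i + 1 ∧ P (e i) (e j) then 1 else 0 := by
  simp [superdiagonalUnits]

end SuperdiagonalUnits

namespace ModifiedPair

variable (A : ModifiedPair D) (u : Root n → kˣ)

theorem sum_roots_apply (a b : Fin n) :
    (∑ α ∈ A.roots, single α.1.1 α.1.2 α.2 (u α : k) : sl (Fin n) k).val a b =
      ∑ α ∈ A.roots, if α.1 = (a, b) then (u α : k) else 0 := by
  have val_sum := map_sum (sl (Fin n) k).toSubmodule.subtype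
    (fun α : Root n => single α.1.1 α.1.2 α.2 (u α : k)) A.roots
  refine (congrFun₂ val_sum a b).trans ?_
  rw [Matrix.sum_apply]
  refine Finset.sum_congr rfl fun α _ => ?_
  change (single α.1.1 α.1.2 α.2 (u α : k)).val a b = _
  rw [val_single, Matrix.single_apply]
  simp only [Prod.ext_iff]

theorem sum_roots_eq_zero {a b : Fin n} (h : ¬ A.Arrow a b) :
    (∑ α ∈ A.roots, single α.1.1 α.1.2 α.2 (u α : k) : sl (Fin n) k).val a b = 0 := by
  rw [sum_roots_apply]
  refine Finset.sum_eq_zero fun α hα => if_neg fun hab => h ?_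
  rwa [A.mem_roots, hab] at hα

theorem sum_roots_ne_zero {a b : Fin n} (h : A.Arrow a b) :
    (∑ α ∈ A.roots, single α.1.1 α.1.2 α.2 (u α : k) : sl (Fin n) k).val a b ≠ 0 := by
  have hab : a ≠ b := h.elim (fun h => h.1.ne) fun h => h.1.ne'
  rw [sum_roots_apply, Finset.sum_eq_single_of_mem ⟨(a, b), hab⟩ (A.mem_roots.2 h)
    fun β _ hβ => if_neg fun hβab => hβ (Subtype.ext hβab), if_pos rfl]
  exact (u _).ne_zero

theorem exists_regular_nilpotent (hn : (2 * n : k) ≠ 0) :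
    ∃ y : Module.Dual k (sl (Fin n) k),
      IsRegularForm k y ∧ IsNilpotentForm k y ∧ restrictForm k D y = A.eta u := by
  classical
  obtain ⟨e, lt_of_arrow, arrow_or_off⟩ := A.exists_adapted_order
  let X : sl (Fin n) k := ∑ α ∈ A.roots, single α.1.1 α.1.2 α.2 (u α : k)
  let P (a b : Fin n) : Prop := ¬ A.Arrow a b
  let N : sl (Fin n) k := ⟨superdiagonalUnits k e P, trace_superdiagonalUnits e P⟩
  have add_apply (i j : Fin n) : (X + N).val (e i) (e j) = X.val (e i) (e j) +
      if (j : ℕ) = i + 1 ∧ ¬ A.Arrow (e i) (e j) then 1 else 0 :=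
    congrArg (X.val (e i) (e j) + ·) (superdiagonalUnits_apply e P i j)
  have upper (i j : Fin n) (hij : j ≤ i) : (X + N).val (e i) (e j) = 0 := by
    rw [add_apply, A.sum_roots_eq_zero u fun h => (lt_of_arrow i j h).not_ge hij, zero_add]
    exact if_neg fun h => by omega
  have superdiagonal (i j : Fin n) (hij : (j : ℕ) = i + 1) : (X + N).val (e i) (e j) ≠ 0 := by
    rw [add_apply]
    by_cases h : A.Arrow (e i) (e j)
    · rw [if_neg fun h' => h'.2 h, add_zero]
      exact A.sum_roots_ne_zero u h
    · rw [A.sum_roots_eq_zero u h, zero_add, if_pos ⟨hij, h⟩]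
      exact one_ne_zero
  have restrict_N : restrictForm k D (killingForm k (sl (Fin n) k) N) = 0 := by
    refine restrictForm_killingForm_eq_zero fun a b hab => ?_
    obtain ⟨i, rfl⟩ := e.surjective a
    obtain ⟨j, rfl⟩ := e.surjective b
    replace hab := (superdiagonalUnits_apply e P i j).symm.trans_ne hab
    obtain ⟨hij, h⟩ := (ite_ne_right_iff.1 hab).1
    exact (arrow_or_off i j hij).resolve_left h
  obtain ⟨regular, nilpotent⟩ :=
    isRegularForm_isNilpotentForm_killingForm hn (X + N) e upper superdiagonal
  refine ⟨_, regular, nilpotent, ?_⟩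
  rw [map_add]
  exact (congrArg (A.eta u + ·) restrict_N).trans (add_zero _)

end ModifiedPair

end Extension

end Biparabolic

theorem theorem9p1_general {k : Type*} [Field k] {n : ℕ} (hn : (2 * n : k) ≠ 0)
    (D : Biparabolic.DoublePartition n) :
    (∀ (P : Biparabolic.ModifiedPair D) (u : Biparabolic.Root n → kˣ),
      ∃ y : Module.Dual k (LieAlgebra.SpecialLinear.sl (Fin n) k),
        Biparabolic.IsRegularForm k y ∧ Biparabolic.IsNilpotentForm k y ∧
          Biparabolic.restrictForm k D y = P.eta u) ∧
    (∀ h η, (h, η) ∈ Biparabolic.constructedAdaptedPairs k D →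
      ∃ y : Module.Dual k (LieAlgebra.SpecialLinear.sl (Fin n) k),
        Biparabolic.IsRegularForm k y ∧ Biparabolic.IsNilpotentForm k y ∧
          Biparabolic.restrictForm k D y = η) := by
  refine ⟨fun P u => P.exists_regular_nilpotent u hn, ?_⟩
  rintro h _ ⟨-, -, P, u, rfl⟩
  exact P.exists_regular_nilpotent u hn

theorem theorem9p1 {k : Type*} [Field k] [IsAlgClosed k] [CharZero k] {n : ℕ} (hn : 1 < n)
    (D : Biparabolic.DoublePartition n) :
    (∀ (P : Biparabolic.ModifiedPair D) (u : Biparabolic.Root n → kˣ),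
      ∃ y : Module.Dual k (LieAlgebra.SpecialLinear.sl (Fin n) k),
        Biparabolic.IsRegularForm k y ∧ Biparabolic.IsNilpotentForm k y ∧
          Biparabolic.restrictForm k D y = P.eta u) ∧
    (∀ h η, (h, η) ∈ Biparabolic.constructedAdaptedPairs k D →
      ∃ y : Module.Dual k (LieAlgebra.SpecialLinear.sl (Fin n) k),
        Biparabolic.IsRegularForm k y ∧ Biparabolic.IsNilpotentForm k y ∧
          Biparabolic.restrictForm k D y = η) :=
  theorem9p1_general (by exact_mod_cast (by omega : 2 * n ≠ 0)) D
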